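/- **Model.** Fix integers $d,\mathfrak g\ge 0$ and, for each $s$, a finite set $F_s$ of nondecreasing $s$-tuples of positive integers (the data of the action $\mathcal S(D)=\operatorname{Tr}\mathcal V(D)-\sum_{s=1}^{\mathfrak g}(N/t)^{-4s}\sum_{n\in F_s}\hat\alpha_{n}\prod_{i=1}^s\operatorname{Tr}(D^{n_i})$, $\mathcal V(x)=\frac1{2t}\big(\frac{x^2}2-\sum_{k=3}^d\alpha_k\frac{x^k}k\big)$, of random matrix geometries of type $(1,0)$, with $D=\{H,\cdot\}$ and $H$ Hermitian $N\times N$). An elementary 2-cell $C$ of type $(g;\vec\ell)$, $g\ge0$, $1\le \ell_1\le\dots\le\ell_b$, $b\ge1$, is a compact connected oriented surface of genus $g$ with $b$ polygonal boundary components of perimeters $\ell_i$, up to equivalence; $\beta_0(\partial C)=b$, $\chi(C)=2-2g-b$. Let $\mathcal C$ be the finite set of the following 2-cells: $(0;\ell)$ with $3\le\ell\le d$; $(0;\ell_1,\ell_2)$ with $2\le\ell_1+\ell_2\le d$; and, for $1\le s\le\mathfrak g$, $n\in F_s$, $J\subseteq\{1,\dots,s\}$ and $1\le r_j\le n_j-1$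 $(j\in J)$, the cell $(s+1;\vec\ell)$ with $\vec\ell$ the nondecreasing rearrangement of $\big((r_j)_{j\in J},(n_j-r_j)_{j\in J},(n_i)_{i\notin J}\big)$. Let $\mathbf t=(\mathrm t_C)_{C\in\mathcal C}$ be independent formal variables. For an integer $N\ge1$ and $t>0$ let $\rho_0$ be the probability measure on Hermitian $N\times N$ matrices with density proportional to $e^{-\frac N{2t}\operatorname{Tr}H^2}$, and $$\Phi(H)=\exp\Big(\sum_{C\in\mathcal C}\frac{(N/t)^{\chi(C)}}{\beta_0(\partial C)!}\,\mathrm t_C\prod_{i}\frac{\operatorname{Tr}H^{\ell_i}}{\ell_i}\Big),\qquad X_j=\sum_{\ell\ge0}\frac{\operatorname{Tr}H^\ell}{x_j^{\ell+1}},$$ as formal power series in $\mathbf t$, resp. $x_j^{-1}$. Integrating coefficient by coefficient, put $\widehat W_{|K|}(x_K)=\rho_0[\Phi]^{-1}\rho_0\big[\Phi\prod_{j\in K}X_j\big]$ and let $W_n(x_1,\dots,x_n)=\sum_{K\vdash\{1,\dots,n\}}(-1)^{[K]-1}([K]-1)!\prod_i\widehat W_{|K_i|}(x_{K_i})$ be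 the connected correlators, where the sum is over set partitions and $[K]$ is the number of blocks. **Stuffed maps.** A closed stuffed map with $n$ marked faces and unmarked pieces in $\mathcal C$ is obtained from $n$ labelled rooted polygons (the marked faces, of perimeters $\ell_j\ge0$) and finitely many surfaces with types in $\mathcal C$ by gluing all their sides in pairs, reversing orientation; a marked face of perimeter $0$ is a sphere with a single vertex. Isomorphisms preserve all the structure and fix the marked faces with their roots. Let $\mathbb M_{g,n}(\mathcal C)$ be the set of isomorphism classes of those whose surface is connected of genus $g$. The Boltzmann weight $\mathfrak{Bw}([M])$ is $1/|\mathrm{Aut}(M)|$ times the product of $t$ for each vertex, $x_j^{-(\ell_j+1)}$ for the $j$-th marked face, and $\mathrm t_C/\nu_C$ for each unmarked piece of type $C=(g;\vec\ell)$, where $\nu_C$ is the number of distinct orderings of the tuple $\vec\ell$. **Proposition.** Let $n\ge1$. For all $g\ge0$, $$W_{g,n}(x_1,\dots,x_n)=\sum_{[M]\in\mathbb M_{g,n}(\mathcal C)}\mathfrak{Bw}([M])\in\mathbb Q[\mathbf t][[t]][[x_1^{-1},\dots,x_n^{-1}]]$$ is well defined: each monomial in $t$ and the $x_j^{-1}$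 receives finitely many nonzero contributions. Moreover, each monomial in $\mathbf t$ and the $x_j^{-1}$ occurs in $W_{g,n}$ with finitely many powers of $t$. For all integers $N\ge1$ and all $t>0$, the measure $\rho_0$ is a probability measure for which all products of traces of powers of $H$ are integrable, and $$W_n(x_1,\dots,x_n)=\sum_{g\ge0}(N/t)^{2-2g-n}\,W_{g,n}(x_1,\dots,x_n)$$ as formal power series in $\mathbf t$ and $x_1^{-1},\dots,x_n^{-1}$: each coefficient on the right has finitely many nonzero terms, and they add up to the coefficient on the left. -/

import Mathlib

open scoped Nat
open MeasureTheory

noncomputable section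

/-! ### Elementary 2-cells and the finite set of 2-cells of the model -/

/-- An elementary 2-cell, i.e. the equivalence class of a compact connected oriented surface with
nonempty polygonal boundary, given by its type `(g; ℓ₁ ≤ ℓ₂ ≤ ⋯ ≤ ℓ_b)`: the genus `g` and the
perimeters `ℓᵢ ≥ 1` of its `b ≥ 1` boundary polygons, in nondecreasing order. -/
@[ext]
structure ElemCell where
  genus : ℕ
  perims : List ℕ
  perims_ne_nil : perims ≠ []
  perims_sorted : perims.Pairwise (· ≤ ·)
  perims_pos : ∀ l ∈ perims, 1 ≤ l

namespace ElemCell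

/-- The number of boundary components. -/
def bdry (C : ElemCell) : ℕ := C.perims.length

/-- The Euler characteristic `2 - 2g - b`. -/
def euler (C : ElemCell) : ℤ := 2 - 2 * (C.genus : ℤ) - (C.bdry : ℤ)

/-- The number of distinct orderings of the tuple of perimeters,
`b! / ∏ₓ (multiplicity of x)!`. -/
def orderings (C : ElemCell) : ℚ :=
  (C.bdry ! : ℚ) / ∏ x ∈ C.perims.toFinset, ((C.perims.count x)! : ℚ)

end ElemCell

/-- The combinatorial data of the action functional
`S(D) = Tr V(D) - ∑_{s=1}^{𝔤} (N/t)^{-4s} ∑_{n ∈ idx s} α̂_n ∏ᵢ Tr D^{nᵢ}` with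
`V(x) = (1/2t) (x²/2 - ∑_{k=3}^{d} α_k x^k / k)`, where `D = {H, ·}`: the integers `d`, `𝔤`, and for
every `s` the finite set of nondecreasing `s`-tuples of positive integers that occur. -/
structure GeometryModel where
  d : ℕ
  gmax : ℕ
  idx : (s : ℕ) → Finset (Fin s → ℕ)
  idx_mono : ∀ s, ∀ n ∈ idx s, Monotone n
  idx_pos : ∀ s, ∀ n ∈ idx s, ∀ i, 1 ≤ n i

namespace GeometryModel

variable (P : GeometryModel)

/-- The unstable 2-cells: disks of perimeter `3 ≤ ℓ ≤ d`, and cylinders with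
`2 ≤ ℓ₁ + ℓ₂ ≤ d`. -/
def unstableCells : Set ElemCell :=
  {C | C.genus = 0 ∧ ∃ l, 3 ≤ l ∧ l ≤ P.d ∧ C.perims = [l]} ∪
  {C | C.genus = 0 ∧ ∃ a b, 1 ≤ a ∧ a ≤ b ∧ 2 ≤ a + b ∧ a + b ≤ P.d ∧ C.perims = [a, b]}

/-- The stable 2-cells: for `1 ≤ s ≤ 𝔤`, genus `s + 1`, and perimeters the rearrangement of
`(r_J, n_J - r_J, n_{I ∖ J})`, where `n` is one of the `s`-tuples of the model, `J ⊆ I = {1, …, s}`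
and `1 ≤ r_j ≤ n_j - 1` for `j ∈ J`. -/
def stableCells : Set ElemCell :=
  {C | ∃ s, 1 ≤ s ∧ s ≤ P.gmax ∧ C.genus = s + 1 ∧
    ∃ n ∈ P.idx s, ∃ J : Finset (Fin s), ∃ r : Fin s → ℕ,
      (∀ j ∈ J, 1 ≤ r j ∧ r j < n j) ∧
      (C.perims : Multiset ℕ) =
        ∑ j ∈ J, ({r j, n j - r j} : Multiset ℕ) + ∑ j ∈ Jᶜ, ({n j} : Multiset ℕ)}

theorem _root_.ElemCell.injective_type :
    Function.Injective (fun C : ElemCell => (C.genus, (C.perims : Multiset ℕ))) := by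
  intro C C' h
  simp only [Prod.mk.injEq, Multiset.coe_eq_coe] at h
  exact ElemCell.ext h.1 (h.2.eq_of_pairwise' C.perims_sorted C'.perims_sorted)

theorem finite_cells : (P.unstableCells ∪ P.stableCells).Finite := by
  refine Set.Finite.of_finite_image (f := fun C : ElemCell => (C.genus, (C.perims : Multiset ℕ)))
    ?_ ElemCell.injective_type.injOn
  have h1 : ((fun l : ℕ => (0, ({l} : Multiset ℕ))) '' Set.Iic P.d).Finite :=
    (Set.finite_Iic _).image _
  have h2 : ((fun p : ℕ × ℕ => (0, ({p.1, p.2} : Multiset ℕ))) ''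
      (Set.Iic P.d ×ˢ Set.Iic P.d)).Finite :=
    ((Set.finite_Iic _).prod (Set.finite_Iic _)).image _
  have h3 : (⋃ s ∈ Set.Iic P.gmax, ⋃ n ∈ (P.idx s : Set (Fin s → ℕ)),
      ⋃ J : Finset (Fin s), (fun r : Fin s → ℕ => (s + 1,
        ∑ j ∈ J, ({r j, n j - r j} : Multiset ℕ) + ∑ j ∈ Jᶜ, ({n j} : Multiset ℕ))) ''
          Set.Iic n).Finite := by
    refine (Set.finite_Iic _).biUnion fun s _ => (Finset.finite_toSet _).biUnion fun n _ => ?_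
    exact Set.finite_iUnion fun J => (Set.finite_Iic n).image _
  refine ((h1.union h2).union h3).subset ?_
  rintro _ ⟨C, hC, rfl⟩
  rcases hC with (⟨hg, l, -, hl, hp⟩ | ⟨hg, a, b, -, -, -, hab, hp⟩) |
    ⟨s, -, hs, hg, n, hn, J, r, hr, hp⟩
  · exact Or.inl (Or.inl ⟨l, hl, by simp [hg, hp]⟩)
  · refine Or.inl (Or.inr ⟨(a, b), ⟨?_, ?_⟩, by simp [hg, hp]; rfl⟩)
    · exact (Nat.le_add_right a b).trans hab
    · exact (Nat.le_add_left b a).trans hab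
  · refine Or.inr ?_
    simp only [Set.mem_iUnion]
    refine ⟨s, hs, n, hn, J, fun j => if j ∈ J then r j else 0, ?_, ?_⟩
    · intro j
      by_cases hj : j ∈ J
      · simpa [hj] using (hr j hj).2.le
      · simp [hj]
    · simp only [hg, hp]
      congr 2
      exact Finset.sum_congr rfl fun j hj => by simp [hj]

/-- The finite set `𝒞` of elementary 2-cells of the model. -/
def cells : Finset ElemCell := P.finite_cells.toFinset

end GeometryModel

/-! ### Closed stuffed maps -/

/-- The sides of `n` marked faces of perimeters `ℓ` (`Fin (ℓ j)` are the sides of the `j`-th marked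
face, `0` being its root) and of unmarked surfaces of the given types. Sides are listed in the cyclic
order of the oriented boundary polygons. -/
abbrev StuffedSide {𝒞 : Finset ElemCell} {n k : ℕ} (ℓ : Fin n → ℕ) (cell : Fin k → 𝒞) : Type :=
  (Σ j : Fin n, Fin (ℓ j)) ⊕
    (Σ i : Fin k, Σ b : Fin (cell i).1.perims.length, Fin ((cell i).1.perims.get b))

/-- A closed stuffed map with `n` marked (labelled, rooted) faces of perimeters `ℓ j`, whose
unmarked pieces are surfaces with types in `𝒞`. It is obtained by gluing all sides of the pieces
in pairs, reversing the orientation. A marked face of perimeter `0` is a sphere with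
one vertex and no edge. -/
structure StuffedMap (𝒞 : Finset ElemCell) {n : ℕ} (ℓ : Fin n → ℕ) where
  numCells : ℕ
  cell : Fin numCells → 𝒞
  glue : Equiv.Perm (StuffedSide ℓ cell)
  glue_glue : ∀ s, glue (glue s) = s
  glue_ne : ∀ s, glue s ≠ s

namespace StuffedMap

variable {𝒞 : Finset ElemCell} {n : ℕ} {ℓ : Fin n → ℕ}

/-- The sides of the pieces of `M`. -/
abbrev Side (M : StuffedMap 𝒞 ℓ) : Type := StuffedSide ℓ M.cell

/-- The following side on the same boundary polygon. -/
def next (M : StuffedMap 𝒞 ℓ) : Equiv.Perm M.Side :=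
  Equiv.sumCongr (Equiv.sigmaCongrRight fun j => finRotate (ℓ j))
    (Equiv.sigmaCongrRight fun _ => Equiv.sigmaCongrRight fun _ => finRotate _)

/-- The piece (marked face or unmarked surface) to which a side belongs. -/
def piece (M : StuffedMap 𝒞 ℓ) : M.Side → Fin n ⊕ Fin M.numCells :=
  Sum.map Sigma.fst Sigma.fst

/-- The number of vertices: the initial vertices of `s` and `next (glue s)` are identified by the
gluing; in addition each marked face of perimeter `0` carries one vertex. -/
def numVertices (M : StuffedMap 𝒞 ℓ) : ℕ :=
  Nat.card (Quotient (Equiv.Perm.SameCycle.setoid (M.next * M.glue))) +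
    Nat.card {j : Fin n // ℓ j = 0}

/-- The number of edges: the number of pairs of glued sides. -/
def numEdges (M : StuffedMap 𝒞 ℓ) : ℕ :=
  Nat.card (Quotient (Equiv.Perm.SameCycle.setoid M.glue))

/-- The Euler characteristic of the closed surface carrying the map. -/
def euler (M : StuffedMap 𝒞 ℓ) : ℤ :=
  (M.numVertices : ℤ) - (M.numEdges : ℤ) + (n : ℤ) + ∑ i, (M.cell i).1.euler

/-- The surface is connected: any two pieces are joined by a chain of glued pieces. -/
def IsConnected (M : StuffedMap 𝒞 ℓ) : Prop :=
  (SimpleGraph.fromRel fun p q => ∃ s, M.piece s = p ∧ M.piece (M.glue s) = q).Connected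

/-- `M` is connected of genus `g`. -/
def HasGenus (M : StuffedMap 𝒞 ℓ) (g : ℕ) : Prop :=
  M.IsConnected ∧ M.euler = 2 - 2 * (g : ℤ)

/-- Isomorphisms of stuffed maps: bijections of sides and of unmarked pieces preserving types,
oriented boundary polygons and gluing, and fixing each marked face and its root. -/
@[ext]
structure Iso (M M' : StuffedMap 𝒞 ℓ) where
  side : M.Side ≃ M'.Side
  onCells : Fin M.numCells ≃ Fin M'.numCells
  cell_eq : ∀ i, M'.cell (onCells i) = M.cell i
  piece_eq : ∀ s, M'.piece (side s) = Sum.map id onCells (M.piece s)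
  next_eq : ∀ s, side (M.next s) = M'.next (side s)
  glue_eq : ∀ s, side (M.glue s) = M'.glue (side s)
  marked_eq : ∀ s, side (Sum.inl s) = Sum.inl s

/-- The identity isomorphism. -/
def Iso.refl (M : StuffedMap 𝒞 ℓ) : Iso M M where
  side := Equiv.refl _
  onCells := Equiv.refl _
  cell_eq _ := rfl
  piece_eq s := by simp
  next_eq _ := rfl
  glue_eq _ := rfl
  marked_eq _ := rfl

/-- The inverse isomorphism. -/
def Iso.symm {M M' : StuffedMap 𝒞 ℓ} (e : Iso M M') : Iso M' M where
  side := e.side.symm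
  onCells := e.onCells.symm
  cell_eq i := by simpa using (e.cell_eq (e.onCells.symm i)).symm
  piece_eq s := by
    have h := e.piece_eq (e.side.symm s)
    simp only [Equiv.apply_symm_apply] at h
    rw [h, Sum.map_map]
    simp
  next_eq s := by
    rw [Equiv.symm_apply_eq, e.next_eq, Equiv.apply_symm_apply]
  glue_eq s := by
    rw [Equiv.symm_apply_eq, e.glue_eq, Equiv.apply_symm_apply]
  marked_eq s := by
    rw [Equiv.symm_apply_eq, e.marked_eq]

/-- The composition of isomorphisms. -/
def Iso.trans {M M' M'' : StuffedMap 𝒞 ℓ} (e : Iso M M') (f : Iso M' M'') : Iso M M'' where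
  side := e.side.trans f.side
  onCells := e.onCells.trans f.onCells
  cell_eq i := by simp [f.cell_eq, e.cell_eq]
  piece_eq s := by simp [f.piece_eq, e.piece_eq, Sum.map_map]
  next_eq s := by simp [f.next_eq, e.next_eq]
  glue_eq s := by simp [f.glue_eq, e.glue_eq]
  marked_eq s := by simp [f.marked_eq, e.marked_eq]

/-- Isomorphism of stuffed maps as an equivalence relation. -/
def isoSetoid (𝒞 : Finset ElemCell) {n : ℕ} (ℓ : Fin n → ℕ) : Setoid (StuffedMap 𝒞 ℓ) where
  r M M' := Nonempty (Iso M M')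
  iseqv := ⟨fun M => ⟨Iso.refl M⟩, fun ⟨e⟩ => ⟨e.symm⟩, fun ⟨e⟩ ⟨f⟩ => ⟨e.trans f⟩⟩

end StuffedMap

/-- Isomorphism classes of closed stuffed maps with `n` marked faces of arbitrary perimeters. -/
def StuffedClass (𝒞 : Finset ElemCell) (n : ℕ) : Type :=
  Σ ℓ : Fin n → ℕ, Quotient (StuffedMap.isoSetoid 𝒞 ℓ)

/-- `𝕄_{g,n}(𝒞)`: the isomorphism classes of connected closed stuffed maps of genus `g` with `n`
marked faces and unmarked pieces in `𝒞`. -/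
def stuffedClasses (𝒞 : Finset ElemCell) (g n : ℕ) : Set (StuffedClass 𝒞 n) :=
  {q | ∃ M : StuffedMap 𝒞 q.1, Quotient.mk _ M = q.2 ∧ M.HasGenus g}

/-- The ring `ℚ[𝐭][[t]][[x₁⁻¹, …, xₙ⁻¹]]`, the variable `j : Fin n` standing for `x_j⁻¹`. -/
abbrev GenSeries (𝒞 : Finset ElemCell) (n : ℕ) : Type :=
  MvPowerSeries (Fin n) (PowerSeries (MvPolynomial 𝒞 ℚ))

/-- The coefficient of `∏ x_j^{-m_j} · t^v · ∏ 𝐭_C^{k_C}`. -/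
def GenSeries.coef {𝒞 : Finset ElemCell} {n : ℕ} (F : GenSeries 𝒞 n)
    (m : Fin n →₀ ℕ) (v : ℕ) (k : 𝒞 →₀ ℕ) : ℚ :=
  MvPolynomial.coeff k (PowerSeries.coeff v (MvPowerSeries.coeff m F))

/-- The Boltzmann weight of a stuffed map: `t` for each vertex, `x_j^{-(ℓ_j+1)}` for the `j`-th
marked face, `𝐭_C / (number of distinct orderings of the perimeters)` for each unmarked piece of
type `C`, divided by the order of the automorphism group. -/
def StuffedMap.weight {𝒞 : Finset ElemCell} {n : ℕ} {ℓ : Fin n → ℕ} (M : StuffedMap 𝒞 ℓ) :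
    GenSeries 𝒞 n :=
  MvPowerSeries.monomial (Finsupp.equivFunOnFinite.symm fun j => ℓ j + 1)
    (PowerSeries.monomial M.numVertices
      (MvPolynomial.C (1 / (Nat.card (StuffedMap.Iso M M) : ℚ)) *
        ∏ i, (MvPolynomial.C (1 / (M.cell i).1.orderings) * MvPolynomial.X (M.cell i))))

/-- The Boltzmann weight of an isomorphism class (it does not depend on the representative). -/
def StuffedClass.weight {𝒞 : Finset ElemCell} {n : ℕ} (q : StuffedClass 𝒞 n) : GenSeries 𝒞 n :=
  StuffedMap.weight (Quotient.out q.2)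

/-- `W_{g,n}`, the formal sum of the Boltzmann weights over `𝕄_{g,n}(𝒞)`. -/
def stuffedSeries (𝒞 : Finset ElemCell) (g n : ℕ) : GenSeries 𝒞 n := fun m =>
  PowerSeries.mk fun v => ∑ᶠ q ∈ stuffedClasses 𝒞 g n,
    PowerSeries.coeff v (MvPowerSeries.coeff m q.weight)

/-! ### The formal matrix model -/

/-- The real coordinates of a Hermitian `N × N` matrix: the `H_ii`, and the pairs
`(Re H_ij, Im H_ij)` for `i < j`. The measure `volume` on this space is the measure `dH`. -/
abbrev HermCoord (N : ℕ) : Type :=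
  (Fin N → ℝ) × ({p : Fin N × Fin N // p.1 < p.2} → ℝ × ℝ)

/-- The Hermitian matrix with given coordinates. -/
def hermMatrix {N : ℕ} (h : HermCoord N) : Matrix (Fin N) (Fin N) ℂ := fun i j =>
  if hij : i < j then ⟨(h.2 ⟨(i, j), hij⟩).1, (h.2 ⟨(i, j), hij⟩).2⟩
  else if hji : j < i then ⟨(h.2 ⟨(j, i), hji⟩).1, -(h.2 ⟨(j, i), hji⟩).2⟩
  else (h.1 i : ℂ)

/-- `Tr (H^l)`, which is a real number. -/
def trPow {N : ℕ} (h : HermCoord N) (l : ℕ) : ℝ := (Matrix.trace (hermMatrix h ^ l)).re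

/-- The Gaussian measure `dρ₀ = c exp(-(N/2t) Tr H²) dH` with
`c = (2^N (π t / N)^{N²})^{-1/2}`. -/
def gaussianHerm (N : ℕ) (t : ℝ) : Measure (HermCoord N) :=
  (volume : Measure (HermCoord N)).withDensity fun h =>
    ENNReal.ofReal ((Real.sqrt (2 ^ N * (Real.pi * t / N) ^ (N ^ 2)))⁻¹ *
      Real.exp (-((N : ℝ) / (2 * t)) * trPow h 2))

/-- Formal power series over `ℝ` in the Boltzmann weights `𝐭_C` (`C ∈ 𝒞`) and in the `x_j⁻¹`
(`j : Fin n`). -/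
abbrev CorrSeries (𝒞 : Finset ElemCell) (n : ℕ) : Type := MvPowerSeries (Fin n ⊕ 𝒞) ℝ

section Correlators

variable (𝒞 : Finset ElemCell) (n N : ℕ) (t : ℝ)

/-- `T_C(H) = 𝐭_C ∏ᵢ Tr(H^{ℓᵢ}) / ℓᵢ`. -/
def cellTerm (C : 𝒞) (h : HermCoord N) : CorrSeries 𝒞 n :=
  MvPowerSeries.X (Sum.inr C) *
    MvPowerSeries.C ((C.1.perims.map fun l => trPow h l / (l : ℝ)).prod)

/-- `S_int(H) = - ∑_{C ∈ 𝒞} (N/t)^{χ(C)} / β₀(∂C)! · T_C(H)`. -/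
def actionInt (h : HermCoord N) : CorrSeries 𝒞 n :=
  -∑ C : 𝒞, MvPowerSeries.C (((N : ℝ) / t) ^ C.1.euler / (C.1.bdry ! : ℝ)) * cellTerm 𝒞 n N C h

/-- `Φ(H) = exp(-S_int(H))` as a formal power series. -/
def formalPhi (h : HermCoord N) : CorrSeries 𝒞 n :=
  (PowerSeries.exp ℝ).subst (-actionInt 𝒞 n N t h)

/-- The formal resolvent trace `X_j = ∑_{l ≥ 0} Tr(H^l) x_j^{-(l+1)}`. -/
def formalResolvent (j : Fin n) (h : HermCoord N) : CorrSeries 𝒞 n :=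
  MvPowerSeries.X (Sum.inl j) *
    (PowerSeries.mk fun l => trPow h l).subst (MvPowerSeries.X (Sum.inl j) : CorrSeries 𝒞 n)

/-- The formal expectation `ρ₀[F]`: integration is interchanged with summation. -/
def formalExp (F : HermCoord N → CorrSeries 𝒞 n) : CorrSeries 𝒞 n := fun e =>
  ∫ h, MvPowerSeries.coeff e (F h) ∂(gaussianHerm N t)

/-- The partition function `Z_N = ρ₀[Φ]`. -/
def partitionFn : CorrSeries 𝒞 n := formalExp 𝒞 n N t (formalPhi 𝒞 n N t)

/-- The disconnected correlator `Ŵ_{|K|}(x_K) = Z_N⁻¹ ρ₀[Φ ∏_{j ∈ K} X_j]`. -/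
def disconnectedCorr (K : Finset (Fin n)) : CorrSeries 𝒞 n :=
  (partitionFn 𝒞 n N t)⁻¹ *
    formalExp 𝒞 n N t fun h => formalPhi 𝒞 n N t h * ∏ j ∈ K, formalResolvent 𝒞 n N j h

/-- The connected correlator `W_n(x₁, …, xₙ)`: the joint cumulant, as a sum over set partitions. -/
def connectedCorr : CorrSeries 𝒞 n :=
  ∑ K : Finpartition (Finset.univ : Finset (Fin n)),
    MvPowerSeries.C ((-1 : ℝ) ^ (K.parts.card - 1) * ((K.parts.card - 1)! : ℝ)) *
      ∏ B ∈ K.parts, disconnectedCorr 𝒞 n N t B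

end Correlators

/-- The series `F ∈ ℚ[𝐭][[t]][[x⁻¹]]` at the real number `t`, as a formal series in `𝐭` and `x⁻¹`.
It is meaningful when each monomial in `𝐭`, `x⁻¹` occurs with finitely many powers of `t`. -/
def GenSeries.atT {𝒞 : Finset ElemCell} {n : ℕ} (F : GenSeries 𝒞 n) (t : ℝ) : CorrSeries 𝒞 n :=
  fun e => ∑ᶠ v : ℕ, (F.coef (Finsupp.sumFinsuppEquivProdFinsupp e).1 v
    (Finsupp.sumFinsuppEquivProdFinsupp e).2 : ℝ) * t ^ v

/-- `F = ∑_g f g` as formal series: each coefficient of `f g` vanishes for all but finitely many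
`g`, and the coefficients sum up to those of `F`. -/
def IsFormalSum {σ : Type} (f : ℕ → MvPowerSeries σ ℝ) (F : MvPowerSeries σ ℝ) : Prop :=
  ∀ e : σ →₀ ℕ, {g | MvPowerSeries.coeff e (f g) ≠ 0}.Finite ∧
    MvPowerSeries.coeff e F = ∑ᶠ g, MvPowerSeries.coeff e (f g)

end

/-!
The identity is proved coefficient by coefficient, by comparing two sums over the gluings of a fixed
collection of labelled pieces: `n` marked polygons of perimeters `ℓ j`, and `k C` surfaces of each
type `C ∈ 𝒞`.

*Matrix side.* Gaussian integration by parts gives the formula of Wick for the entries of a Hermitian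
matrix (`integral_prod_hermMatrix`). Expanding traces as sums over closed index paths, the integral
of a product of traces is a sum over the pairings `α` of the sides (`integral_prod_trPow`), in which a
pairing has the weight `(t/N)^E N^V`, where `V` is essentially the number of cycles of `next ∘ α`: an
index assignment compatible with `α` is a colouring of the vertices. Decomposing a pairing according
to the component of one marked face (`pairingSum_eq_sum_connectedSum`) gives the same triangular
recursion as the one that determines joint cumulants from moments (`eq_sum_jointCumulant_mul`,
`traceMoment_eq_sum`). So the coefficients of the connected correlators are the sums over the pairings
with a connected surface (`connectedSum_eq_traceCumulant`, `StuffedMap.coeff_connectedCorr`). No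
logarithm of a power series is needed: the normalisation by the partition function and the set
partitions of the marked faces enter only through this recursion.

*Map side.* Isomorphisms between two gluings of the same pieces are the relabellings of the pieces
which carry one gluing to the other, and every relabelling carries a given gluing to exactly one
gluing. Hence a sum over isomorphism classes weighted by `1/|Aut|` is the sum over gluings divided by
the number of relabellings (`StuffedMap.sum_gluingClasses`). That number is
`∏ C, (k C)! (∏ᵢ ℓᵢ · ∏ₓ (multiplicity of x)!)^(k C)` (`StuffedMap.card_relabelling`), which together
with the numbers of orderings produces the factors `1/(k C)!`, `1/β₀(∂C)!` and `∏ᵢ 1/ℓᵢ` of the matrix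
model.

*Genus.* The powers of `N/t` match because the weight of a connected gluing is `(N/t)^(χ - n) t^V`, with
`χ` the Euler characteristic. It remains to see that `χ = 2 - 2g` for some natural number `g`
(`StuffedMap.exists_hasGenus`), with `χ` defined by counting cycles of permutations. Evenness follows
from the signs of `next`, `glue` and their product, and `χ ≤ 2` from the inequality of Ree for the
numbers of cycles of two permutations and their product (`Equiv.Perm.numCycles_add_le`), which is
proved by linear algebra on the functions of the sides. For gluings of surfaces with several boundary
components, the number of orbits in that inequality is bounded by connectedness
(`StuffedMap.finrank_add_card_le`).

*Finiteness.* Each 2-cell of the model contributes at least `1` to `|∂C| - 2 χ(C)`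
(`GeometryModel.one_le_of_mem_cells`), so that the genus, the perimeters of the marked faces and the
number of vertices bound the number of unmarked pieces (`StuffedMap.numCells_le`).
-/

/-! ### Cycles of permutations and the genus inequality -/

namespace Equiv.Perm

variable {α : Type*}

/-- The number of cycles of a permutation, fixed points included. -/
noncomputable def numCycles (σ : Perm α) : ℕ := Nat.card (Quotient (SameCycle.setoid σ))

theorem eq_of_sameCycle {β : Type*} {σ : Perm α} {f : α → β} (hf : ∀ x, f (σ x) = f x)
    {x y : α} (h : σ.SameCycle x y) : f x = f y := by
  obtain ⟨i, rfl⟩ := h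
  have hinv : ∀ x, f (σ⁻¹ x) = f x := fun x => by simpa using (hf (σ⁻¹ x)).symm
  induction i with
  | zero => simp
  | succ k ih => rw [add_comm, zpow_one_add, mul_apply, hf, ← ih]
  | pred k ih => rw [sub_eq_neg_add, zpow_add, zpow_neg_one, mul_apply, hinv, ← ih]

/-- Functions invariant under a permutation are functions on its set of cycles. -/
noncomputable def invariantEquiv (σ : Perm α) (β : Type*) :
    {f : α → β // ∀ x, f (σ x) = f x} ≃ (Quotient (SameCycle.setoid σ) → β) where
  toFun f := Quotient.lift f.1 fun _ _ h => eq_of_sameCycle f.2 h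
  invFun g := ⟨fun x => g (Quotient.mk _ x), fun x =>
    congrArg g (Quotient.sound (⟨-1, by simp⟩ : σ.SameCycle (σ x) x))⟩
  left_inv f := rfl
  right_inv g := by
    funext q
    induction q using Quotient.inductionOn
    rfl

/-- The functions that are invariant under a permutation. -/
def invariants (σ : Perm α) : Submodule ℚ (α → ℚ) :=
  LinearMap.ker (LinearMap.id - LinearMap.funLeft ℚ ℚ σ)

theorem mem_invariants {σ : Perm α} {f : α → ℚ} : f ∈ σ.invariants ↔ ∀ x, f (σ x) = f x := by
  simp only [invariants, LinearMap.mem_ker, LinearMap.sub_apply, LinearMap.id_apply, sub_eq_zero,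
    funext_iff, LinearMap.funLeft_apply]
  exact forall_congr' fun x => eq_comm

variable [Fintype α]

theorem finrank_invariants (σ : Perm α) : Module.finrank ℚ σ.invariants = σ.numCycles := by
  classical
  have hr : LinearMap.range (LinearMap.funLeft ℚ ℚ
      (Quotient.mk (SameCycle.setoid σ))) = σ.invariants := by
    ext f
    rw [mem_invariants]
    constructor
    · rintro ⟨g, rfl⟩
      exact ((σ.invariantEquiv ℚ).symm g).2
    · intro hf
      exact ⟨σ.invariantEquiv ℚ ⟨f, hf⟩, rfl⟩
  have : Fintype (Quotient (SameCycle.setoid σ)) := Fintype.ofFinite _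
  rw [← hr, LinearMap.finrank_range_of_inj, Module.finrank_fintype_fun_eq_card, numCycles,
    Nat.card_eq_fintype_card]
  exact LinearMap.funLeft_injective_of_surjective _ _ _ Quotient.mk_surjective

/-- The inequality of Ree for two permutations and their product: if the group generated by `σ` and
`τ` has `κ` orbits, then `σ`, `τ` and `σ τ` have together at most `|α| + 2 κ` cycles. With
`A = range (1 - σ)` and `B = range (1 - τ)` acting on functions, `A + B` has codimension `κ`, and
`1 - σ` maps the functions invariant under `σ τ` into `A ∩ B`. -/
theorem numCycles_add_le (σ τ : Perm α) :
    σ.numCycles + τ.numCycles + (σ * τ).numCycles ≤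
      Fintype.card α + 2 * Module.finrank ℚ (σ.invariants ⊓ τ.invariants : Submodule ℚ (α → ℚ)) := by
  classical
  let S : (α → ℚ) →ₗ[ℚ] (α → ℚ) := LinearMap.id - LinearMap.funLeft ℚ ℚ σ
  let T : (α → ℚ) →ₗ[ℚ] (α → ℚ) := LinearMap.id - LinearMap.funLeft ℚ ℚ τ
  have hS : ∀ f x, S f x = f x - f (σ x) := fun f x => rfl
  have hT : ∀ f x, T f x = f x - f (τ x) := fun f x => rfl
  have h1 : Module.finrank ℚ (LinearMap.range S) + σ.numCycles = Fintype.card α := by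
    rw [← finrank_invariants, ← Module.finrank_fintype_fun_eq_card ℚ]
    exact S.finrank_range_add_finrank_ker
  have h2 : Module.finrank ℚ (LinearMap.range T) + τ.numCycles = Fintype.card α := by
    rw [← finrank_invariants, ← Module.finrank_fintype_fun_eq_card ℚ]
    exact T.finrank_range_add_finrank_ker
  have h3 := Submodule.finrank_sup_add_finrank_inf_eq (LinearMap.range S) (LinearMap.range T)
  have h4 := Subspace.finrank_add_finrank_dualAnnihilator_eq (LinearMap.range S ⊔ LinearMap.range T)
  rw [Module.finrank_fintype_fun_eq_card] at h4
  -- a functional vanishing on `A + B` takes the same value on the point masses of an orbit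
  have h5 : Module.finrank ℚ (LinearMap.range S ⊔ LinearMap.range T).dualAnnihilator ≤
      Module.finrank ℚ (σ.invariants ⊓ τ.invariants : Submodule ℚ (α → ℚ)) := by
    let F : Module.Dual ℚ (α → ℚ) →ₗ[ℚ] (α → ℚ) :=
      { toFun := fun u x => u (Pi.single x 1)
        map_add' := fun _ _ => rfl
        map_smul' := fun _ _ => rfl }
    have hsingle : ∀ (ρ : Perm α) (x : α),
        (fun y => (Pi.single (ρ x) 1 : α → ℚ) (ρ y)) = Pi.single x 1 := by
      intro ρ x
      ext y
      simp [Pi.single_apply]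
    have hF : ∀ u ∈ (LinearMap.range S ⊔ LinearMap.range T).dualAnnihilator,
        F u ∈ σ.invariants ⊓ τ.invariants := by
      intro u hu
      rw [Submodule.mem_dualAnnihilator] at hu
      refine ⟨mem_invariants.2 fun x => ?_, mem_invariants.2 fun x => ?_⟩
      · have := hu (S (Pi.single (σ x) 1)) (Submodule.mem_sup_left ⟨_, rfl⟩)
        have e : S (Pi.single (σ x) 1) = Pi.single (σ x) 1 - Pi.single x 1 := by
          rw [← hsingle σ x]
          rfl
        rw [e, map_sub, sub_eq_zero] at this
        exact this
      · have := hu (T (Pi.single (τ x) 1)) (Submodule.mem_sup_right ⟨_, rfl⟩)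
        have e : T (Pi.single (τ x) 1) = Pi.single (τ x) 1 - Pi.single x 1 := by
          rw [← hsingle τ x]
          rfl
        rw [e, map_sub, sub_eq_zero] at this
        exact this
    refine LinearMap.finrank_le_finrank_of_injective (f := F.restrict hF) ?_
    intro u v huv
    ext x
    exact congrFun (congrArg Subtype.val huv) x
  -- `1 - σ` maps the invariants of `σ τ` to `A ∩ B`, with kernel the common invariants
  have h6 : (σ * τ).numCycles ≤
      Module.finrank ℚ (LinearMap.range S ⊓ LinearMap.range T : Submodule ℚ (α → ℚ)) +
      Module.finrank ℚ (σ.invariants ⊓ τ.invariants : Submodule ℚ (α → ℚ)) := by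
    rw [← finrank_invariants]
    have hmem : ∀ f ∈ (σ * τ).invariants, S f ∈ LinearMap.range S ⊓ LinearMap.range T := by
      intro f hf
      rw [mem_invariants] at hf
      refine ⟨⟨f, rfl⟩, ⟨-(fun x => f (σ x)), ?_⟩⟩
      ext x
      have := hf x
      rw [mul_apply] at this
      rw [hT, hS, Pi.neg_apply, Pi.neg_apply, this]
      ring
    let G : (σ * τ).invariants →ₗ[ℚ] (LinearMap.range S ⊓ LinearMap.range T : Submodule ℚ (α → ℚ)) :=
      S.restrict hmem
    rw [← G.finrank_range_add_finrank_ker]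
    refine add_le_add (Submodule.finrank_le _) ?_
    have hk : ∀ f : LinearMap.ker G, f.1.1 ∈ σ.invariants ⊓ τ.invariants := by
      intro f
      have h0 : S f.1.1 = 0 := congrArg Subtype.val f.2
      have hσ : f.1.1 ∈ σ.invariants := h0
      refine ⟨hσ, mem_invariants.2 fun x => ?_⟩
      have := mem_invariants.1 f.1.2 x
      rwa [mul_apply, mem_invariants.1 hσ] at this
    refine LinearMap.finrank_le_finrank_of_injective
      (f := LinearMap.codRestrict _ ((Submodule.subtype _).comp (Submodule.subtype _)) hk) ?_
    intro f g hfg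
    have h0 := congrArg Subtype.val hfg
    exact Subtype.ext (Subtype.ext h0)
  omega

variable [DecidableEq α]

theorem numCycles_eq (σ : Perm α) :
    σ.numCycles = Multiset.card σ.cycleType + (Fintype.card α - σ.support.card) := by
  let f : α → Perm α ⊕ α := fun x => if σ x = x then Sum.inr x else Sum.inl (σ.cycleOf x)
  have hf : ∀ x y, σ.SameCycle x y ↔ f x = f y := by
    intro x y
    by_cases hx : σ x = x <;> by_cases hy : σ y = y
    · simp only [f, hx, hy, if_true, Sum.inr.injEq]
      exact ⟨fun h => h.eq_of_left hx, fun h => h.sameCycle σ⟩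
    · simp only [f, hx, hy, if_true, if_false, reduceCtorEq, iff_false]
      exact fun h => hy (h.apply_eq_self_iff.1 hx)
    · simp only [f, hx, hy, if_true, if_false, reduceCtorEq, iff_false]
      exact fun h => hx (h.apply_eq_self_iff.2 hy)
    · simp only [f, hx, hy, if_false, Sum.inl.injEq]
      exact sameCycle_iff_cycleOf_eq_of_mem_support (mem_support.2 hx) (mem_support.2 hy)
  have hr : (Finset.univ.image f) = σ.cycleFactorsFinset.disjSum σ.supportᶜ := by
    ext z
    simp only [Finset.mem_image, Finset.mem_univ, true_and, Finset.mem_disjSum]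
    constructor
    · rintro ⟨x, rfl⟩
      by_cases hx : σ x = x
      · exact Or.inr ⟨x, by simp [hx], by simp [f, hx]⟩
      · exact Or.inl ⟨σ.cycleOf x, cycleOf_mem_cycleFactorsFinset_iff.2 (mem_support.2 hx),
          by simp [f, hx]⟩
    · rintro (⟨c, hc, rfl⟩ | ⟨x, hx, rfl⟩)
      · obtain ⟨x, hx⟩ := (mem_cycleFactorsFinset_iff.1 hc).1.nonempty_support
        have h1 : σ x ≠ x := mem_support.1 (mem_cycleFactorsFinset_support_le hc hx)
        refine ⟨x, ?_⟩
        simp only [f, h1, if_false]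
        rw [cycle_is_cycleOf hx hc]
      · refine ⟨x, ?_⟩
        have : σ x = x := by simpa using hx
        simp [f, this]
  have hc : σ.numCycles = (Finset.univ.image f).card := by
    rw [numCycles, ← Nat.card_eq_finsetCard]
    refine Nat.card_congr (Equiv.ofBijective (Quotient.lift
      (fun x => (⟨f x, Finset.mem_image_of_mem f (Finset.mem_univ x)⟩ : Finset.univ.image f))
      fun x y h => Subtype.ext ((hf x y).1 h)) ⟨?_, ?_⟩)
    · intro p q
      refine Quotient.inductionOn₂ p q fun x y h => ?_
      exact Quotient.sound ((hf x y).2 (congrArg Subtype.val h))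
    · rintro ⟨z, hz⟩
      obtain ⟨x, -, rfl⟩ := Finset.mem_image.1 hz
      exact ⟨Quotient.mk _ x, rfl⟩
  rw [hc, hr, Finset.card_disjSum, Finset.card_compl, cycleType_def]
  simp

theorem sign_eq_neg_one_pow (σ : Perm α) :
    (sign σ : ℤˣ) = (-1) ^ (Fintype.card α + σ.numCycles) := by
  have h : σ.support.card ≤ Fintype.card α := Finset.card_le_univ _
  rw [sign_of_cycleType, sum_cycleType, numCycles_eq]
  have e : Fintype.card α + (Multiset.card σ.cycleType + (Fintype.card α - σ.support.card)) =
    (σ.support.card + Multiset.card σ.cycleType) + 2 * (Fintype.card α - σ.support.card) := by omega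
  rw [e, pow_add _ _ (2 * _), pow_mul]
  simp

/-- The parity of the number of cycles of a product. -/
theorem even_numCycles_add (σ τ : Perm α) :
    Even (σ.numCycles + τ.numCycles + (σ * τ).numCycles + Fintype.card α) := by
  have h := sign_mul σ τ
  simp only [sign_eq_neg_one_pow] at h
  rw [← pow_add] at h
  have h2 : ((-1 : ℤˣ)) ^ (σ.numCycles + τ.numCycles + (σ * τ).numCycles + Fintype.card α) = 1 := by
    have h3 := congrArg (fun u : ℤˣ => u * (-1) ^ (Fintype.card α + (σ * τ).numCycles)) h
    simp only [← pow_add] at h3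
    rw [Even.neg_one_pow ⟨_, rfl⟩] at h3
    have e : Fintype.card α + σ.numCycles + (Fintype.card α + τ.numCycles) +
        (Fintype.card α + (σ * τ).numCycles) = (σ.numCycles + τ.numCycles + (σ * τ).numCycles +
        Fintype.card α) + 2 * Fintype.card α := by ring
    rw [e, pow_add, pow_mul] at h3
    simpa using h3.symm
  rwa [neg_one_pow_eq_one_iff_even (by decide)] at h2

/-- A fixed-point free involution has half as many cycles as points. -/
theorem two_mul_numCycles_of_involution {τ : Perm α} (h2 : ∀ x, τ (τ x) = x) (hne : ∀ x, τ x ≠ x) :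
    2 * τ.numCycles = Fintype.card α := by
  have hs : τ.support = Finset.univ := by ext x; simp [hne]
  have hp : τ ^ 2 = 1 := by ext x; simp [sq, h2]
  have : Fact (Nat.Prime 2) := ⟨Nat.prime_two⟩
  have hall : ∀ m ∈ τ.cycleType, m = 2 := fun m hm => by
    have := dvd_trans (dvd_of_mem_cycleType hm) (orderOf_dvd_of_pow_eq_one hp)
    have h1 := two_le_of_mem_cycleType hm
    exact le_antisymm (Nat.le_of_dvd two_pos this) h1
  have hsum := sum_cycleType τ
  rw [Multiset.eq_replicate_card.2 hall, Multiset.sum_replicate, hs, Finset.card_univ] at hsum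
  rw [numCycles_eq, hs, Finset.card_univ, Nat.sub_self, add_zero]
  rw [smul_eq_mul] at hsum
  omega

end Equiv.Perm

/-! ### The Gaussian measure on Hermitian matrices -/

/-- The moments of the centred Gaussian law of variance `v`. -/
def gaussMoment (v : ℝ) : ℕ → ℝ
  | 0 => 1
  | 1 => 0
  | k + 2 => (k + 1) * v * gaussMoment v k

/-- The density of the centred Gaussian law of variance `v`. -/
noncomputable def gaussDensity (v x : ℝ) : ℝ :=
  (Real.sqrt (2 * Real.pi * v))⁻¹ * Real.exp (-(2 * v)⁻¹ * x ^ 2)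

theorem integrable_pow_mul_exp_neg_mul_sq {b : ℝ} (hb : 0 < b) (k : ℕ) :
    Integrable fun x : ℝ => x ^ k * Real.exp (-b * x ^ 2) := by
  have h := integrable_rpow_mul_exp_neg_mul_sq hb (s := k) (by linarith [k.cast_nonneg (α := ℝ)])
  simpa [Real.rpow_natCast] using h

theorem integral_pow_mul_exp_neg_mul_sq {b : ℝ} (hb : 0 < b) (k : ℕ) :
    ∫ x : ℝ, x ^ k * Real.exp (-b * x ^ 2) =
      Real.sqrt (Real.pi / b) * gaussMoment (2 * b)⁻¹ k := by
  have hE : ∀ x : ℝ, HasDerivAt (fun x : ℝ => Real.exp (-b * x ^ 2))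
      (-(2 * b) * (x ^ 1 * Real.exp (-b * x ^ 2))) x := fun x => by
    have := (((hasDerivAt_id x).pow 2).const_mul (-b)).exp
    convert! this using 1
    simp
    ring
  have hI := integrable_pow_mul_exp_neg_mul_sq hb
  induction k using Nat.twoStepInduction with
  | zero => simpa [gaussMoment] using integral_gaussian b
  | one =>
    have h := integral_eq_zero_of_hasDerivAt_of_integrable hE ((hI 1).const_mul _)
      (by simpa using hI 0)
    rw [integral_const_mul] at h
    have h2 : -(2 * b) ≠ 0 := by linarith
    rw [(mul_eq_zero.1 h).resolve_left h2]
    simp [gaussMoment]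
  | more k ih _ =>
    have hd : ∀ x : ℝ, HasDerivAt (fun x : ℝ => x ^ (k + 1) * Real.exp (-b * x ^ 2))
        ((k + 1) * (x ^ k * Real.exp (-b * x ^ 2)) -
          (2 * b) * (x ^ (k + 2) * Real.exp (-b * x ^ 2))) x := fun x => by
      have := ((hasDerivAt_id x).pow (k + 1)).mul (hE x)
      convert! this using 1
      simp
      ring
    have h := integral_eq_zero_of_hasDerivAt_of_integrable hd
      (((hI k).const_mul _).sub ((hI (k + 2)).const_mul _)) (hI (k + 1))
    rw [integral_sub ((hI k).const_mul _) ((hI (k + 2)).const_mul _), integral_const_mul,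
      integral_const_mul, ih] at h
    apply mul_left_cancel₀ (a := 2 * b) (by positivity)
    rw [← sub_eq_zero.1 h]
    simp only [gaussMoment]
    field_simp

theorem integrable_pow_mul_gaussDensity {v : ℝ} (hv : 0 < v) (k : ℕ) :
    Integrable fun x : ℝ => x ^ k * gaussDensity v x := by
  have h := (integrable_pow_mul_exp_neg_mul_sq (b := (2 * v)⁻¹) (by positivity) k).const_mul
    (Real.sqrt (2 * Real.pi * v))⁻¹
  refine h.congr (Filter.Eventually.of_forall fun x => ?_)
  simp only [gaussDensity]
  ring

theorem integral_pow_mul_gaussDensity {v : ℝ} (hv : 0 < v) (k : ℕ) :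
    ∫ x : ℝ, x ^ k * gaussDensity v x = gaussMoment v k := by
  have h : ∀ x : ℝ, x ^ k * gaussDensity v x =
      (Real.sqrt (2 * Real.pi * v))⁻¹ * (x ^ k * Real.exp (-(2 * v)⁻¹ * x ^ 2)) := fun x => by
    simp only [gaussDensity]
    ring
  simp_rw [h]
  rw [integral_const_mul, integral_pow_mul_exp_neg_mul_sq (by positivity)]
  have e : Real.pi / (2 * v)⁻¹ = 2 * Real.pi * v := by field_simp
  have e2 : (2 * (2 * v)⁻¹)⁻¹ = v := by field_simp
  have : Real.sqrt (2 * Real.pi * v) ≠ 0 := by positivity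
  rw [e, e2]
  field_simp

section Hermitian

variable {N : ℕ}

/-- The index set of the real coordinates of a Hermitian matrix: diagonal entries, and real and
imaginary parts of the entries above the diagonal. -/
abbrev CoordIdx (N : ℕ) : Type :=
  Fin N ⊕ ({p : Fin N × Fin N // p.1 < p.2} ⊕ {p : Fin N × Fin N // p.1 < p.2})

/-- The real coordinate of a Hermitian matrix with a given index. -/
def coordVal (h : HermCoord N) : CoordIdx N → ℝ
  | Sum.inl i => h.1 i
  | Sum.inr (Sum.inl p) => (h.2 p).1
  | Sum.inr (Sum.inr p) => (h.2 p).2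

/-- The variance of a real coordinate. -/
noncomputable def coordVar (N : ℕ) (t : ℝ) : CoordIdx N → ℝ
  | Sum.inl _ => t / N
  | Sum.inr _ => t / (2 * N)

theorem hermMatrix_apply (h : HermCoord N) (i j : Fin N) : hermMatrix h i j =
    if hij : i < j then ⟨(h.2 ⟨(i, j), hij⟩).1, (h.2 ⟨(i, j), hij⟩).2⟩
    else if hji : j < i then ⟨(h.2 ⟨(j, i), hji⟩).1, -(h.2 ⟨(j, i), hji⟩).2⟩
    else (h.1 i : ℂ) := rfl

theorem isHermitian_hermMatrix (h : HermCoord N) : (hermMatrix h).IsHermitian := by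
  ext i j
  rw [Matrix.conjTranspose_apply, hermMatrix_apply, hermMatrix_apply]
  rcases lt_trichotomy i j with hij | rfl | hij
  · simp only [hij, hij.not_gt, dif_pos, dif_neg, not_false_eq_true]
    apply Complex.ext <;> simp
  · simp
  · simp only [hij, hij.not_gt, dif_pos, dif_neg, not_false_eq_true]
    apply Complex.ext <;> simp

theorem ofReal_trPow (h : HermCoord N) (l : ℕ) :
    (trPow h l : ℂ) = Matrix.trace (hermMatrix h ^ l) := by
  have h1 : (hermMatrix h ^ l).IsHermitian := (isHermitian_hermMatrix h).pow l
  have h2 : star (Matrix.trace (hermMatrix h ^ l)) = Matrix.trace (hermMatrix h ^ l) := by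
    rw [← Matrix.trace_conjTranspose, h1.eq]
  exact Complex.conj_eq_iff_re.1 h2

theorem two_mul_card_lt (N : ℕ) :
    2 * Fintype.card {p : Fin N × Fin N // p.1 < p.2} + N = N ^ 2 := by
  have e : Fintype.card {p : Fin N × Fin N // p.1 < p.2} =
      Fintype.card {p : Fin N × Fin N // p.2 < p.1} :=
    Fintype.card_congr ((Equiv.prodComm _ _).subtypeEquiv fun _ => Iff.rfl)
  have e2 : Fintype.card {p : Fin N × Fin N // p.1 = p.2} = N := by
    conv_rhs => rw [← Fintype.card_fin N]
    refine Fintype.card_congr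
      { toFun := fun p => p.1.1
        invFun := fun i => ⟨(i, i), rfl⟩
        left_inv := ?_
        right_inv := fun _ => rfl }
    rintro ⟨⟨i, j⟩, h⟩
    exact Subtype.ext (Prod.ext rfl h)
  have e3 : Fintype.card (Fin N × Fin N) = N ^ 2 := by simp [sq]
  rw [Fintype.card_subtype] at e e2
  rw [Fintype.card_subtype] at e
  rw [← e3, Fintype.card_subtype, ← Finset.card_univ,
    ← Finset.card_filter_add_card_filter_not (s := Finset.univ) (fun p : Fin N × Fin N => p.1 < p.2)]
  have e4 : (Finset.univ.filter fun p : Fin N × Fin N => ¬ p.1 < p.2) =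
      (Finset.univ.filter fun p : Fin N × Fin N => p.2 < p.1) ∪
        (Finset.univ.filter fun p : Fin N × Fin N => p.1 = p.2) := by
    ext p
    simp only [Finset.mem_filter, Finset.mem_univ, true_and, Finset.mem_union, not_lt,
      le_iff_lt_or_eq]
    exact or_congr Iff.rfl eq_comm
  rw [e4, Finset.card_union_of_disjoint, ← e, e2]
  · omega
  · rw [Finset.disjoint_left]
    intro p hp hp'
    simp only [Finset.mem_filter, Finset.mem_univ, true_and] at hp hp'
    exact hp.ne hp'.symm

theorem trPow_two (h : HermCoord N) : trPow h 2 =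
    ∑ i, h.1 i ^ 2 + 2 * ∑ p, ((h.2 p).1 ^ 2 + (h.2 p).2 ^ 2) := by
  have h0 : ∀ i j, (hermMatrix h i j * hermMatrix h j i).re =
      if hij : i < j then (h.2 ⟨(i, j), hij⟩).1 ^ 2 + (h.2 ⟨(i, j), hij⟩).2 ^ 2
      else if hji : j < i then (h.2 ⟨(j, i), hji⟩).1 ^ 2 + (h.2 ⟨(j, i), hji⟩).2 ^ 2
      else h.1 i ^ 2 := by
    intro i j
    rw [hermMatrix_apply, hermMatrix_apply]
    rcases lt_trichotomy i j with hij | rfl | hij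
    · simp only [hij, hij.not_gt, dif_pos, dif_neg, not_false_eq_true, Complex.mul_re]
      ring
    · simp [sq]
    · simp only [hij, hij.not_gt, dif_pos, dif_neg, not_false_eq_true, Complex.mul_re]
      ring
  have h1 : trPow h 2 = ∑ q : Fin N × Fin N, (hermMatrix h q.1 q.2 * hermMatrix h q.2 q.1).re := by
    rw [trPow, sq, Matrix.trace, Complex.re_sum, Fintype.sum_prod_type]
    refine Finset.sum_congr rfl fun i _ => ?_
    rw [Matrix.diag_apply, Matrix.mul_apply, Complex.re_sum]
  let f : Fin N × Fin N → ℝ := fun q => if hq : q.1 < q.2 then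
    (h.2 ⟨q, hq⟩).1 ^ 2 + (h.2 ⟨q, hq⟩).2 ^ 2 else 0
  let g : Fin N × Fin N → ℝ := fun q => if q.1 = q.2 then h.1 q.1 ^ 2 else 0
  have h2 : ∀ q : Fin N × Fin N, (hermMatrix h q.1 q.2 * hermMatrix h q.2 q.1).re =
      g q + f q + f q.swap := by
    rintro ⟨i, j⟩
    rw [h0]
    rcases lt_trichotomy i j with hij | rfl | hij
    · simp [f, g, hij, hij.ne, hij.not_gt]
    · simp [f, g]
    · simp [f, g, hij, hij.ne', hij.not_gt]
  have hf : ∑ q, f q = ∑ p, ((h.2 p).1 ^ 2 + (h.2 p).2 ^ 2) := by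
    rw [← Fintype.sum_subtype_add_sum_subtype (fun q : Fin N × Fin N => q.1 < q.2) f,
      Finset.sum_eq_zero (s := (Finset.univ : Finset {q : Fin N × Fin N // ¬ q.1 < q.2})), add_zero]
    · exact Finset.sum_congr rfl fun p _ => by simp [f, p.2]
    · exact fun p _ => by simp only [f, p.2, dif_neg, not_false_eq_true]
  have hg : ∑ q, g q = ∑ i, h.1 i ^ 2 := by
    rw [Fintype.sum_prod_type]
    simp [g]
  have hs : ∑ q : Fin N × Fin N, f q.swap = ∑ q, f q :=
    Equiv.sum_comp (Equiv.prodComm (Fin N) (Fin N)) f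
  rw [h1, Finset.sum_congr rfl fun q _ => h2 q, Finset.sum_add_distrib, Finset.sum_add_distrib,
    hs, hf, hg]
  ring

/-- The density of `gaussianHerm` as a product over the real coordinates. -/
noncomputable def hermDensity (t : ℝ) (h : HermCoord N) : ℝ :=
  (∏ i, gaussDensity (t / N) (h.1 i)) *
    ∏ p, (gaussDensity (t / (2 * N)) (h.2 p).1 * gaussDensity (t / (2 * N)) (h.2 p).2)

theorem hermDensity_nonneg (t : ℝ) (h : HermCoord N) : 0 ≤ hermDensity t h := by
  have : ∀ v x, 0 ≤ gaussDensity v x := fun v x => by unfold gaussDensity; positivity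
  exact mul_nonneg (Finset.prod_nonneg fun _ _ => this _ _)
    (Finset.prod_nonneg fun _ _ => mul_nonneg (this _ _) (this _ _))

theorem density_eq_hermDensity {t : ℝ} (hN : 1 ≤ N) (ht : 0 < t) (h : HermCoord N) :
    (Real.sqrt (2 ^ N * (Real.pi * t / N) ^ (N ^ 2)))⁻¹ *
      Real.exp (-((N : ℝ) / (2 * t)) * trPow h 2) = hermDensity t h := by
  have hN0 : (0 : ℝ) < N := by exact_mod_cast hN
  set x : ℝ := Real.pi * t / N with hx
  have hx0 : 0 < x := by positivity
  set m := Fintype.card {p : Fin N × Fin N // p.1 < p.2} with hm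
  have hcard : 2 * m + N = N ^ 2 := two_mul_card_lt N
  have e1 : 2 * Real.pi * (t / N) = 2 * x := by rw [hx]; ring
  have e2 : 2 * Real.pi * (t / (2 * N)) = x := by rw [hx]; field_simp
  have e3 : -(2 * (t / N))⁻¹ = -((N : ℝ) / (2 * t)) := by field_simp
  have e4 : -(2 * (t / (2 * N)))⁻¹ = -((N : ℝ) / (2 * t)) * 2 := by field_simp
  have hsq : Real.sqrt (2 ^ N * x ^ (N ^ 2)) = Real.sqrt (2 * x) ^ N * x ^ m := by
    rw [← hcard, pow_add, mul_comm 2 m, pow_mul]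
    rw [Real.sqrt_eq_iff_mul_self_eq (by positivity) (by positivity)]
    have h1 := Real.mul_self_sqrt (show 0 ≤ 2 * x by positivity)
    calc (2 : ℝ) ^ N * ((x ^ m) ^ 2 * x ^ N) = (2 * x) ^ N * (x ^ m) ^ 2 := by ring
      _ = _ := by rw [mul_mul_mul_comm, ← mul_pow, h1]; ring
  have hxx : (Real.sqrt x)⁻¹ * (Real.sqrt x)⁻¹ = x⁻¹ := by
    rw [← mul_inv, Real.mul_self_sqrt hx0.le]
  unfold hermDensity gaussDensity
  rw [hsq, trPow_two, e1, e2, e3, e4, Finset.prod_mul_distrib, ← Real.exp_sum]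
  have e5 : ∀ p : {p : Fin N × Fin N // p.1 < p.2},
      (Real.sqrt x)⁻¹ * Real.exp (-((N : ℝ) / (2 * t)) * 2 * (h.2 p).1 ^ 2) *
        ((Real.sqrt x)⁻¹ * Real.exp (-((N : ℝ) / (2 * t)) * 2 * (h.2 p).2 ^ 2)) =
      x⁻¹ * Real.exp (-((N : ℝ) / (2 * t)) * 2 * ((h.2 p).1 ^ 2 + (h.2 p).2 ^ 2)) := by
    intro p
    rw [mul_add, Real.exp_add, ← hxx]
    ring
  rw [Finset.prod_congr rfl fun p _ => e5 p, Finset.prod_mul_distrib, ← Real.exp_sum,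
    ← Finset.mul_sum, ← Finset.mul_sum, Finset.prod_const, Finset.prod_const, Finset.card_univ,
    Finset.card_univ, Fintype.card_fin, ← hm, mul_inv, inv_pow, inv_pow, mul_add, Real.exp_add,
    ← mul_assoc (-((N : ℝ) / (2 * t))) 2]
  ring

theorem gaussianHerm_eq {t : ℝ} (hN : 1 ≤ N) (ht : 0 < t) : gaussianHerm N t =
    (volume : Measure (HermCoord N)).withDensity fun h => ENNReal.ofReal (hermDensity t h) := by
  unfold gaussianHerm
  simp_rw [density_eq_hermDensity hN ht]

theorem measurable_hermDensity (t : ℝ) : Measurable (hermDensity (N := N) t) := by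
  unfold hermDensity gaussDensity
  fun_prop

theorem prod_coordVal_mul_hermDensity (t : ℝ) (e : CoordIdx N → ℕ) (h : HermCoord N) :
    (∏ c, coordVal h c ^ e c) * hermDensity t h =
      (∏ i, (h.1 i ^ e (Sum.inl i) * gaussDensity (t / N) (h.1 i))) *
      ∏ p, (((h.2 p).1 ^ e (Sum.inr (Sum.inl p)) * gaussDensity (t / (2 * N)) (h.2 p).1) *
        ((h.2 p).2 ^ e (Sum.inr (Sum.inr p)) * gaussDensity (t / (2 * N)) (h.2 p).2)) := by
  rw [Fintype.prod_sum_type, Fintype.prod_sum_type, hermDensity]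
  simp only [coordVal, Finset.prod_mul_distrib]
  ring

theorem integrable_prod_coordVal_mul_hermDensity {t : ℝ} (hN : 1 ≤ N) (ht : 0 < t)
    (e : CoordIdx N → ℕ) :
    Integrable fun h : HermCoord N => (∏ c, coordVal h c ^ e c) * hermDensity t h := by
  have hN0 : (0 : ℝ) < N := by exact_mod_cast hN
  simp_rw [prod_coordVal_mul_hermDensity]
  refine Integrable.mul_prod (μ := volume) (ν := volume)
    (f := fun h : Fin N → ℝ => ∏ i, (h i ^ e (Sum.inl i) * gaussDensity (t / N) (h i)))
    (g := fun h : {p : Fin N × Fin N // p.1 < p.2} → ℝ × ℝ => ∏ p,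
      (((h p).1 ^ e (Sum.inr (Sum.inl p)) * gaussDensity (t / (2 * N)) (h p).1) *
        ((h p).2 ^ e (Sum.inr (Sum.inr p)) * gaussDensity (t / (2 * N)) (h p).2))) ?_ ?_
  · exact Integrable.fintype_prod (f := fun i x => x ^ e (Sum.inl i) * gaussDensity (t / N) x)
      fun i => integrable_pow_mul_gaussDensity (by positivity) _
  · exact Integrable.fintype_prod (f := fun p (x : ℝ × ℝ) =>
      (x.1 ^ e (Sum.inr (Sum.inl p)) * gaussDensity (t / (2 * N)) x.1) *
        (x.2 ^ e (Sum.inr (Sum.inr p)) * gaussDensity (t / (2 * N)) x.2))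
      fun p => Integrable.mul_prod (μ := volume) (ν := volume)
        (integrable_pow_mul_gaussDensity (by positivity) _)
        (integrable_pow_mul_gaussDensity (by positivity) _)

theorem integral_prod_coordVal_mul_hermDensity {t : ℝ} (hN : 1 ≤ N) (ht : 0 < t)
    (e : CoordIdx N → ℕ) :
    ∫ h : HermCoord N, (∏ c, coordVal h c ^ e c) * hermDensity t h =
      ∏ c, gaussMoment (coordVar N t c) (e c) := by
  have hN0 : (0 : ℝ) < N := by exact_mod_cast hN
  simp_rw [prod_coordVal_mul_hermDensity]
  have h1 := integral_prod_mul (μ := volume) (ν := volume)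
    (f := fun h : Fin N → ℝ => ∏ i, (h i ^ e (Sum.inl i) * gaussDensity (t / N) (h i)))
    (g := fun h : {p : Fin N × Fin N // p.1 < p.2} → ℝ × ℝ => ∏ p,
      (((h p).1 ^ e (Sum.inr (Sum.inl p)) * gaussDensity (t / (2 * N)) (h p).1) *
        ((h p).2 ^ e (Sum.inr (Sum.inr p)) * gaussDensity (t / (2 * N)) (h p).2)))
  have h2 := integral_fintype_prod_volume_eq_prod
    (f := fun (i : Fin N) x => x ^ e (Sum.inl i) * gaussDensity (t / N) x)
  have h3 := integral_fintype_prod_volume_eq_prod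
    (f := fun (p : {p : Fin N × Fin N // p.1 < p.2}) (x : ℝ × ℝ) =>
      (x.1 ^ e (Sum.inr (Sum.inl p)) * gaussDensity (t / (2 * N)) x.1) *
        (x.2 ^ e (Sum.inr (Sum.inr p)) * gaussDensity (t / (2 * N)) x.2))
  have h4 : ∀ p : {p : Fin N × Fin N // p.1 < p.2},
      ∫ x : ℝ × ℝ, (x.1 ^ e (Sum.inr (Sum.inl p)) * gaussDensity (t / (2 * N)) x.1) *
        (x.2 ^ e (Sum.inr (Sum.inr p)) * gaussDensity (t / (2 * N)) x.2) =
      gaussMoment (t / (2 * N)) (e (Sum.inr (Sum.inl p))) *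
        gaussMoment (t / (2 * N)) (e (Sum.inr (Sum.inr p))) := by
    intro p
    rw [← integral_pow_mul_gaussDensity (by positivity), ← integral_pow_mul_gaussDensity
      (by positivity)]
    exact integral_prod_mul (μ := volume) (ν := volume)
      (fun x : ℝ => x ^ e (Sum.inr (Sum.inl p)) * gaussDensity (t / (2 * N)) x)
      (fun x : ℝ => x ^ e (Sum.inr (Sum.inr p)) * gaussDensity (t / (2 * N)) x)
  refine h1.trans ?_
  rw [h2, h3, Finset.prod_congr rfl fun p _ => h4 p, Fintype.prod_sum_type, Fintype.prod_sum_type,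
    Finset.prod_mul_distrib]
  simp only [coordVar]
  congr 1
  exact Finset.prod_congr rfl fun i _ => integral_pow_mul_gaussDensity (by positivity) _

theorem integral_gaussianHerm {t : ℝ} (hN : 1 ≤ N) (ht : 0 < t) (f : HermCoord N → ℝ) :
    ∫ h, f h ∂(gaussianHerm N t) = ∫ h, f h * hermDensity t h := by
  rw [gaussianHerm_eq hN ht, integral_withDensity_eq_integral_toReal_smul
    (measurable_hermDensity t).ennreal_ofReal (by simp)]
  refine integral_congr_ae (Filter.Eventually.of_forall fun h => ?_)
  simp only [ENNReal.toReal_ofReal (hermDensity_nonneg t h), smul_eq_mul]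
  ring

theorem integrable_gaussianHerm {t : ℝ} (hN : 1 ≤ N) (ht : 0 < t) {f : HermCoord N → ℝ} :
    Integrable f (gaussianHerm N t) ↔ Integrable fun h => f h * hermDensity t h := by
  rw [gaussianHerm_eq hN ht, integrable_withDensity_iff
    (measurable_hermDensity t).ennreal_ofReal (by simp)]
  simp only [ENNReal.toReal_ofReal (hermDensity_nonneg t _)]

theorem isProbabilityMeasure_gaussianHerm {t : ℝ} (hN : 1 ≤ N) (ht : 0 < t) :
    IsProbabilityMeasure (gaussianHerm N t) := by
  have hi := integrable_prod_coordVal_mul_hermDensity hN ht (fun _ => 0)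
  have h1 := integral_prod_coordVal_mul_hermDensity hN ht (fun _ => 0)
  simp only [pow_zero, Finset.prod_const_one, one_mul, gaussMoment] at hi h1
  constructor
  rw [gaussianHerm_eq hN ht, withDensity_apply _ MeasurableSet.univ, Measure.restrict_univ,
    ← ofReal_integral_eq_lintegral_ofReal hi
      (Filter.Eventually.of_forall fun h => hermDensity_nonneg t h), h1, ENNReal.ofReal_one]

theorem integrable_prod_coordVal {t : ℝ} (hN : 1 ≤ N) (ht : 0 < t) (e : CoordIdx N → ℕ) :
    Integrable (fun h : HermCoord N => ∏ c, coordVal h c ^ e c) (gaussianHerm N t) :=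
  (integrable_gaussianHerm hN ht).2 (integrable_prod_coordVal_mul_hermDensity hN ht e)

theorem integral_prod_coordVal {t : ℝ} (hN : 1 ≤ N) (ht : 0 < t) (e : CoordIdx N → ℕ) :
    ∫ h : HermCoord N, ∏ c, coordVal h c ^ e c ∂(gaussianHerm N t) =
      ∏ c, gaussMoment (coordVar N t c) (e c) := by
  rw [integral_gaussianHerm hN ht, integral_prod_coordVal_mul_hermDensity hN ht]

end Hermitian

/-! ### Pairings and Wick's theorem -/

section Pairings

variable {ι : Type*} [Fintype ι] [DecidableEq ι]

/-- The pairings of a finite set `T`, as involutions of the ambient type with support `T`. -/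
def pairings (T : Finset ι) : Finset (Equiv.Perm ι) :=
  Finset.univ.filter fun α => (∀ s, α (α s) = s) ∧ ∀ s, α s ≠ s ↔ s ∈ T

theorem mem_pairings {T : Finset ι} {α : Equiv.Perm ι} :
    α ∈ pairings T ↔ (∀ s, α (α s) = s) ∧ ∀ s, α s ≠ s ↔ s ∈ T := by
  simp [pairings]

theorem pairings_empty : pairings (∅ : Finset ι) = {1} := by
  ext α
  rw [mem_pairings, Finset.mem_singleton]
  constructor
  · intro h
    ext s
    simpa using h.2 s
  · rintro rfl
    simp

theorem apply_mem_of_mem_pairings {T : Finset ι} {α : Equiv.Perm ι} (h : α ∈ pairings T) {s : ι}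
    (hs : s ∈ T) : α s ∈ T := by
  rw [mem_pairings] at h
  rw [← h.2, h.1]
  exact fun h' => (h.2 s).2 hs h'.symm

/-- A pairing of `insert s T` consists of a partner `u ∈ T` of `s` and a pairing of the rest. -/
theorem sum_pairings_insert {M : Type*} [AddCommMonoid M] {s : ι} {T : Finset ι} (hs : s ∉ T)
    (F : Equiv.Perm ι → M) :
    ∑ α ∈ pairings (insert s T), F α =
      ∑ u ∈ T, ∑ β ∈ pairings (T.erase u), F (Equiv.swap s u * β) := by
  rw [Finset.sum_sigma']
  have key : ∀ u ∈ T, ∀ β ∈ pairings (T.erase u), β s = s ∧ β u = u ∧ s ≠ u := by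
    intro u hu β hβ
    rw [mem_pairings] at hβ
    refine ⟨not_not.1 fun h => hs (Finset.mem_of_mem_erase ((hβ.2 s).1 h)),
      not_not.1 fun h => Finset.notMem_erase u T ((hβ.2 u).1 h), ?_⟩
    rintro rfl
    exact hs hu
  refine Finset.sum_bij' (i := fun α _ => (⟨α s, Equiv.swap s (α s) * α⟩ : Σ _ : ι, Equiv.Perm ι))
    (j := fun p _ => Equiv.swap s p.1 * p.2) ?_ ?_ ?_ ?_ ?_
  · intro α hα
    have hα' := mem_pairings.1 hα
    have h1 : α s ≠ s := (hα'.2 s).2 (Finset.mem_insert_self _ _)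
    rw [Finset.mem_sigma]
    refine ⟨Finset.mem_of_mem_insert_of_ne
      (apply_mem_of_mem_pairings hα (Finset.mem_insert_self _ _)) h1, ?_⟩
    rw [mem_pairings]
    have hval : ∀ x, (Equiv.swap s (α s) * α) x =
        if x = s then s else if x = α s then α s else α x := by
      intro x
      rw [Equiv.Perm.mul_apply]
      by_cases hx : x = s
      · subst hx; simp
      by_cases hx2 : x = α s
      · subst hx2; simp [hα'.1, h1]
      rw [if_neg hx, if_neg hx2, Equiv.swap_apply_of_ne_of_ne]
      · intro h
        exact hx2 (by rw [← h, hα'.1])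
      · exact fun h => hx (α.injective h)
    constructor
    · intro x
      rw [hval x]
      by_cases hx : x = s
      · rw [if_pos hx, hval, if_pos rfl, hx]
      by_cases hx2 : x = α s
      · rw [if_neg hx, if_pos hx2, hval, if_neg h1, if_pos rfl, hx2]
      rw [if_neg hx, if_neg hx2, hval, if_neg, if_neg, hα'.1]
      · exact fun h => hx (α.injective h)
      · intro h
        exact hx2 (by rw [← h, hα'.1])
    · intro x
      rw [hval x, Finset.mem_erase]
      by_cases hx : x = s
      · subst hx; simp [hs]
      by_cases hx2 : x = α s
      · subst hx2; simp [h1]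
      rw [if_neg hx, if_neg hx2, hα'.2]
      simp [hx, hx2]
  · rintro ⟨u, β⟩ hp
    rw [Finset.mem_sigma] at hp
    obtain ⟨hu, hβ⟩ := hp
    obtain ⟨h1, h2, h3⟩ := key u hu β hβ
    have hβ' := mem_pairings.1 hβ
    dsimp only at hu hβ h1 h2 h3 hβ' ⊢
    have hval : ∀ x, (Equiv.swap s u * β) x =
        if x = s then u else if x = u then s else β x := by
      intro x
      rw [Equiv.Perm.mul_apply]
      by_cases hx : x = s
      · subst hx; simp [h1]
      by_cases hx2 : x = u
      · subst hx2; simp [h2, hx]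
      rw [if_neg hx, if_neg hx2, Equiv.swap_apply_of_ne_of_ne]
      · intro h
        exact hx (β.injective (h.trans h1.symm))
      · intro h
        exact hx2 (β.injective (h.trans h2.symm))
    rw [mem_pairings]
    constructor
    · intro x
      rw [hval x]
      by_cases hx : x = s
      · rw [if_pos hx, hval, if_neg h3.symm, if_pos rfl, hx]
      by_cases hx2 : x = u
      · rw [if_neg hx, if_pos hx2, hval, if_pos rfl, hx2]
      rw [if_neg hx, if_neg hx2, hval, if_neg, if_neg, hβ'.1]
      · intro h
        exact hx2 (β.injective (h.trans h2.symm))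
      · intro h
        exact hx (β.injective (h.trans h1.symm))
    · intro x
      rw [hval x, Finset.mem_insert]
      by_cases hx : x = s
      · subst hx; simp [h3.symm]
      by_cases hx2 : x = u
      · subst hx2; simp [h3, hx, hu]
      rw [if_neg hx, if_neg hx2, hβ'.2, Finset.mem_erase]
      simp [hx, hx2]
  · intro α hα
    simp [← mul_assoc]
  · rintro ⟨u, β⟩ hp
    rw [Finset.mem_sigma] at hp
    obtain ⟨h1, h2, h3⟩ := key u hp.1 β hp.2
    dsimp only at h1 h2 h3 ⊢
    have h4 : (Equiv.swap s u * β) s = u := by simp [h1]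
    rw [h4]
    simp [← mul_assoc]
  · intro α hα
    simp [← mul_assoc]

/-- Wick's theorem for the entries of a Hermitian matrix: a functional `L` that satisfies the
integration by parts formula with covariance `r² [a s = b u] [b s = a u]` is computed on products by
a sum over pairings. -/
theorem wick_of_integration_by_parts {n R : Type*} [DecidableEq n] [CommRing R] {𝕜 : Type*}
    [CommRing 𝕜] (L : R → 𝕜) (x : ι → R) (a b : ι → n) (r : 𝕜) (h1 : L 1 = 1)
    (hL : ∀ s T, s ∉ T → L (x s * ∏ u ∈ T, x u) =
      ∑ u ∈ T, r ^ 2 * (if a s = b u ∧ b s = a u then 1 else 0) * L (∏ v ∈ T.erase u, x v))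
    (T : Finset ι) :
    L (∏ s ∈ T, x s) =
      ∑ α ∈ pairings T, r ^ T.card * (if ∀ s ∈ T, a s = b (α s) then 1 else 0) := by
  induction hT : T.card using Nat.strong_induction_on generalizing T with
  | _ m ih =>
  rcases T.eq_empty_or_nonempty with rfl | ⟨s, hs⟩
  · rw [Finset.card_empty] at hT
    simp [pairings_empty, h1, ← hT]
  obtain ⟨T, hsT, rfl⟩ : ∃ T', s ∉ T' ∧ T = insert s T' :=
    ⟨T.erase s, Finset.notMem_erase _ _, (Finset.insert_erase hs).symm⟩
  rw [Finset.prod_insert hsT, hL s T hsT, sum_pairings_insert hsT]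
  refine Finset.sum_congr rfl fun u hu => ?_
  have hc : (T.erase u).card + 2 = m := by
    rw [← hT, Finset.card_insert_of_notMem hsT, ← Finset.card_erase_add_one hu]
  rw [ih _ (by omega) (T.erase u) rfl, Finset.mul_sum]
  refine Finset.sum_congr rfl fun β hβ => ?_
  have hβ' := mem_pairings.1 hβ
  have hsu : s ≠ u := fun h => hsT (h ▸ hu)
  have hβs : β s = s := not_not.1 fun h => hsT (Finset.mem_of_mem_erase ((hβ'.2 s).1 h))
  have hβu : β u = u := not_not.1 fun h => Finset.notMem_erase u T ((hβ'.2 u).1 h)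
  have e : (∀ y ∈ insert s T, a y = b ((Equiv.swap s u * β) y)) ↔
      (a s = b u ∧ b s = a u) ∧ ∀ y ∈ T.erase u, a y = b (β y) := by
    have hval : ∀ y ∈ T.erase u, (Equiv.swap s u * β) y = β y := by
      intro y hy
      have hy' := apply_mem_of_mem_pairings hβ hy
      rw [Equiv.Perm.mul_apply, Equiv.swap_apply_of_ne_of_ne]
      · intro h
        exact hsT (h ▸ Finset.mem_of_mem_erase hy')
      · exact Finset.ne_of_mem_erase hy'
    constructor
    · intro h
      refine ⟨⟨?_, ?_⟩, fun y hy => ?_⟩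
      · simpa [hβs] using h s (Finset.mem_insert_self _ _)
      · simpa [hβu] using (h u (Finset.mem_insert_of_mem hu)).symm
      · rw [← hval y hy]
        exact h y (Finset.mem_insert_of_mem (Finset.mem_of_mem_erase hy))
    · rintro ⟨⟨h2, h3⟩, h4⟩ y hy
      rcases Finset.mem_insert.1 hy with rfl | hy
      · simpa [hβs] using h2
      · by_cases hyu : y = u
        · subst hyu
          simpa [hβu] using h3.symm
        · have := Finset.mem_erase.2 ⟨hyu, hy⟩
          rw [hval y this]
          exact h4 y this
  rw [← hc, pow_add]
  by_cases h2 : a s = b u ∧ b s = a u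
  · by_cases h3 : ∀ y ∈ T.erase u, a y = b (β y)
    · rw [if_pos h2, if_pos h3, if_pos (e.2 ⟨h2, h3⟩)]
      ring
    · rw [if_neg h3, if_neg fun h => h3 (e.1 h).2]
      ring
  · rw [if_neg h2, if_neg fun h => h2 (e.1 h).1]
    ring

end Pairings

/-! ### Gaussian integrals of products of matrix entries -/

section GaussFunctional

variable {κ : Type*}

/-- The expectation of polynomials in independent centred Gaussian variables of variances `v`. -/
noncomputable def gaussFunctional [Fintype κ] (v : κ → ℝ) : MvPolynomial κ ℂ →ₗ[ℂ] ℂ :=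
  (MvPolynomial.basisMonomials κ ℂ).constr ℂ fun e => ((∏ c, gaussMoment (v c) (e c) : ℝ) : ℂ)

theorem gaussFunctional_monomial [Fintype κ] (v : κ → ℝ) (e : κ →₀ ℕ) (a : ℂ) :
    gaussFunctional v (MvPolynomial.monomial e a) =
      a * ((∏ c, gaussMoment (v c) (e c) : ℝ) : ℂ) := by
  have h : MvPolynomial.monomial e a = a • MvPolynomial.basisMonomials κ ℂ e := by
    rw [MvPolynomial.coe_basisMonomials, MvPolynomial.smul_monomial, smul_eq_mul, mul_one]
  rw [h, map_smul, gaussFunctional, Module.Basis.constr_basis, smul_eq_mul]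

/-- Gaussian integration by parts. -/
theorem gaussFunctional_X_mul [Fintype κ] (v : κ → ℝ) (c : κ) (p : MvPolynomial κ ℂ) :
    gaussFunctional v (MvPolynomial.X c * p) =
      v c * gaussFunctional v (MvPolynomial.pderiv c p) := by
  classical
  induction p using MvPolynomial.induction_on' with
  | add p q hp hq => rw [mul_add, map_add, map_add, map_add, hp, hq, mul_add]
  | monomial e a =>
    have h : MvPolynomial.X c * MvPolynomial.monomial e a =
        MvPolynomial.monomial (Finsupp.single c 1 + e) a := by
      rw [MvPolynomial.monomial_single_add, pow_one]
    rw [h, MvPolynomial.pderiv_monomial, gaussFunctional_monomial, gaussFunctional_monomial,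
      ← Finset.mul_prod_erase _ _ (Finset.mem_univ c),
      ← Finset.mul_prod_erase Finset.univ _ (Finset.mem_univ c)]
    have e1 : ∏ c' ∈ Finset.univ.erase c, gaussMoment (v c') ((Finsupp.single c 1 + e : κ →₀ ℕ) c') =
        ∏ c' ∈ Finset.univ.erase c, gaussMoment (v c') ((e - Finsupp.single c 1 : κ →₀ ℕ) c') := by
      refine Finset.prod_congr rfl fun c' hc' => ?_
      have : c ≠ c' := (Finset.ne_of_mem_erase hc').symm
      simp [this]
    rw [e1]
    simp only [Finsupp.add_apply, Finsupp.tsub_apply, Finsupp.single_eq_same]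
    rcases hk : e c with _ | k
    · simp [gaussMoment]
    · have : 1 + (k + 1) = k + 2 := by ring
      rw [this, Nat.add_sub_cancel, gaussMoment]
      push_cast
      ring

theorem pderiv_prod {ι : Type*} [DecidableEq ι] (c : κ) (f : ι → MvPolynomial κ ℂ) (T : Finset ι) :
    MvPolynomial.pderiv c (∏ u ∈ T, f u) =
      ∑ u ∈ T, MvPolynomial.pderiv c (f u) * ∏ w ∈ T.erase u, f w := by
  induction T using Finset.induction_on with
  | empty => simp
  | insert s T hs ih =>
    rw [Finset.prod_insert hs, MvPolynomial.pderiv_mul, ih, Finset.sum_insert hs,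
      Finset.erase_insert hs, Finset.mul_sum]
    congr 1
    refine Finset.sum_congr rfl fun u hu => ?_
    have : s ≠ u := fun h => hs (h ▸ hu)
    rw [Finset.erase_insert_of_ne this, Finset.prod_insert
      fun h => hs (Finset.mem_of_mem_erase h)]
    ring

/-- The linear form with coefficients `γ`. -/
noncomputable def linForm [Fintype κ] (γ : κ → ℂ) : MvPolynomial κ ℂ :=
  ∑ c, MvPolynomial.C (γ c) * MvPolynomial.X c

theorem gaussFunctional_linForm_mul [Fintype κ] {ι : Type*} [DecidableEq ι] (v : κ → ℝ) (γ : ι → κ → ℂ) (s : ι)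
    (T : Finset ι) :
    gaussFunctional v (linForm (γ s) * ∏ u ∈ T, linForm (γ u)) =
      ∑ u ∈ T, (∑ c, γ s c * v c * γ u c) *
        gaussFunctional v (∏ w ∈ T.erase u, linForm (γ w)) := by
  have hd : ∀ (δ : κ → ℂ) (c : κ), MvPolynomial.pderiv c (linForm δ) = MvPolynomial.C (δ c) := by
    intro δ c
    rw [linForm, map_sum, Finset.sum_eq_single c]
    · simp
    · intro c' _ h
      simp [MvPolynomial.pderiv_X_of_ne h]
    · simp
  rw [linForm, Finset.sum_mul, map_sum]
  have h1 : ∀ c, gaussFunctional v (MvPolynomial.C (γ s c) * MvPolynomial.X c *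
      ∏ u ∈ T, linForm (γ u)) = ∑ u ∈ T, γ s c * v c * γ u c *
        gaussFunctional v (∏ w ∈ T.erase u, linForm (γ w)) := by
    intro c
    rw [mul_assoc, ← MvPolynomial.smul_eq_C_mul, map_smul, gaussFunctional_X_mul, pderiv_prod,
      map_sum, smul_eq_mul, Finset.mul_sum, Finset.mul_sum]
    refine Finset.sum_congr rfl fun u _ => ?_
    rw [hd, ← MvPolynomial.smul_eq_C_mul, map_smul, smul_eq_mul]
    ring
  rw [Finset.sum_congr rfl fun c _ => h1 c, Finset.sum_comm]
  exact Finset.sum_congr rfl fun u _ => (Finset.sum_mul _ _ _).symm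

end GaussFunctional

section HermWick

variable {N : ℕ}

/-- The coefficients of a matrix entry as a linear form in the real coordinates. -/
noncomputable def entryCoeff (a b : Fin N) : CoordIdx N → ℂ
  | Sum.inl i => if a = i ∧ b = i then 1 else 0
  | Sum.inr (Sum.inl p) => (if p.1 = (a, b) then 1 else 0) + (if p.1 = (b, a) then 1 else 0)
  | Sum.inr (Sum.inr p) => (if p.1 = (a, b) then Complex.I else 0) -
      (if p.1 = (b, a) then Complex.I else 0)

theorem sum_ite_val_eq {M : Type*} [AddCommMonoid M] (q : Fin N × Fin N)
    (f : {p : Fin N × Fin N // p.1 < p.2} → M) :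
    ∑ p, (if p.1 = q then f p else 0) = if h : q.1 < q.2 then f ⟨q, h⟩ else 0 := by
  split_ifs with h
  · rw [Finset.sum_eq_single ⟨q, h⟩]
    · simp
    · intro p _ hp
      rw [if_neg fun h' => hp (Subtype.ext h')]
    · simp
  · refine Finset.sum_eq_zero fun p _ => if_neg ?_
    rintro rfl
    exact h p.2

theorem hermMatrix_eq_sum (h : HermCoord N) (a b : Fin N) :
    hermMatrix h a b = ∑ c, entryCoeff a b c * (coordVal h c : ℂ) := by
  rw [Fintype.sum_sum_type, Fintype.sum_sum_type]
  simp only [entryCoeff, coordVal, add_mul, sub_mul, ite_mul, one_mul, zero_mul,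
    Finset.sum_add_distrib, Finset.sum_sub_distrib, sum_ite_val_eq]
  rw [hermMatrix_apply]
  rcases lt_trichotomy a b with hab | rfl | hab
  · have : ∑ i : Fin N, (if a = i ∧ b = i then ((h.1 i : ℝ) : ℂ) else 0) = 0 :=
      Finset.sum_eq_zero fun i _ => if_neg fun hi => hab.ne (hi.1.trans hi.2.symm)
    rw [this]
    simp only [hab, hab.not_gt, dif_pos, dif_neg, not_false_eq_true]
    apply Complex.ext <;> simp
  · simp
  · have : ∑ i : Fin N, (if a = i ∧ b = i then ((h.1 i : ℝ) : ℂ) else 0) = 0 :=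
      Finset.sum_eq_zero fun i _ => if_neg fun hi => hab.ne' (hi.1.trans hi.2.symm)
    rw [this]
    simp only [hab, hab.not_gt, dif_pos, dif_neg, not_false_eq_true]
    apply Complex.ext <;> simp

/-- The covariance of two matrix entries. -/
theorem sum_entryCoeff_mul (t : ℝ) (a b c d : Fin N) :
    ∑ x, entryCoeff a b x * (coordVar N t x : ℂ) * entryCoeff c d x =
      ((t / N : ℝ) : ℂ) * (if a = d ∧ b = c then 1 else 0) := by
  rw [Fintype.sum_sum_type, Fintype.sum_sum_type, ← Finset.sum_add_distrib]
  have e : ∀ p : {p : Fin N × Fin N // p.1 < p.2},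
      entryCoeff a b (Sum.inr (Sum.inl p)) * (coordVar N t (Sum.inr (Sum.inl p)) : ℂ) *
        entryCoeff c d (Sum.inr (Sum.inl p)) +
      entryCoeff a b (Sum.inr (Sum.inr p)) * (coordVar N t (Sum.inr (Sum.inr p)) : ℂ) *
        entryCoeff c d (Sum.inr (Sum.inr p)) =
      (if p.1 = (a, b) then (if p.1 = (d, c) then ((t / N : ℝ) : ℂ) else 0) else 0) +
      (if p.1 = (b, a) then (if p.1 = (c, d) then ((t / N : ℝ) : ℂ) else 0) else 0) := by
    intro p
    have hv : ((t / N : ℝ) : ℂ) = 2 * ((t / (2 * N) : ℝ) : ℂ) := by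
      push_cast
      rw [← mul_div_assoc, mul_div_mul_left _ _ two_ne_zero]
    rw [hv]
    simp only [entryCoeff, coordVar]
    split_ifs <;> ring_nf <;> simp only [Complex.I_sq] <;> ring
  rw [Finset.sum_congr rfl fun p _ => e p, Finset.sum_add_distrib, sum_ite_val_eq, sum_ite_val_eq]
  have e2 : ∑ i : Fin N, entryCoeff a b (Sum.inl i) * (coordVar N t (Sum.inl i) : ℂ) *
      entryCoeff c d (Sum.inl i) = if a = b then (if a = d ∧ b = c then ((t / N : ℝ) : ℂ) else 0)
        else 0 := by
    rw [Finset.sum_eq_single a]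
    · simp only [entryCoeff, coordVar]
      by_cases hab : a = b
      · subst hab
        by_cases h1 : a = d <;> by_cases h2 : a = c <;> simp [h1, h2, eq_comm]
      · simp [hab, Ne.symm hab]
    · intro i _ hi
      simp [entryCoeff, hi.symm]
    · simp
  rw [e2]
  simp only [Prod.mk.injEq]
  rcases lt_trichotomy a b with hab | rfl | hab
  · simp [hab, hab.ne, hab.not_gt]
  · simp
  · simp only [hab, hab.ne', hab.not_gt, if_false, dif_neg, dif_pos, not_false_eq_true, zero_add]
    by_cases h1 : a = d <;> by_cases h2 : b = c <;> simp [h1, h2]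

/-- Expectations of polynomials in the coordinates. -/
theorem integral_aeval {t : ℝ} (hN : 1 ≤ N) (ht : 0 < t) (p : MvPolynomial (CoordIdx N) ℂ) :
    Integrable (fun h : HermCoord N => MvPolynomial.aeval (fun c => (coordVal h c : ℂ)) p)
      (gaussianHerm N t) ∧
    ∫ h, MvPolynomial.aeval (fun c => (coordVal h c : ℂ)) p ∂(gaussianHerm N t) =
      gaussFunctional (coordVar N t) p := by
  induction p using MvPolynomial.induction_on' with
  | add p q hp hq =>
    simp only [map_add]
    exact ⟨hp.1.add hq.1, by rw [integral_add hp.1 hq.1, hp.2, hq.2]⟩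
  | monomial e a =>
    have h1 : ∀ h : HermCoord N, MvPolynomial.aeval (fun c => (coordVal h c : ℂ))
        (MvPolynomial.monomial e a) = a * ((∏ c, coordVal h c ^ e c : ℝ) : ℂ) := by
      intro h
      rw [MvPolynomial.aeval_monomial, Finsupp.prod_fintype _ _ fun _ => pow_zero _]
      push_cast
      rfl
    simp only [h1]
    refine ⟨((integrable_prod_coordVal hN ht e).ofReal).const_mul a, ?_⟩
    rw [integral_const_mul, integral_complex_ofReal, integral_prod_coordVal hN ht, gaussFunctional_monomial]

/-- Wick's theorem for the Gaussian measure on Hermitian matrices. -/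
theorem integral_prod_hermMatrix {ι : Type*} [Fintype ι] [DecidableEq ι] {t : ℝ} (hN : 1 ≤ N)
    (ht : 0 < t) (a b : ι → Fin N) (T : Finset ι) :
    Integrable (fun h : HermCoord N => ∏ s ∈ T, hermMatrix h (a s) (b s)) (gaussianHerm N t) ∧
    ∫ h, ∏ s ∈ T, hermMatrix h (a s) (b s) ∂(gaussianHerm N t) =
      ∑ α ∈ pairings T, ((Real.sqrt (t / N) : ℝ) : ℂ) ^ T.card *
        (if ∀ s ∈ T, a s = b (α s) then 1 else 0) := by
  have hev : ∀ h : HermCoord N, ∏ s ∈ T, hermMatrix h (a s) (b s) =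
      MvPolynomial.aeval (fun c => (coordVal h c : ℂ))
        (∏ s ∈ T, linForm (entryCoeff (a s) (b s))) := by
    intro h
    rw [map_prod]
    refine Finset.prod_congr rfl fun s _ => ?_
    rw [hermMatrix_eq_sum, linForm, map_sum]
    simp
  have hr : ((Real.sqrt (t / N) : ℝ) : ℂ) ^ 2 = ((t / N : ℝ) : ℂ) := by
    rw [← Complex.ofReal_pow, Real.sq_sqrt (by positivity)]
  simp only [hev]
  refine ⟨(integral_aeval hN ht _).1, ?_⟩
  rw [(integral_aeval hN ht _).2]
  refine wick_of_integration_by_parts (gaussFunctional (coordVar N t)) _ a b _ ?_ ?_ T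
  · rw [← MvPolynomial.C_1, ← MvPolynomial.monomial_zero', gaussFunctional_monomial]
    simp [gaussMoment]
  · intro s T _
    rw [gaussFunctional_linForm_mul (coordVar N t) (fun s => entryCoeff (a s) (b s))]
    refine Finset.sum_congr rfl fun u _ => ?_
    rw [sum_entryCoeff_mul, hr]

end HermWick

/-! ### Sums over pairings and their decomposition into connected parts -/

section Pinned

variable {ι π : Type*} [Fintype ι] [DecidableEq π]
  (pc : ι → π) (nx : Equiv.Perm ι) (N : ℕ) [NeZero N] (ζ : π → ℝ)

/-- The sides of the pieces in `Q`. -/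
def sidesOf (Q : Finset π) : Finset ι := Finset.univ.filter fun s => pc s ∈ Q

theorem mem_sidesOf {Q : Finset π} {s : ι} : s ∈ sidesOf pc Q ↔ pc s ∈ Q := by
  simp [sidesOf]

variable [DecidableEq ι]

/-- The colourings, by `N` colours, of the vertices of the surface obtained from the pieces in `Q`
through the pairing `α`: each side carries the colour of its initial vertex. The sides of the other
pieces have the colour `0`. -/
def colorings (Q : Finset π) (α : Equiv.Perm ι) : Finset (ι → Fin N) :=
  Finset.univ.filter fun i => ∀ s, if pc s ∈ Q then i s = i (nx (α s)) else i s = 0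

theorem mem_colorings {Q : Finset π} {α : Equiv.Perm ι} {i : ι → Fin N} :
    i ∈ colorings pc nx N Q α ↔
      (∀ s, pc s ∈ Q → i s = i (nx (α s))) ∧ ∀ s, pc s ∉ Q → i s = 0 := by
  simp only [colorings, Finset.mem_filter, Finset.mem_univ, true_and]
  constructor
  · intro h
    exact ⟨fun s hs => by simpa [hs] using h s, fun s hs => by simpa [hs] using h s⟩
  · intro h s
    split_ifs with hs
    exacts [h.1 s hs, h.2 s hs]

/-- The weight of a pairing: a factor `ζ q` for each piece, and the number of colourings. -/
noncomputable def pairingWeight (Q : Finset π) (α : Equiv.Perm ι) : ℝ :=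
  (∏ q ∈ Q, ζ q) * (colorings pc nx N Q α).card

/-- The sum over all pairings of the sides of the pieces in `Q`. -/
noncomputable def pairingSum (Q : Finset π) : ℝ :=
  ∑ α ∈ pairings (sidesOf pc Q), pairingWeight pc nx N ζ Q α

/-- A set of pieces that is a union of connected components for the gluing `α`. -/
def ClosedUnder (α : Equiv.Perm ι) (U : Finset π) : Prop := ∀ s, pc s ∈ U → pc (α s) ∈ U

/-- The pieces in `Q` form a single component, namely the one of the piece `p`. -/
def ConnectedFrom (p : π) (Q : Finset π) (α : Equiv.Perm ι) : Prop :=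
  ∀ U ⊆ Q, p ∈ U → ClosedUnder pc α U → U = Q

open Classical in
/-- The sum over the pairings of the sides of `Q` for which `Q` is connected. -/
noncomputable def connectedSum (p : π) (Q : Finset π) : ℝ :=
  ∑ α ∈ (pairings (sidesOf pc Q)).filter (ConnectedFrom pc p Q), pairingWeight pc nx N ζ Q α

theorem pairingSum_empty : pairingSum pc nx N ζ ∅ = 1 := by
  have h : sidesOf pc ∅ = ∅ := by ext; simp [sidesOf]
  have hc : colorings pc nx N ∅ 1 = {fun _ => 0} := by
    ext i
    rw [mem_colorings, Finset.mem_singleton]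
    simp [funext_iff]
  rw [pairingSum, h, pairings_empty, Finset.sum_singleton, pairingWeight, hc]
  simp

variable {pc nx N ζ}

theorem pc_apply_mem {Q : Finset π} {α : Equiv.Perm ι} (h : α ∈ pairings (sidesOf pc Q)) :
    ClosedUnder pc α Q := fun _ hs =>
  (mem_sidesOf pc).1 (apply_mem_of_mem_pairings h ((mem_sidesOf pc).2 hs))

theorem apply_eq_of_notMem {Q : Finset π} {α : Equiv.Perm ι} (h : α ∈ pairings (sidesOf pc Q))
    {s : ι} (hs : pc s ∉ Q) : α s = s :=
  not_not.1 fun h' => hs ((mem_sidesOf pc).1 (((mem_pairings.1 h).2 s).1 h'))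

/-- Two pairings of the sides of disjoint sets of pieces act independently. -/
theorem mul_apply_eq_ite {R R' : Finset π} (hd : Disjoint R R') {α β : Equiv.Perm ι}
    (hα : α ∈ pairings (sidesOf pc R)) (hβ : β ∈ pairings (sidesOf pc R')) (s : ι) :
    (α * β) s = if pc s ∈ R then α s else β s := by
  rw [Equiv.Perm.mul_apply]
  split_ifs with hs
  · rw [apply_eq_of_notMem hβ (Finset.disjoint_left.1 hd hs)]
  · refine apply_eq_of_notMem hα fun h => ?_
    by_cases hs' : pc s ∈ R'
    · exact Finset.disjoint_left.1 hd h (pc_apply_mem hβ s hs')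
    · rw [apply_eq_of_notMem hβ hs'] at h
      exact hs h

theorem mul_mem_pairings {R R' : Finset π} (hd : Disjoint R R') {α β : Equiv.Perm ι}
    (hα : α ∈ pairings (sidesOf pc R)) (hβ : β ∈ pairings (sidesOf pc R')) :
    α * β ∈ pairings (sidesOf pc (R ∪ R')) := by
  have hv := mul_apply_eq_ite hd hα hβ
  have hα' := mem_pairings.1 hα
  have hβ' := mem_pairings.1 hβ
  rw [mem_pairings]
  refine ⟨fun s => ?_, fun s => ?_⟩
  · rw [hv s]
    split_ifs with hs
    · rw [hv, if_pos (pc_apply_mem hα s hs), hα'.1]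
    · rw [hv, if_neg, hβ'.1]
      intro h
      by_cases hs' : pc s ∈ R'
      · exact Finset.disjoint_left.1 hd h (pc_apply_mem hβ s hs')
      · rw [apply_eq_of_notMem hβ hs'] at h
        exact hs h
  · rw [hv s, mem_sidesOf, Finset.mem_union]
    split_ifs with hs
    · rw [hα'.2, mem_sidesOf]
      simp [hs]
    · rw [hβ'.2, mem_sidesOf]
      simp [hs]

/-- Colourings of two disjoint sets of pieces, each glued to itself, are chosen independently. -/
theorem card_colorings_mul (hnx : ∀ s, pc (nx s) = pc s) {R R' : Finset π} (hd : Disjoint R R')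
    {α β : Equiv.Perm ι} (hα : α ∈ pairings (sidesOf pc R)) (hβ : β ∈ pairings (sidesOf pc R')) :
    (colorings pc nx N (R ∪ R') (α * β)).card =
      (colorings pc nx N R α).card * (colorings pc nx N R' β).card := by
  have hv := mul_apply_eq_ite hd hα hβ
  have hdl : ∀ q, q ∈ R → q ∉ R' := fun q h => Finset.disjoint_left.1 hd h
  rw [← Finset.card_product]
  refine Finset.card_bij'
    (fun i _ => (fun s => if pc s ∈ R then i s else 0, fun s => if pc s ∈ R' then i s else 0))
    (fun ij _ s => if pc s ∈ R then ij.1 s else ij.2 s) ?_ ?_ ?_ ?_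
  · intro i hi
    rw [mem_colorings] at hi
    rw [Finset.mem_product, mem_colorings, mem_colorings]
    refine ⟨⟨fun s hs => ?_, fun s hs => by simp [hs]⟩, ⟨fun s hs => ?_, fun s hs => by simp [hs]⟩⟩
    · have := hi.1 s (Finset.mem_union_left _ hs)
      rw [hv, if_pos hs] at this
      simp [hs, hnx, pc_apply_mem hα s hs, this]
    · have := hi.1 s (Finset.mem_union_right _ hs)
      rw [hv, if_neg fun h => hdl _ h hs] at this
      simp [hs, hnx, pc_apply_mem hβ s hs, this]
  · rintro ⟨i, j⟩ hij
    rw [Finset.mem_product, mem_colorings, mem_colorings] at hij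
    obtain ⟨⟨hi1, hi2⟩, hj1, hj2⟩ := hij
    dsimp only at hi1 hi2 hj1 hj2 ⊢
    rw [mem_colorings]
    refine ⟨fun s hs => ?_, fun s hs => ?_⟩
    · rw [hv]
      by_cases h : pc s ∈ R
      · have := pc_apply_mem hα s h
        simp only [h, if_true, hnx, this]
        exact hi1 s h
      · have h' : pc s ∈ R' := (Finset.mem_union.1 hs).resolve_left h
        have : pc (β s) ∉ R := fun h2 => hdl _ h2 (pc_apply_mem hβ s h')
        simp only [h, if_false, hnx, this]
        exact hj1 s h'
    · rw [Finset.mem_union, not_or] at hs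
      rw [if_neg hs.1, hj2 s hs.2]
  · intro i hi
    rw [mem_colorings] at hi
    ext1 s
    by_cases h : pc s ∈ R
    · simp [h]
    · by_cases h' : pc s ∈ R'
      · simp [h, h']
      · simp [h, h', hi.2 s (by simp [h, h'])]
  · rintro ⟨i, j⟩ hij
    rw [Finset.mem_product, mem_colorings, mem_colorings] at hij
    obtain ⟨⟨-, hi2⟩, -, hj2⟩ := hij
    dsimp only at hi2 hj2 ⊢
    refine Prod.ext (funext fun s => ?_) (funext fun s => ?_)
    · by_cases h : pc s ∈ R
      · simp [h]
      · simp [h, hi2 s h]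
    · by_cases h : pc s ∈ R'
      · have : pc s ∉ R := fun h2 => hdl _ h2 h
        simp [h, this]
      · simp [h, hj2 s h]

theorem pairingWeight_mul (hnx : ∀ s, pc (nx s) = pc s) {R R' : Finset π} (hd : Disjoint R R')
    {α β : Equiv.Perm ι} (hα : α ∈ pairings (sidesOf pc R)) (hβ : β ∈ pairings (sidesOf pc R')) :
    pairingWeight pc nx N ζ (R ∪ R') (α * β) =
      pairingWeight pc nx N ζ R α * pairingWeight pc nx N ζ R' β := by
  rw [pairingWeight, pairingWeight, pairingWeight, card_colorings_mul hnx hd hα hβ,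
    Finset.prod_union hd]
  push_cast
  ring

/-- A union of components can be cut off from a pairing. -/
theorem exists_mul_eq {Q R : Finset π} (hR : R ⊆ Q) {α : Equiv.Perm ι}
    (hα : α ∈ pairings (sidesOf pc Q)) (hc : ClosedUnder pc α R) :
    ∃ β ∈ pairings (sidesOf pc R), ∃ γ ∈ pairings (sidesOf pc (Q \ R)), β * γ = α := by
  have hα' := mem_pairings.1 hα
  have hc' : ∀ s, pc (α s) ∈ R ↔ pc s ∈ R := fun s =>
    ⟨fun h => by simpa [hα'.1] using hc _ h, hc s⟩
  have h1 : Function.Involutive fun s => if pc s ∈ R then α s else s := by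
    intro s
    dsimp only
    by_cases hs : pc s ∈ R
    · rw [if_pos hs, if_pos ((hc' s).2 hs), hα'.1]
    · rw [if_neg hs, if_neg hs]
  have h2 : Function.Involutive fun s => if pc s ∈ R then s else α s := by
    intro s
    dsimp only
    by_cases hs : pc s ∈ R
    · rw [if_pos hs, if_pos hs]
    · rw [if_neg hs, if_neg fun h => hs ((hc' s).1 h), hα'.1]
  have m1 : h1.toPerm ∈ pairings (sidesOf pc R) := by
    rw [mem_pairings]
    refine ⟨h1, fun s => ?_⟩
    change (if pc s ∈ R then α s else s) ≠ s ↔ _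
    rw [mem_sidesOf]
    by_cases hs : pc s ∈ R
    · simp only [hs, if_true, iff_true]
      exact (hα'.2 s).2 ((mem_sidesOf pc).2 (hR hs))
    · simp [hs]
  have m2 : h2.toPerm ∈ pairings (sidesOf pc (Q \ R)) := by
    rw [mem_pairings]
    refine ⟨h2, fun s => ?_⟩
    change (if pc s ∈ R then s else α s) ≠ s ↔ _
    rw [mem_sidesOf, Finset.mem_sdiff]
    by_cases hs : pc s ∈ R
    · simp [hs]
    · simp only [hs, if_false, not_false_eq_true, and_true]
      rw [hα'.2, mem_sidesOf]
  refine ⟨_, m1, _, m2, Equiv.ext fun s => ?_⟩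
  rw [mul_apply_eq_ite Finset.disjoint_sdiff m1 m2]
  change (if pc s ∈ R then (if pc s ∈ R then α s else s) else (if pc s ∈ R then s else α s)) = _
  split_ifs <;> rfl

theorem closedUnder_mul_iff {R R' U : Finset π} (hd : Disjoint R R') (hU : U ⊆ R)
    {α β : Equiv.Perm ι} (hα : α ∈ pairings (sidesOf pc R)) (hβ : β ∈ pairings (sidesOf pc R')) :
    ClosedUnder pc (α * β) U ↔ ClosedUnder pc α U := by
  refine forall_congr' fun s => imp_congr_right fun hs => ?_
  rw [mul_apply_eq_ite hd hα hβ, if_pos (hU hs)]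

/-- The decomposition of a pairing according to the component `R` of a given piece. -/
theorem pairingSum_eq_sum_connectedSum (hnx : ∀ s, pc (nx s) = pc s) {p : π} {Q : Finset π}
    (hp : p ∈ Q) :
    pairingSum pc nx N ζ Q = ∑ R ∈ Q.powerset.filter (p ∈ ·),
      connectedSum pc nx N ζ p R * pairingSum pc nx N ζ (Q \ R) := by
  classical
  simp only [connectedSum, pairingSum, Finset.sum_mul_sum]
  simp_rw [← Finset.sum_product']
  rw [Finset.sum_sigma']
  symm
  refine Finset.sum_bij (fun (x : Σ _ : Finset π, Equiv.Perm ι × Equiv.Perm ι) _ => x.2.1 * x.2.2)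
    ?_ ?_ ?_ ?_
  · rintro ⟨R, α, β⟩ hx
    simp only [Finset.mem_sigma, Finset.mem_filter, Finset.mem_powerset, Finset.mem_product] at hx
    have := mul_mem_pairings Finset.disjoint_sdiff hx.2.1.1 hx.2.2
    rwa [Finset.union_sdiff_of_subset hx.1.1] at this
  · rintro ⟨R, α, β⟩ hx ⟨R', α', β'⟩ hx' h
    simp only [Finset.mem_sigma, Finset.mem_filter, Finset.mem_powerset, Finset.mem_product]
      at hx hx' h
    obtain ⟨⟨hR, hpR⟩, ⟨hα, hc⟩, hβ⟩ := hx
    obtain ⟨⟨hR', hpR'⟩, ⟨hα', hc'⟩, hβ'⟩ := hx'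
    -- both `R` and `R'` are the component of `p`
    have hcl : ClosedUnder pc (α * β) R :=
      (closedUnder_mul_iff Finset.disjoint_sdiff subset_rfl hα hβ).2 (pc_apply_mem hα)
    have hcl' : ClosedUnder pc (α * β) R' := by
      rw [h]
      exact (closedUnder_mul_iff Finset.disjoint_sdiff subset_rfl hα' hβ').2 (pc_apply_mem hα')
    have hcl2 : ClosedUnder pc (α * β) (R ∩ R') := fun s hs => by
      rw [Finset.mem_inter] at hs ⊢
      exact ⟨hcl s hs.1, hcl' s hs.2⟩
    have e1 : R ∩ R' = R := hc _ Finset.inter_subset_left (Finset.mem_inter.2 ⟨hpR, hpR'⟩)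
      ((closedUnder_mul_iff Finset.disjoint_sdiff Finset.inter_subset_left hα hβ).1 hcl2)
    have e2 : R ∩ R' = R' := hc' _ Finset.inter_subset_right (Finset.mem_inter.2 ⟨hpR, hpR'⟩)
      ((closedUnder_mul_iff Finset.disjoint_sdiff Finset.inter_subset_right hα' hβ').1
        (h ▸ hcl2))
    obtain rfl : R = R' := e1.symm.trans e2
    have hv := mul_apply_eq_ite Finset.disjoint_sdiff hα hβ
    have hv' := mul_apply_eq_ite Finset.disjoint_sdiff hα' hβ'
    have eα : α = α' := Equiv.ext fun s => by
      by_cases hs : pc s ∈ R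
      · have := Equiv.congr_fun h s
        rwa [hv, hv', if_pos hs, if_pos hs] at this
      · rw [apply_eq_of_notMem hα hs, apply_eq_of_notMem hα' hs]
    subst eα
    rw [mul_left_cancel h]
  · intro α hα
    -- the component of `p` is the intersection of all closed sets of pieces containing `p`
    let R : Finset π := Q.filter fun q => ∀ U, p ∈ U → ClosedUnder pc α U → q ∈ U
    have hRQ : R ⊆ Q := Finset.filter_subset _ _
    have hpR : p ∈ R := Finset.mem_filter.2 ⟨hp, fun _ hU _ => hU⟩
    have hR : ClosedUnder pc α R := fun s hs => by
      rw [Finset.mem_filter] at hs ⊢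
      exact ⟨pc_apply_mem hα s hs.1, fun U hU hc => hc s (hs.2 U hU hc)⟩
    obtain ⟨β, hβ, γ, hγ, rfl⟩ := exists_mul_eq hRQ hα hR
    refine ⟨⟨R, β, γ⟩, ?_, rfl⟩
    simp only [Finset.mem_sigma, Finset.mem_filter, Finset.mem_powerset, Finset.mem_product]
    refine ⟨⟨hRQ, hpR⟩, ⟨hβ, fun U hU hpU hc => ?_⟩, hγ⟩
    refine Finset.Subset.antisymm hU fun q hq => ?_
    exact (Finset.mem_filter.1 hq).2 U hpU
      ((closedUnder_mul_iff Finset.disjoint_sdiff hU hβ hγ).2 hc)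
  · rintro ⟨R, α, β⟩ hx
    simp only [Finset.mem_sigma, Finset.mem_filter, Finset.mem_powerset, Finset.mem_product] at hx
    have := pairingWeight_mul (N := N) (ζ := ζ) hnx Finset.disjoint_sdiff hx.2.1.1 hx.2.2
    rw [Finset.union_sdiff_of_subset hx.1.1] at this
    exact this.symm

end Pinned

/-! ### Joint cumulants -/

section Cumulant

variable {ι R : Type*} [DecidableEq ι] [CommRing R]

/-- The joint cumulant attached to a family `M` of joint moments, as a sum over set partitions. -/
def jointCumulant (M : Finset ι → R) (K : Finset ι) : R :=
  ∑ P : Finpartition K, ((-1) ^ (P.parts.card - 1) * ((P.parts.card - 1)! : R)) *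
    ∏ B ∈ P.parts, M B

/-- The terms `B ≠ K` of the recursion of `eq_sum_jointCumulant_mul`: a partition of `B ∋ p` together with
the part `K \ B` is a partition of `K` with a distinguished part `D = K \ B` that does not contain `p`. -/
theorem mul_jointCumulant_sdiff (M : Finset ι → R) (K : Finset ι) {p : ι} (hp : p ∈ K) :
    ∑ B ∈ (K.powerset.filter (p ∈ ·)).erase K, jointCumulant M B * M (K \ B) =
      ∑ P : Finpartition K, ∑ _D ∈ P.parts.filter (p ∉ ·),
        ((-1) ^ (P.parts.card - 2) * ((P.parts.card - 2)! : R)) * ∏ B ∈ P.parts, M B := by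
  simp only [jointCumulant, Finset.sum_mul]
  rw [Finset.sum_sigma', Finset.sum_sigma']
  have hmem : ∀ x : (Σ B : Finset ι, Finpartition B),
      x ∈ (((K.powerset.filter (p ∈ ·)).erase K).sigma fun _ => Finset.univ) →
      x.1 ⊆ K ∧ p ∈ x.1 ∧ K \ x.1 ≠ ∅ := by
    intro x hx
    simp only [Finset.mem_sigma, Finset.mem_erase, Finset.mem_filter, Finset.mem_powerset,
      Finset.mem_univ, and_true] at hx
    refine ⟨hx.2.1, hx.2.2, fun h => hx.1 (Finset.Subset.antisymm hx.2.1 ?_)⟩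
    rwa [Finset.sdiff_eq_empty_iff_subset] at h
  have hnot : ∀ x : (Σ B : Finset ι, Finpartition B), K \ x.1 ≠ ∅ → K \ x.1 ∉ x.2.parts := by
    intro x h h'
    obtain ⟨y, hy⟩ := Finset.nonempty_iff_ne_empty.2 h
    exact (Finset.mem_sdiff.1 hy).2 (x.2.subset h' hy)
  refine Finset.sum_bij (fun x hx => (⟨x.2.extend (hmem x hx).2.2 Finset.disjoint_sdiff
      (Finset.union_sdiff_of_subset (hmem x hx).1), K \ x.1⟩ : Σ _ : Finpartition K, Finset ι))
    ?_ ?_ ?_ ?_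
  · intro x hx
    simp only [Finset.mem_sigma, Finset.mem_univ, true_and, Finset.mem_filter]
    refine ⟨Finset.mem_insert_self _ _, fun h => ?_⟩
    exact (Finset.mem_sdiff.1 h).2 (hmem x hx).2.1
  · rintro ⟨B, P⟩ hx ⟨B', P'⟩ hx' h
    have h1 := hmem _ hx
    have h1' := hmem _ hx'
    have h3 := hnot _ h1.2.2
    have h3' := hnot _ h1'.2.2
    rw [Sigma.mk.injEq] at h
    obtain ⟨ha, hb⟩ := h
    dsimp only at h1 h1' h3 h3'
    have hb' : K \ B = K \ B' := eq_of_heq hb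
    obtain rfl : B = B' := by
      rw [← Finset.sdiff_sdiff_eq_self h1.1, hb', Finset.sdiff_sdiff_eq_self h1'.1]
    have hparts := congrArg Finpartition.parts ha
    simp only [Finpartition.extend_parts] at hparts
    congr 1
    refine Finpartition.ext ?_
    rw [← Finset.erase_insert h3, hparts, Finset.erase_insert h3']
  · rintro ⟨P, D⟩ hx
    simp only [Finset.mem_sigma, Finset.mem_univ, true_and, Finset.mem_filter] at hx
    have hDK := P.subset hx.1
    refine ⟨⟨K \ D, P.avoid D⟩, ?_, ?_⟩
    · simp only [Finset.mem_sigma, Finset.mem_erase, Finset.mem_filter, Finset.mem_powerset,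
        Finset.mem_univ, and_true]
      refine ⟨fun h => ?_, Finset.sdiff_subset, Finset.mem_sdiff.2 ⟨hp, hx.2⟩⟩
      obtain ⟨y, hy⟩ := P.nonempty_of_mem_parts hx.1
      have := hDK hy
      rw [← h] at this
      exact (Finset.mem_sdiff.1 this).2 hy
    · rw [Sigma.mk.injEq]
      have e : K \ (K \ D) = D := Finset.sdiff_sdiff_eq_self hDK
      refine ⟨Finpartition.ext ?_, heq_of_eq e⟩
      ext c
      simp only [Finpartition.extend_parts, Finset.mem_insert, Finpartition.mem_avoid]
      rw [e]
      constructor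
      · rintro (rfl | ⟨d, hd, hd', rfl⟩)
        · exact hx.1
        · have : d ≠ D := fun h => hd' h.le
          have hdis : Disjoint d D := P.disjoint hd hx.1 this
          rwa [hdis.sdiff_eq_left]
      · intro hc
        by_cases h : c = D
        · exact Or.inl h
        · have hdis : Disjoint c D := P.disjoint hc hx.1 h
          refine Or.inr ⟨c, hc, fun h' => ?_, hdis.sdiff_eq_left⟩
          exact P.ne_bot hc (hdis.eq_bot_of_le h')
  · intro x hx
    have h3 := hnot _ (hmem _ hx).2.2
    simp only [Finpartition.extend_parts]
    rw [Finset.prod_insert h3, Finset.card_insert_of_notMem h3]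
    have : x.2.parts.card + 1 - 2 = x.2.parts.card - 1 := by omega
    rw [this]
    ring

/-- Moments are recovered from the joint cumulants by singling out the block of an element `p`. This
relation determines the joint cumulants. -/
theorem eq_sum_jointCumulant_mul (M : Finset ι → R) (h0 : M ∅ = 1) {K : Finset ι} {p : ι}
    (hp : p ∈ K) :
    M K = ∑ B ∈ K.powerset.filter (p ∈ ·), jointCumulant M B * M (K \ B) := by
  have hK : K ∈ K.powerset.filter (p ∈ ·) := by simp [hp]
  have hKne : K ≠ ⊥ := Finset.ne_empty_of_mem hp
  rw [← Finset.add_sum_erase _ _ hK, mul_jointCumulant_sdiff M K hp, Finset.sdiff_self, h0, mul_one,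
    jointCumulant, ← Finset.sum_add_distrib, Finset.sum_eq_single (Finpartition.indiscrete hKne)]
  · have : ({K} : Finset (Finset ι)).filter (p ∉ ·) = ∅ := by
      rw [Finset.filter_singleton, if_neg (not_not.2 hp)]
    simp [Finpartition.indiscrete, this]
  · intro P _ hP
    -- the part of `p` is the only one excluded from the inner sum
    have hpart : P.parts.filter (p ∉ ·) = P.parts.erase (P.part p) := by
      ext D
      rw [Finset.mem_filter, Finset.mem_erase, and_comm]
      refine and_congr_left fun hD => ?_
      rw [not_iff_comm, ne_eq, not_not, eq_comm, P.part_eq_iff_mem hD]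
    have hpm : P.part p ∈ P.parts := P.part_mem.2 hp
    rw [Finset.sum_const, hpart, Finset.card_erase_of_mem hpm]
    obtain ⟨m, hm⟩ : ∃ m, P.parts.card = m + 2 := by
      have h1 : P.parts.card ≠ 0 := Finset.card_ne_zero_of_mem hpm
      have h2 : P.parts.card ≠ 1 := by
        intro h
        obtain ⟨D, hD⟩ := Finset.card_eq_one.1 h
        have hs := P.sup_parts
        rw [hD, Finset.sup_singleton] at hs
        exact hP (Finpartition.ext (by rw [hD]; simpa [Finpartition.indiscrete] using hs))
      exact ⟨P.parts.card - 2, by omega⟩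
    rw [hm]
    have e1 : m + 2 - 1 = m + 1 := rfl
    have e2 : m + 2 - 2 = m := rfl
    rw [e1, e2, Nat.factorial_succ, nsmul_eq_mul]
    push_cast
    ring
  · simp

end Cumulant

/-! ### Coefficients of the formal correlators -/

section Series

variable {α β : Type*}

/-- Each monomial of `F` contains exactly the variables of index in `D`, among those of index in
`α`. -/
def SupportedOn (D : Finset α) (F : MvPowerSeries (α ⊕ β) ℝ) : Prop :=
  ∀ e, MvPowerSeries.coeff e F ≠ 0 → ∀ j, j ∈ D ↔ e (Sum.inl j) ≠ 0

theorem SupportedOn.sum {ι : Type*} {D : Finset α} {F : ι → MvPowerSeries (α ⊕ β) ℝ} {s : Finset ι}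
    (h : ∀ i ∈ s, SupportedOn D (F i)) : SupportedOn D (∑ i ∈ s, F i) := by
  intro e he
  rw [map_sum] at he
  obtain ⟨i, hi, hne⟩ := Finset.exists_ne_zero_of_sum_ne_zero he
  exact h i hi e hne

theorem SupportedOn.mul [DecidableEq α] {D D' : Finset α} {F G : MvPowerSeries (α ⊕ β) ℝ}
    (hF : SupportedOn D F) (hG : SupportedOn D' G) : SupportedOn (D ∪ D') (F * G) := by
  classical
  intro e he
  rw [MvPowerSeries.coeff_mul] at he
  obtain ⟨x, hx, hne⟩ := Finset.exists_ne_zero_of_sum_ne_zero he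
  intro j
  rw [Finset.mem_union, hF _ (left_ne_zero_of_mul hne) j, hG _ (right_ne_zero_of_mul hne) j,
    ← Finset.HasAntidiagonal.mem_antidiagonal.1 hx, Finsupp.add_apply]
  omega

theorem SupportedOn.C (r : ℝ) : SupportedOn ∅ (MvPowerSeries.C r : MvPowerSeries (α ⊕ β) ℝ) := by
  classical
  intro e he
  rw [MvPowerSeries.coeff_C] at he
  have : e = 0 := by
    by_contra h
    simp [h] at he
  simp [this]

theorem SupportedOn.prod [DecidableEq α] {ι : Type*} (s : Finset ι) (D : ι → Finset α)
    (F : ι → MvPowerSeries (α ⊕ β) ℝ) (h : ∀ i ∈ s, SupportedOn (D i) (F i)) :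
    SupportedOn (s.sup D) (∏ i ∈ s, F i) := by
  classical
  induction s using Finset.induction_on with
  | empty => simpa using SupportedOn.C (α := α) (β := β) 1
  | insert i s hi ih =>
    rw [Finset.prod_insert hi, Finset.sup_insert]
    exact (h i (Finset.mem_insert_self _ _)).mul
      (ih fun j hj => h j (Finset.mem_insert_of_mem hj))

theorem SupportedOn.inv {F : MvPowerSeries (α ⊕ β) ℝ} (hF : SupportedOn ∅ F) :
    SupportedOn ∅ F⁻¹ := by
  classical
  intro e
  induction e using WellFoundedLT.induction with
  | _ e ih =>
  intro he j
  simp only [Finset.notMem_empty, false_iff, not_not]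
  rw [MvPowerSeries.coeff_inv] at he
  split_ifs at he with h0
  · simp [h0]
  · obtain ⟨x, hx, hne⟩ := Finset.exists_ne_zero_of_sum_ne_zero (right_ne_zero_of_mul he)
    split_ifs at hne with hlt
    · have h1 := hF _ (left_ne_zero_of_mul hne) j
      have h2 := ih _ hlt (right_ne_zero_of_mul hne) j
      simp only [Finset.notMem_empty, false_iff, not_not] at h1 h2
      rw [← Finset.HasAntidiagonal.mem_antidiagonal.1 hx, Finsupp.add_apply, h1, h2]
    · exact absurd rfl hne

/-- For series in disjoint sets of variables `α`, only the variables `β` are shared in a product. -/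
theorem coeff_mul_of_supportedOn [DecidableEq β] {D D' : Finset α} (hd : Disjoint D D')
    {F G : MvPowerSeries (α ⊕ β) ℝ} (hF : SupportedOn D F) (hG : SupportedOn D' G)
    {m m' : α →₀ ℕ} (hm : ∀ j, j ∉ D → m j = 0) (hm' : ∀ j, j ∉ D' → m' j = 0) (k : β →₀ ℕ) :
    MvPowerSeries.coeff (Finsupp.sumElim (m + m') k) (F * G) =
      ∑ x ∈ Finset.HasAntidiagonal.antidiagonal k, MvPowerSeries.coeff (Finsupp.sumElim m x.1) F *
        MvPowerSeries.coeff (Finsupp.sumElim m' x.2) G := by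
  classical
  rw [MvPowerSeries.coeff_mul]
  symm
  have hinj : ∀ {a a' : α →₀ ℕ} {b b' : β →₀ ℕ}, Finsupp.sumElim a b = Finsupp.sumElim a' b' →
      b = b' := by
    intro a a' b b' h
    ext c
    simpa using DFunLike.congr_fun h (Sum.inr c)
  refine Finset.sum_of_injOn (fun x => (Finsupp.sumElim m x.1, Finsupp.sumElim m' x.2)) ?_ ?_ ?_
    fun _ _ => rfl
  · intro x _ y _ h
    simp only [Prod.mk.injEq] at h
    exact Prod.ext (hinj h.1) (hinj h.2)
  · intro x hx
    rw [Finset.mem_coe, Finset.HasAntidiagonal.mem_antidiagonal] at hx ⊢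
    rw [← hx]
    ext (j | c) <;> simp
  · rintro ⟨e, e'⟩ hx hnot
    by_contra hne
    rw [Finset.HasAntidiagonal.mem_antidiagonal] at hx
    dsimp only at hx hne
    have h1 := hF _ (left_ne_zero_of_mul hne)
    have h2 := hG _ (right_ne_zero_of_mul hne)
    apply hnot
    have hsum : ∀ j, e (Sum.inl j) + e' (Sum.inl j) = m j + m' j := fun j => by
      simpa using DFunLike.congr_fun hx (Sum.inl j)
    have hsum' : ∀ c, e (Sum.inr c) + e' (Sum.inr c) = k c := fun c => by
      simpa using DFunLike.congr_fun hx (Sum.inr c)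
    have hj : ∀ j, e (Sum.inl j) = m j ∧ e' (Sum.inl j) = m' j := by
      intro j
      have := hsum j
      by_cases hjD : j ∈ D
      · have hjD' := Finset.disjoint_left.1 hd hjD
        have a1 := hm' j hjD'
        have a2 := (h2 j).not.1 hjD'
        omega
      · have a1 := hm j hjD
        have a2 := (h1 j).not.1 hjD
        omega
    refine ⟨((Finsupp.sumFinsuppEquivProdFinsupp e).2, (Finsupp.sumFinsuppEquivProdFinsupp e').2),
      ?_, ?_⟩
    · rw [Finset.mem_coe, Finset.HasAntidiagonal.mem_antidiagonal]
      ext c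
      simpa using hsum' c
    · refine Prod.ext ?_ ?_
      · ext (j | c)
        · simp [(hj j).1]
        · simp
      · ext (j | c)
        · simp [(hj j).2]
        · simp

/-- The coefficients of the exponential of a linear form. -/
theorem coeff_exp_subst_sum [Fintype β] [DecidableEq α] [DecidableEq β] (a : β → ℝ) (m : α →₀ ℕ)
    (k : β →₀ ℕ) :
    MvPowerSeries.coeff (Finsupp.sumElim m k) ((PowerSeries.exp ℝ).subst
      (∑ c, MvPowerSeries.C (a c) * MvPowerSeries.X (Sum.inr c) : MvPowerSeries (α ⊕ β) ℝ)) =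
      if m = 0 then ∏ c, a c ^ k c / (k c)! else 0 := by
  have hs : PowerSeries.HasSubst
      (∑ c, MvPowerSeries.C (a c) * MvPowerSeries.X (Sum.inr c) : MvPowerSeries (α ⊕ β) ℝ) := by
    apply PowerSeries.HasSubst.of_constantCoeff_zero
    simp
  rw [PowerSeries.coeff_subst hs]
  have hpow : ∀ d : ℕ, MvPowerSeries.coeff (Finsupp.sumElim m k)
      ((∑ c, MvPowerSeries.C (a c) * MvPowerSeries.X (Sum.inr c) : MvPowerSeries (α ⊕ β) ℝ) ^ d) =
      if m = 0 ∧ ∑ c, k c = d then (Nat.multinomial Finset.univ k : ℝ) * ∏ c, a c ^ k c else 0 := by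
    intro d
    have hterm : ∀ κ : β → ℕ, ∏ c, (MvPowerSeries.C (a c) * MvPowerSeries.X (Sum.inr c) :
        MvPowerSeries (α ⊕ β) ℝ) ^ κ c = MvPowerSeries.C (∏ c, a c ^ κ c) *
          MvPowerSeries.monomial (Finsupp.sumElim 0 (Finsupp.equivFunOnFinite.symm κ)) 1 := by
      intro κ
      have he : (Finsupp.sumElim 0 (Finsupp.equivFunOnFinite.symm κ) : α ⊕ β →₀ ℕ) =
          ∑ c, Finsupp.single (Sum.inr c) (κ c) := by
        ext (j | c)
        · simp [Finsupp.finsetSum_apply]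
        · simp [Finsupp.finsetSum_apply, Finsupp.single_apply]
      have hprod : ∀ s : Finset β, ∏ c ∈ s, (MvPowerSeries.monomial
          (Finsupp.single (Sum.inr c : α ⊕ β) (κ c)) (1 : ℝ)) =
          MvPowerSeries.monomial (∑ c ∈ s, Finsupp.single (Sum.inr c) (κ c)) 1 := by
        intro s
        induction s using Finset.induction_on with
        | empty => simp
        | insert c s hc ih =>
          rw [Finset.prod_insert hc, Finset.sum_insert hc, ih,
            MvPowerSeries.monomial_mul_monomial, one_mul]
      rw [he, ← hprod]
      simp only [mul_pow, Finset.prod_mul_distrib, MvPowerSeries.X_pow_eq, map_prod, map_pow]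
    rw [Finset.sum_pow_eq_sum_piAntidiag, map_sum]
    have hcoef : ∀ κ : β → ℕ, MvPowerSeries.coeff (Finsupp.sumElim m k)
        ((Nat.multinomial Finset.univ κ : MvPowerSeries (α ⊕ β) ℝ) *
          ∏ c, (MvPowerSeries.C (a c) * MvPowerSeries.X (Sum.inr c)) ^ κ c) =
        if m = 0 ∧ ⇑k = κ then (Nat.multinomial Finset.univ κ : ℝ) * ∏ c, a c ^ κ c else 0 := by
      intro κ
      have hcast : (Nat.multinomial Finset.univ κ : MvPowerSeries (α ⊕ β) ℝ) =
          MvPowerSeries.C (Nat.multinomial Finset.univ κ : ℝ) := by simp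
      rw [hterm, hcast, ← mul_assoc, ← map_mul, MvPowerSeries.coeff_C_mul,
        MvPowerSeries.coeff_monomial]
      have : (Finsupp.sumElim m k = Finsupp.sumElim 0 (Finsupp.equivFunOnFinite.symm κ)) ↔
          (m = 0 ∧ ⇑k = κ) := by
        constructor
        · intro h
          refine ⟨?_, ?_⟩
          · ext j
            simpa using DFunLike.congr_fun h (Sum.inl j)
          · ext c
            simpa using DFunLike.congr_fun h (Sum.inr c)
        · rintro ⟨rfl, rfl⟩
          simp
      simp only [this]
      split_ifs <;> simp
    rw [Finset.sum_congr rfl fun κ _ => hcoef κ]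
    by_cases h : m = 0 ∧ ∑ c, k c = d
    · rw [if_pos h, Finset.sum_eq_single (⇑k)]
      · rw [if_pos ⟨h.1, rfl⟩]
      · intro κ _ hκ
        rw [if_neg fun h' => hκ h'.2.symm]
      · intro hk
        exact absurd (by simp [h.2]) hk
    · rw [if_neg h]
      refine Finset.sum_eq_zero fun κ hκ => if_neg ?_
      rintro ⟨h1, rfl⟩
      exact h ⟨h1, by simpa using hκ⟩
  simp only [hpow]
  by_cases hm : m = 0
  · rw [finsum_eq_single _ (∑ c, k c)]
    · rw [if_pos ⟨hm, rfl⟩, if_pos hm, PowerSeries.coeff_exp, Finset.prod_div_distrib]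
      have h := Nat.multinomial_spec Finset.univ (⇑k)
      have h' : (∏ c, ((k c)! : ℝ)) * (Nat.multinomial Finset.univ k : ℝ) =
          ((∑ c, k c)! : ℝ) := by exact_mod_cast h
      have h1 : (∏ c, ((k c)! : ℝ)) ≠ 0 :=
        Finset.prod_ne_zero_iff.2 fun c _ => by exact_mod_cast (k c).factorial_ne_zero
      have h2 : (((∑ c, k c)! : ℕ) : ℝ) ≠ 0 := by exact_mod_cast (∑ c, k c).factorial_ne_zero
      simp only [map_div₀, map_one, map_natCast, smul_eq_mul]
      rw [← h'] at h2 ⊢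
      have h3 := right_ne_zero_of_mul h2
      field_simp
    · intro d hd
      rw [if_neg fun h => hd h.2.symm, smul_zero]
  · rw [if_neg hm]
    simp [hm]

end Series

section CorrelatorCoefficients

/-- The constant factor of a 2-cell in the exponent of `Φ`. -/
noncomputable def ElemCell.vertexFactor (N : ℕ) (t : ℝ) (C : ElemCell) : ℝ :=
  ((N : ℝ) / t) ^ C.euler / (C.bdry ! : ℝ) * (C.perims.map fun l : ℕ => (l : ℝ)⁻¹).prod

/-- The product of traces of powers attached to a 2-cell. -/
noncomputable def ElemCell.traceProd {N : ℕ} (h : HermCoord N) (C : ElemCell) : ℝ :=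
  (C.perims.map (trPow h)).prod

variable {𝒞 : Finset ElemCell} {n N : ℕ} {t : ℝ}

theorem ElemCell.vertexFactor_ne_zero (hN : 1 ≤ N) (ht : 0 < t) (C : ElemCell) :
    C.vertexFactor N t ≠ 0 := by
  have hN0 : (0 : ℝ) < N := by exact_mod_cast hN
  refine mul_ne_zero (div_ne_zero (zpow_ne_zero _ (by positivity))
    (by exact_mod_cast C.bdry.factorial_ne_zero)) ?_
  rw [ne_eq, List.prod_eq_zero_iff]
  simp only [List.mem_map, inv_eq_zero, Nat.cast_eq_zero, exists_eq_right]
  exact fun h => absurd (C.perims_pos 0 h) (by norm_num)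

variable (𝒞 n N t)

theorem neg_actionInt (h : HermCoord N) : -actionInt 𝒞 n N t h =
    ∑ C : 𝒞, MvPowerSeries.C (C.1.vertexFactor N t * C.1.traceProd h) *
      MvPowerSeries.X (Sum.inr C) := by
  rw [actionInt, neg_neg]
  refine Finset.sum_congr rfl fun C _ => ?_
  have e : (C.1.perims.map fun l => trPow h l / (l : ℝ)).prod =
      (C.1.perims.map fun l : ℕ => (l : ℝ)⁻¹).prod * C.1.traceProd h := by
    rw [ElemCell.traceProd, ← List.prod_map_mul]
    congr 1
    exact List.map_congr_left fun l _ => by ring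
  rw [cellTerm, e, ElemCell.vertexFactor, mul_assoc, map_mul, map_mul, map_mul]
  ring

theorem coeff_formalPhi (h : HermCoord N) (m : Fin n →₀ ℕ) (k : 𝒞 →₀ ℕ) :
    MvPowerSeries.coeff (Finsupp.sumElim m k) (formalPhi 𝒞 n N t h) =
      if m = 0 then ∏ C, (C.1.vertexFactor N t * C.1.traceProd h) ^ k C / (k C)! else 0 := by
  classical
  rw [formalPhi, neg_actionInt]
  exact coeff_exp_subst_sum (fun C : 𝒞 => C.1.vertexFactor N t * C.1.traceProd h) m k

theorem sumElim_fst_snd {α β : Type*} (e : α ⊕ β →₀ ℕ) :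
    Finsupp.sumElim (Finsupp.sumFinsuppEquivProdFinsupp e).1
      (Finsupp.sumFinsuppEquivProdFinsupp e).2 = e := by
  ext (j | c) <;> simp

theorem supportedOn_formalPhi (h : HermCoord N) : SupportedOn ∅ (formalPhi 𝒞 n N t h) := by
  intro e he j
  rw [← sumElim_fst_snd e, coeff_formalPhi] at he
  have h0 : (Finsupp.sumFinsuppEquivProdFinsupp e).1 = 0 := by
    by_contra h0
    rw [if_neg h0] at he
    exact he rfl
  simpa using (DFunLike.congr_fun h0 j)

theorem coeff_formalResolvent (j : Fin n) (h : HermCoord N) (e : Fin n ⊕ 𝒞 →₀ ℕ) :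
    MvPowerSeries.coeff e (formalResolvent 𝒞 n N j h) =
      if e (Sum.inl j) ≠ 0 ∧ e = Finsupp.single (Sum.inl j) (e (Sum.inl j))
        then trPow h (e (Sum.inl j) - 1) else 0 := by
  classical
  rw [formalResolvent, MvPowerSeries.X_def, MvPowerSeries.coeff_monomial_mul]
  rw [← MvPowerSeries.X_def, PowerSeries.coeff_subst_single]
  simp only [PowerSeries.coeff_mk, one_mul]
  by_cases h1 : Finsupp.single (Sum.inl j) 1 ≤ e
  · have h1' : 1 ≤ e (Sum.inl j) := by simpa using h1 (Sum.inl j)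
    rw [if_pos h1]
    have hiff : (e - Finsupp.single (Sum.inl j) 1 =
        Finsupp.single (Sum.inl j) ((e - Finsupp.single (Sum.inl j) 1 : Fin n ⊕ 𝒞 →₀ ℕ) (Sum.inl j))) ↔
        (e (Sum.inl j) ≠ 0 ∧ e = Finsupp.single (Sum.inl j) (e (Sum.inl j))) := by
      constructor
      · intro h2
        refine ⟨by omega, ?_⟩
        conv_lhs => rw [← tsub_add_cancel_of_le h1, h2, ← Finsupp.single_add]
        congr 1
        simp only [Finsupp.tsub_apply, Finsupp.single_eq_same]
        omega
      · rintro ⟨-, h2⟩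
        conv_lhs => rw [h2, ← Finsupp.single_tsub]
        simp
    simp only [hiff]
    simp
  · have h1' : e (Sum.inl j) = 0 := by
      by_contra h0
      apply h1
      intro x
      by_cases hx : x = Sum.inl j
      · subst hx
        simpa using Nat.one_le_iff_ne_zero.2 h0
      · rw [Finsupp.single_eq_of_ne hx]
        exact Nat.zero_le _
    rw [if_neg h1, if_neg]
    exact fun h2 => h2.1 h1'

theorem supportedOn_formalResolvent (j : Fin n) (h : HermCoord N) :
    SupportedOn {j} (formalResolvent 𝒞 n N j h) := by
  intro e he i
  rw [coeff_formalResolvent] at he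
  have h0 := (ite_ne_right_iff.1 he).1
  rw [Finset.mem_singleton]
  constructor
  · rintro rfl
    exact h0.1
  · intro hi
    by_contra hij
    rw [h0.2, Finsupp.single_eq_of_ne] at hi
    · exact hi rfl
    · simpa using hij

/-- The exponents of the `x_j⁻¹`, `j ∈ K`, for marked faces of perimeters `ℓ`. -/
noncomputable def faceExp {n : ℕ} (ℓ : Fin n → ℕ) (K : Finset (Fin n)) : Fin n →₀ ℕ :=
  Finsupp.equivFunOnFinite.symm fun j => if j ∈ K then ℓ j + 1 else 0

theorem faceExp_apply {n : ℕ} (ℓ : Fin n → ℕ) (K : Finset (Fin n)) (j : Fin n) :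
    faceExp ℓ K j = if j ∈ K then ℓ j + 1 else 0 := rfl

theorem faceExp_eq_zero {n : ℕ} {ℓ : Fin n → ℕ} {K : Finset (Fin n)} {j : Fin n} (h : j ∉ K) :
    faceExp ℓ K j = 0 := if_neg h

theorem faceExp_add {n : ℕ} (ℓ : Fin n → ℕ) {K K' : Finset (Fin n)} (h : Disjoint K K') :
    faceExp ℓ K + faceExp ℓ K' = faceExp ℓ (K ∪ K') := by
  ext j
  have : j ∈ K → j ∉ K' := fun h' => Finset.disjoint_left.1 h h'
  simp only [Finsupp.add_apply, faceExp_apply, Finset.mem_union]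
  by_cases h1 : j ∈ K <;> by_cases h2 : j ∈ K' <;> simp_all

theorem supportedOn_prod_formalResolvent (K : Finset (Fin n)) (h : HermCoord N) :
    SupportedOn K (∏ j ∈ K, formalResolvent 𝒞 n N j h) := by
  have := SupportedOn.prod K (fun j => {j}) (fun j => formalResolvent 𝒞 n N j h)
    fun j _ => supportedOn_formalResolvent 𝒞 n N j h
  rwa [Finset.sup_singleton_eq_self] at this

/-- The exponent of `x_j⁻¹` is the perimeter plus one, so each factor contributes a single trace. -/
theorem coeff_prod_formalResolvent (ℓ : Fin n → ℕ) (K : Finset (Fin n)) (h : HermCoord N)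
    (k : 𝒞 →₀ ℕ) :
    MvPowerSeries.coeff (Finsupp.sumElim (faceExp ℓ K) k) (∏ j ∈ K, formalResolvent 𝒞 n N j h) =
      if k = 0 then ∏ j ∈ K, trPow h (ℓ j) else 0 := by
  classical
  induction K using Finset.induction_on generalizing k with
  | empty =>
    have e : Finsupp.sumElim (faceExp ℓ ∅) k = 0 ↔ k = 0 := by
      constructor
      · intro h
        ext c
        simpa using DFunLike.congr_fun h (Sum.inr c)
      · rintro rfl
        ext (j | c) <;> simp [faceExp_apply]
    rw [Finset.prod_empty, Finset.prod_empty, MvPowerSeries.coeff_one]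
    by_cases hk : k = 0
    · rw [if_pos (e.2 hk), if_pos hk]
    · rw [if_neg fun h => hk (e.1 h), if_neg hk]
  | insert j K hj ih =>
    have hd : Disjoint {j} K := Finset.disjoint_singleton_left.2 hj
    rw [Finset.prod_insert hj, Finset.prod_insert hj, Finset.insert_eq, ← faceExp_add ℓ hd,
      coeff_mul_of_supportedOn hd (supportedOn_formalResolvent 𝒞 n N j h)
        (supportedOn_prod_formalResolvent 𝒞 n N K h) (fun _ => faceExp_eq_zero)
        (fun _ => faceExp_eq_zero)]
    have hr : ∀ k : 𝒞 →₀ ℕ, MvPowerSeries.coeff (Finsupp.sumElim (faceExp ℓ {j}) k)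
        (formalResolvent 𝒞 n N j h) = if k = 0 then trPow h (ℓ j) else 0 := by
      intro k
      rw [coeff_formalResolvent]
      have e : ((Finsupp.sumElim (faceExp ℓ {j}) k) (Sum.inl j) ≠ 0 ∧
          Finsupp.sumElim (faceExp ℓ {j}) k = Finsupp.single (Sum.inl j)
            ((Finsupp.sumElim (faceExp ℓ {j}) k) (Sum.inl j))) ↔ k = 0 := by
        constructor
        · rintro ⟨-, h2⟩
          ext c
          simpa using DFunLike.congr_fun h2 (Sum.inr c)
        · rintro rfl
          refine ⟨by simp [faceExp_apply], ?_⟩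
          ext (i | c)
          · by_cases hi : i = j
            · subst hi
              simp
            · simp [faceExp_apply, hi]
          · simp
      simp only [e]
      simp [faceExp_apply]
    simp only [hr, ih]
    by_cases hk : k = 0
    · subst hk
      simp
    · rw [if_neg hk]
      refine Finset.sum_eq_zero fun x hx => ?_
      by_cases h1 : x.1 = 0
      · rw [if_neg (c := x.2 = 0), mul_zero]
        intro h2
        rw [Finset.HasAntidiagonal.mem_antidiagonal, h1, h2, add_zero] at hx
        exact hk hx.symm
      · rw [if_neg h1, zero_mul]

/-- The formal series `ρ₀[Φ ∏_{j ∈ K} X_j]`. -/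
noncomputable def momentSeries (K : Finset (Fin n)) : CorrSeries 𝒞 n :=
  formalExp 𝒞 n N t fun h => formalPhi 𝒞 n N t h * ∏ j ∈ K, formalResolvent 𝒞 n N j h

theorem supportedOn_momentSeries (K : Finset (Fin n)) :
    SupportedOn K (momentSeries 𝒞 n N t K) := by
  intro e he
  change ∫ h, MvPowerSeries.coeff e (formalPhi 𝒞 n N t h *
    ∏ j ∈ K, formalResolvent 𝒞 n N j h) ∂(gaussianHerm N t) ≠ 0 at he
  obtain ⟨h, hh⟩ : ∃ h, MvPowerSeries.coeff e (formalPhi 𝒞 n N t h *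
      ∏ j ∈ K, formalResolvent 𝒞 n N j h) ≠ 0 := by
    by_contra hcon
    push Not at hcon
    simp [hcon] at he
  have := (supportedOn_formalPhi 𝒞 n N t h).mul (supportedOn_prod_formalResolvent 𝒞 n N K h)
  rw [Finset.empty_union] at this
  exact this e hh

/-- The expectation of a product of traces of powers, with one factor for each marked face in `K` and
`k C` factors for the 2-cells of type `C`. -/
noncomputable def traceMoment (ℓ : Fin n → ℕ) (K : Finset (Fin n)) (k : 𝒞 →₀ ℕ) : ℝ :=
  ∫ h : HermCoord N, (∏ j ∈ K, trPow h (ℓ j)) * ∏ C, C.1.traceProd h ^ k C ∂(gaussianHerm N t)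

/-- The factor of the monomial with exponents `k` in the expansion of `Φ`. -/
noncomputable def cellNorm (k : 𝒞 →₀ ℕ) : ℝ := ∏ C, C.1.vertexFactor N t ^ k C / (k C)!

theorem coeff_momentSeries (ℓ : Fin n → ℕ) (K : Finset (Fin n)) (k : 𝒞 →₀ ℕ) :
    MvPowerSeries.coeff (Finsupp.sumElim (faceExp ℓ K) k) (momentSeries 𝒞 n N t K) =
      cellNorm 𝒞 N t k * traceMoment 𝒞 n N t ℓ K k := by
  classical
  rw [traceMoment, ← integral_const_mul]
  refine integral_congr_ae (Filter.Eventually.of_forall fun h => ?_)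
  dsimp only
  have := coeff_mul_of_supportedOn (Finset.disjoint_empty_left K)
    (supportedOn_formalPhi 𝒞 n N t h) (supportedOn_prod_formalResolvent 𝒞 n N K h) (m := 0)
    (m' := faceExp ℓ K) (fun _ _ => rfl) (fun _ => faceExp_eq_zero) k
  rw [zero_add] at this
  rw [this, Finset.sum_eq_single (k, 0)]
  · rw [coeff_formalPhi, coeff_prod_formalResolvent, if_pos rfl, if_pos rfl, cellNorm, mul_left_comm,
      mul_comm, ← Finset.prod_mul_distrib]
    congr 1
    refine Finset.prod_congr rfl fun C _ => ?_
    rw [mul_pow]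
    ring
  · intro x hx hne
    rw [coeff_prod_formalResolvent, if_neg, mul_zero]
    intro h0
    rw [Finset.HasAntidiagonal.mem_antidiagonal, h0, add_zero] at hx
    exact hne (Prod.ext hx h0)
  · intro h0
    exact absurd (Finset.HasAntidiagonal.mem_antidiagonal.2 (add_zero k)) h0

theorem partitionFn_eq : partitionFn 𝒞 n N t = momentSeries 𝒞 n N t ∅ := by
  simp [partitionFn, momentSeries]

variable {N t} in
theorem constantCoeff_partitionFn (hN : 1 ≤ N) (ht : 0 < t) :
    MvPowerSeries.constantCoeff (partitionFn 𝒞 n N t) = 1 := by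
  have := isProbabilityMeasure_gaussianHerm hN ht
  have h := coeff_momentSeries 𝒞 n N t (fun _ => 0) ∅ 0
  have e : Finsupp.sumElim (faceExp (fun _ : Fin n => 0) ∅) (0 : 𝒞 →₀ ℕ) = 0 := by
    ext (j | c) <;> simp [faceExp_apply]
  rw [e, MvPowerSeries.coeff_zero_eq_constantCoeff_apply] at h
  rw [partitionFn_eq, h]
  simp [cellNorm, traceMoment]

theorem disconnectedCorr_eq (K : Finset (Fin n)) : disconnectedCorr 𝒞 n N t K =
    (partitionFn 𝒞 n N t)⁻¹ * momentSeries 𝒞 n N t K := rfl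

theorem supportedOn_disconnectedCorr (K : Finset (Fin n)) :
    SupportedOn K (disconnectedCorr 𝒞 n N t K) := by
  rw [disconnectedCorr_eq, partitionFn_eq, ← Finset.empty_union K]
  have := (supportedOn_momentSeries 𝒞 n N t ∅).inv.mul (supportedOn_momentSeries 𝒞 n N t K)
  rwa [Finset.empty_union] at this ⊢

theorem supportedOn_jointCumulant (K : Finset (Fin n)) :
    SupportedOn K (jointCumulant (disconnectedCorr 𝒞 n N t) K) := by
  refine SupportedOn.sum fun P _ => ?_
  have h1 := SupportedOn.prod P.parts id (fun B => disconnectedCorr 𝒞 n N t B)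
    fun B _ => supportedOn_disconnectedCorr 𝒞 n N t B
  have h2 := (SupportedOn.C (α := Fin n) (β := 𝒞)
    ((-1) ^ (P.parts.card - 1) * ((P.parts.card - 1)! : ℝ))).mul h1
  rw [P.sup_parts, Finset.empty_union] at h2
  simpa using h2

theorem connectedCorr_eq_jointCumulant :
    connectedCorr 𝒞 n N t = jointCumulant (disconnectedCorr 𝒞 n N t) Finset.univ := by
  rw [connectedCorr, jointCumulant]
  refine Finset.sum_congr rfl fun P _ => ?_
  simp

/-- The coefficient of a joint cumulant series, without the factor coming from the expansion of
`Φ`. -/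
noncomputable def traceCumulant (ℓ : Fin n → ℕ) (K : Finset (Fin n)) (k : 𝒞 →₀ ℕ) : ℝ :=
  MvPowerSeries.coeff (Finsupp.sumElim (faceExp ℓ K) k)
    (jointCumulant (disconnectedCorr 𝒞 n N t) K) / cellNorm 𝒞 N t k

variable {N t}

theorem cellNorm_ne_zero (hN : 1 ≤ N) (ht : 0 < t) (k : 𝒞 →₀ ℕ) : cellNorm 𝒞 N t k ≠ 0 :=
  Finset.prod_ne_zero_iff.2 fun C _ => div_ne_zero
    (pow_ne_zero _ (C.1.vertexFactor_ne_zero hN ht)) (by exact_mod_cast (k C).factorial_ne_zero)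

variable {𝒞 n}

/-- The number of ways to distribute labelled cells of types `k` between two sets of types `x.1` and
`x.2`. -/
def cellChoose (x : (𝒞 →₀ ℕ) × (𝒞 →₀ ℕ)) : ℕ := ∏ C, ((x.1 C + x.2 C).choose (x.1 C))

/-- The factors `1 / k!` turn products of coefficients into sums over distributions of labelled cells. -/
theorem cellNorm_mul (x : (𝒞 →₀ ℕ) × (𝒞 →₀ ℕ)) :
    cellNorm 𝒞 N t x.1 * cellNorm 𝒞 N t x.2 = cellChoose x * cellNorm 𝒞 N t (x.1 + x.2) := by
  rw [cellNorm, cellNorm, cellNorm, cellChoose, ← Finset.prod_mul_distrib]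
  push_cast
  rw [← Finset.prod_mul_distrib]
  refine Finset.prod_congr rfl fun C _ => ?_
  have h : ((x.1 C + x.2 C).choose (x.1 C) : ℝ) =
      ((x.1 C + x.2 C)! : ℝ) / ((x.1 C)! * (x.2 C)!) := by
    rw [Nat.cast_choose ℝ (Nat.le_add_right _ _), Nat.add_sub_cancel_left]
  have h1 : (((x.1 C)! : ℕ) : ℝ) ≠ 0 := by exact_mod_cast (x.1 C).factorial_ne_zero
  have h2 : (((x.2 C)! : ℕ) : ℝ) ≠ 0 := by exact_mod_cast (x.2 C).factorial_ne_zero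
  have h3 : (((x.1 C + x.2 C)! : ℕ) : ℝ) ≠ 0 := by
    exact_mod_cast (x.1 C + x.2 C).factorial_ne_zero
  rw [h, Pi.add_apply, pow_add]
  field_simp

/-- The recursion between moments and cumulants for traces, with labelled 2-cells: the connected part
of the marked face `p` contains the marked faces `B` and 2-cells of types `x.1`. -/
theorem traceMoment_eq_sum [DecidableEq 𝒞] (hN : 1 ≤ N) (ht : 0 < t) (ℓ : Fin n → ℕ) {K : Finset (Fin n)}
    {p : Fin n} (hp : p ∈ K) (k : 𝒞 →₀ ℕ) :
    traceMoment 𝒞 n N t ℓ K k = ∑ B ∈ K.powerset.filter (p ∈ ·),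
      ∑ x ∈ Finset.HasAntidiagonal.antidiagonal k, cellChoose x *
        (traceCumulant 𝒞 n N t ℓ B x.1 * traceMoment 𝒞 n N t ℓ (K \ B) x.2) := by
  have hZ : MvPowerSeries.constantCoeff (partitionFn 𝒞 n N t) ≠ 0 := by
    rw [constantCoeff_partitionFn 𝒞 n hN ht]
    exact one_ne_zero
  have hmom : ∀ K, partitionFn 𝒞 n N t * disconnectedCorr 𝒞 n N t K = momentSeries 𝒞 n N t K := by
    intro K
    rw [disconnectedCorr_eq, ← mul_assoc, MvPowerSeries.mul_inv_cancel _ hZ, one_mul]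
  have h0 : disconnectedCorr 𝒞 n N t ∅ = 1 := by
    rw [disconnectedCorr_eq, ← partitionFn_eq, mul_comm, MvPowerSeries.mul_inv_cancel _ hZ]
  have hrec : momentSeries 𝒞 n N t K = ∑ B ∈ K.powerset.filter (p ∈ ·),
      jointCumulant (disconnectedCorr 𝒞 n N t) B * momentSeries 𝒞 n N t (K \ B) := by
    rw [← hmom K, eq_sum_jointCumulant_mul _ h0 hp, Finset.mul_sum]
    refine Finset.sum_congr rfl fun B _ => ?_
    rw [← hmom (K \ B)]
    ring
  have hne := cellNorm_ne_zero 𝒞 hN ht k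
  refine mul_left_cancel₀ hne ?_
  rw [← coeff_momentSeries, hrec, map_sum, Finset.mul_sum]
  refine Finset.sum_congr rfl fun B hB => ?_
  rw [Finset.mem_filter, Finset.mem_powerset] at hB
  have hf : faceExp ℓ K = faceExp ℓ B + faceExp ℓ (K \ B) := by
    rw [faceExp_add ℓ Finset.disjoint_sdiff, Finset.union_sdiff_of_subset hB.1]
  rw [hf, coeff_mul_of_supportedOn Finset.disjoint_sdiff (supportedOn_jointCumulant 𝒞 n N t B)
    (supportedOn_momentSeries 𝒞 n N t (K \ B)) (fun _ => faceExp_eq_zero)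
    (fun _ => faceExp_eq_zero), Finset.mul_sum]
  refine Finset.sum_congr rfl fun x hx => ?_
  rw [Finset.HasAntidiagonal.mem_antidiagonal] at hx
  have h1 := cellNorm_ne_zero 𝒞 hN ht x.1
  have h2 := cellNorm_mul (N := N) (t := t) x
  rw [hx] at h2
  rw [coeff_momentSeries, traceCumulant, ← mul_assoc, ← mul_assoc, mul_comm (cellNorm 𝒞 N t k), ← h2]
  field_simp

end CorrelatorCoefficients

/-! ### Traces of powers as sums over colourings -/

section Traces

variable {N : ℕ}

/-- The entries of a matrix power as sums over paths of indices, against a function of the end points. -/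
theorem sum_path_prod {R : Type*} [CommRing R] (M : Matrix (Fin N) (Fin N) R) (k : ℕ)
    (g : Fin N → Fin N → R) :
    ∑ i : Fin (k + 1) → Fin N, (∏ s : Fin k, M (i s.castSucc) (i s.succ)) * g (i 0) (i (Fin.last k)) =
      ∑ x, ∑ y, (M ^ k) x y * g x y := by
  induction k generalizing g with
  | zero =>
    rw [← (Equiv.funUnique (Fin 1) (Fin N)).symm.sum_comp]
    refine Finset.sum_congr rfl fun x _ => ?_
    rw [Finset.sum_eq_single x]
    · simp
    · intro y _ hy
      rw [pow_zero, Matrix.one_apply_ne hy.symm, zero_mul]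
    · simp
  | succ k ih =>
    rw [← (Fin.snocEquiv fun _ : Fin (k + 2) => Fin N).sum_comp, Fintype.sum_prod_type]
    have h : ∀ (y : Fin N) (i : Fin (k + 1) → Fin N),
        (∏ s : Fin (k + 1), M ((Fin.snocEquiv fun _ : Fin (k + 2) => Fin N) (y, i) s.castSucc)
          ((Fin.snocEquiv fun _ : Fin (k + 2) => Fin N) (y, i) s.succ)) *
          g ((Fin.snocEquiv fun _ : Fin (k + 2) => Fin N) (y, i) 0)
            ((Fin.snocEquiv fun _ : Fin (k + 2) => Fin N) (y, i) (Fin.last (k + 1))) =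
        (∏ s : Fin k, M (i s.castSucc) (i s.succ)) * (M (i (Fin.last k)) y * g (i 0) y) := by
      intro y i
      rw [Fin.prod_univ_castSucc]
      simp only [Fin.snocEquiv, Equiv.coe_fn_mk, Fin.succ_last, Fin.snoc_last,
        Fin.succ_castSucc, Fin.snoc_castSucc]
      have h0 : (Fin.snoc i y : Fin (k + 2) → Fin N) 0 = i 0 := by
        rw [← Fin.castSucc_zero, Fin.snoc_castSucc]
      rw [h0, mul_assoc]
    simp only [h]
    rw [Finset.sum_comm]
    simp only [← Finset.mul_sum]
    rw [ih fun x z => ∑ y, M z y * g x y]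
    refine Finset.sum_congr rfl fun x _ => ?_
    simp only [Finset.mul_sum]
    rw [Finset.sum_comm]
    refine Finset.sum_congr rfl fun y _ => ?_
    rw [pow_succ, Matrix.mul_apply, Finset.sum_mul]
    exact Finset.sum_congr rfl fun z _ => by ring

/-- The trace of a power as a sum over closed paths. A polygon with no sides still has a vertex,
hence the extra factor. -/
theorem trace_pow_eq_sum {R : Type*} [CommRing R] (M : Matrix (Fin N) (Fin N) R) (l : ℕ) :
    Matrix.trace (M ^ l) = (if l = 0 then (N : R) else 1) *
      ∑ i : Fin l → Fin N, ∏ s, M (i s) (i (finRotate l s)) := by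
  rcases l with _ | k
  · simp
  · rw [if_neg (Nat.succ_ne_zero k), one_mul]
    have h := sum_path_prod M k fun x y => M y x
    have e : Matrix.trace (M ^ (k + 1)) = ∑ x, ∑ y, (M ^ k) x y * M y x := by
      rw [pow_succ, Matrix.trace]
      rfl
    rw [e, ← h]
    refine Finset.sum_congr rfl fun i _ => ?_
    rw [Fin.prod_univ_castSucc]
    simp only [finRotate_apply, Fin.last_add_one, Fin.coeSucc_eq_succ]

/-- Choosing indices around each polygon separately is choosing indices for all sides at once. The
polygon `p` has `len p` sides, and `ι` enumerates the sides of all polygons. -/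
theorem prod_sum_polygons {ι Pg R : Type*} [Fintype ι] [DecidableEq ι] [Fintype Pg]
    [CommRing R] (len : Pg → ℕ) (E : ι ≃ Σ p, Fin (len p)) (nx : Equiv.Perm ι)
    (hE : ∀ s, E (nx s) = ⟨(E s).1, finRotate _ (E s).2⟩) (F : Pg → Fin N → Fin N → R) :
    ∏ p, ∑ i : Fin (len p) → Fin N, ∏ s, F p (i s) (i (finRotate _ s)) =
      ∑ i : ι → Fin N, ∏ s, F (E s).1 (i s) (i (nx s)) := by
  classical
  rw [Finset.prod_univ_sum, Fintype.piFinset_univ]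
  refine (Fintype.sum_equiv ((Equiv.arrowCongr E (Equiv.refl (Fin N))).trans
    (Equiv.piCurry fun p (_ : Fin (len p)) => Fin N)) _ _ fun i => ?_).symm
  have h : ∀ y, nx (E.symm y) = E.symm ⟨y.1, finRotate _ y.2⟩ := fun y => by
    rw [Equiv.eq_symm_apply, hE, Equiv.apply_symm_apply]
  rw [← E.symm.prod_comp, Fintype.prod_sigma]
  simp [Equiv.piCurry, Sigma.curry, h]

variable {ι Pg π : Type*} [Fintype ι] [Fintype Pg] [DecidableEq π]
  (len : Pg → ℕ) (E : ι ≃ Σ p, Fin (len p)) (nx : Equiv.Perm ι)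
  (g : Pg → π) (pc : ι → π)

/-- The weight of a piece: `√(t/N)` for each side, and `N` for each polygon without sides. -/
noncomputable def pieceWeight (N : ℕ) (t : ℝ) (q : π) : ℝ :=
  Real.sqrt (t / N) ^ (Finset.univ.filter fun s => pc s = q).card *
    ∏ p ∈ Finset.univ.filter (fun p => g p = q), (if len p = 0 then (N : ℝ) else 1)

theorem prod_filter_mem {M : Type*} [CommMonoid M] (Q : Finset π) (f : Pg → M) :
    ∏ q ∈ Q, ∏ p ∈ Finset.univ.filter (fun p => g p = q), f p =
      ∏ p ∈ Finset.univ.filter (fun p => g p ∈ Q), f p := by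
  rw [← Finset.prod_fiberwise_of_maps_to (g := g) (t := Q)
    fun p hp => (Finset.mem_filter.1 hp).2]
  refine Finset.prod_congr rfl fun q hq => Finset.prod_congr ?_ fun _ _ => rfl
  ext p
  simp only [Finset.mem_filter, Finset.mem_univ, true_and]
  exact ⟨fun h => ⟨h ▸ hq, h⟩, fun h => h.2⟩

theorem prod_pieceWeight (t : ℝ) (Q : Finset π) :
    ∏ q ∈ Q, pieceWeight len g pc N t q = Real.sqrt (t / N) ^ (sidesOf pc Q).card *
      ∏ p ∈ Finset.univ.filter (fun p => g p ∈ Q), (if len p = 0 then (N : ℝ) else 1) := by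
  simp only [pieceWeight]
  rw [Finset.prod_mul_distrib, prod_filter_mem, Finset.prod_pow_eq_pow_sum]
  congr 2
  rw [Finset.card_eq_sum_card_fiberwise (f := pc) (t := Q)
    (fun s hs => (mem_sidesOf pc).1 hs)]
  refine Finset.sum_congr rfl fun q hq => ?_
  congr 1
  ext s
  simp only [Finset.mem_filter, Finset.mem_univ, true_and, mem_sidesOf]
  exact ⟨fun h => ⟨h ▸ hq, h⟩, fun h => h.2⟩

/-- The sides outside `Q` have the single colour `0` and contribute a factor `1`. -/
theorem sum_prod_ite_zero [NeZero N] {R : Type*} [CommRing R] (l : ℕ) :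
    ∑ i : Fin l → Fin N, ∏ s, (if i s = 0 then (1 : R) else 0) = 1 := by
  rw [Finset.sum_eq_single fun _ => 0]
  · simp
  · intro i _ hi
    obtain ⟨s, hs⟩ := Function.ne_iff.1 hi
    exact Finset.prod_eq_zero (Finset.mem_univ s) (if_neg hs)
  · simp

/-- The traces attached to the pieces in `Q` as a sum over colourings of their sides. -/
theorem prod_trace_eq_sum [DecidableEq ι] [NeZero N] (hE : ∀ s, E (nx s) = ⟨(E s).1, finRotate _ (E s).2⟩)
    (hpc : ∀ s, pc s = g (E s).1) (Q : Finset π) (M : Matrix (Fin N) (Fin N) ℂ) :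
    ∏ p ∈ Finset.univ.filter (fun p => g p ∈ Q), Matrix.trace (M ^ len p) =
      (∏ p ∈ Finset.univ.filter (fun p => g p ∈ Q), (if len p = 0 then (N : ℂ) else 1)) *
      ∑ i : ι → Fin N, (if ∀ s, pc s ∉ Q → i s = 0 then 1 else 0) *
        ∏ s ∈ sidesOf pc Q, M (i s) (i (nx s)) := by
  have h1 : ∏ p ∈ Finset.univ.filter (fun p => g p ∈ Q),
      ∑ i : Fin (len p) → Fin N, ∏ s, M (i s) (i (finRotate _ s)) =
      ∏ p, ∑ i : Fin (len p) → Fin N, ∏ s, (if g p ∈ Q then M (i s) (i (finRotate _ s)) else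
        if i s = 0 then 1 else 0) := by
    rw [Finset.prod_filter]
    refine Finset.prod_congr rfl fun p _ => ?_
    split_ifs with hp
    · rfl
    · exact (sum_prod_ite_zero _).symm
  simp only [trace_pow_eq_sum]
  rw [Finset.prod_mul_distrib, h1, prod_sum_polygons len E nx hE
    fun p x y => if g p ∈ Q then M x y else if x = 0 then 1 else 0]
  congr 1
  refine Finset.sum_congr rfl fun i _ => ?_
  simp only [← hpc]
  rw [← Finset.prod_filter_mul_prod_filter_not Finset.univ (fun s => pc s ∈ Q), mul_comm]
  congr 1
  · split_ifs with h
    · refine Finset.prod_eq_one fun s hs => ?_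
      have hs' := (Finset.mem_filter.1 hs).2
      rw [if_neg hs', if_pos (h s hs')]
    · push Not at h
      obtain ⟨s, hs, hs'⟩ := h
      refine Finset.prod_eq_zero (Finset.mem_filter.2 ⟨Finset.mem_univ s, hs⟩) ?_
      rw [if_neg hs, if_neg hs']
  · exact Finset.prod_congr rfl fun s hs => if_pos (Finset.mem_filter.1 hs).2

/-- The expectation of a product of traces of powers is a sum over pairings of the sides. -/
theorem integral_prod_trPow [DecidableEq ι] [NeZero N] {t : ℝ} (hN : 1 ≤ N) (ht : 0 < t)
    (hE : ∀ s, E (nx s) = ⟨(E s).1, finRotate _ (E s).2⟩)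
    (hpc : ∀ s, pc s = g (E s).1) (Q : Finset π) :
    Integrable (fun h : HermCoord N => ∏ p ∈ Finset.univ.filter (fun p => g p ∈ Q), trPow h (len p))
      (gaussianHerm N t) ∧
    ∫ h : HermCoord N, ∏ p ∈ Finset.univ.filter (fun p => g p ∈ Q), trPow h (len p)
      ∂(gaussianHerm N t) = pairingSum pc nx N (pieceWeight len g pc N t) Q := by
  have hcast : ∀ h : HermCoord N,
      ((∏ p ∈ Finset.univ.filter (fun p => g p ∈ Q), trPow h (len p) : ℝ) : ℂ) =
      (∏ p ∈ Finset.univ.filter (fun p => g p ∈ Q), (if len p = 0 then (N : ℂ) else 1)) *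
      ∑ i : ι → Fin N, (if ∀ s, pc s ∉ Q → i s = 0 then 1 else 0) *
        ∏ s ∈ sidesOf pc Q, hermMatrix h (i s) (i (nx s)) := by
    intro h
    rw [← prod_trace_eq_sum len E nx g pc hE hpc]
    push_cast
    exact Finset.prod_congr rfl fun p _ => ofReal_trPow h _
  have hint := fun i : ι → Fin N =>
    integral_prod_hermMatrix hN ht (fun s => i s) (fun s => i (nx s)) (sidesOf pc Q)
  have hint' : ∀ i ∈ (Finset.univ : Finset (ι → Fin N)), Integrable (fun h : HermCoord N =>
      (if ∀ s, pc s ∉ Q → i s = 0 then (1 : ℂ) else 0) *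
        ∏ s ∈ sidesOf pc Q, hermMatrix h (i s) (i (nx s))) (gaussianHerm N t) :=
    fun i _ => (hint i).1.const_mul _
  constructor
  · have h1 := ((integrable_finsetSum _ hint').const_mul
      (∏ p ∈ Finset.univ.filter (fun p => g p ∈ Q), (if len p = 0 then (N : ℂ) else 1))).re
    refine h1.congr (Filter.Eventually.of_forall fun h => ?_)
    dsimp only
    rw [← hcast h]
    exact Complex.ofReal_re _
  · apply Complex.ofReal_injective
    rw [← integral_complex_ofReal]
    simp only [hcast]
    rw [integral_const_mul, integral_finsetSum _ hint']
    simp only [integral_const_mul, (hint _).2]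
    simp only [Finset.mul_sum]
    rw [Finset.sum_comm, pairingSum]
    push_cast
    refine Finset.sum_congr rfl fun α _ => ?_
    have hcol : ((colorings pc nx N Q α).card : ℂ) = ∑ i : ι → Fin N,
        (if ∀ s, pc s ∉ Q → i s = 0 then (1 : ℂ) else 0) *
          (if ∀ s ∈ sidesOf pc Q, i s = i (nx (α s)) then 1 else 0) := by
      rw [Finset.card_eq_sum_ones, Nat.cast_sum]
      rw [← Finset.sum_filter_add_sum_filter_not Finset.univ
        (fun i => i ∈ colorings pc nx N Q α) (fun i => (if ∀ s, pc s ∉ Q → i s = 0 then (1 : ℂ) else 0) *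
          (if ∀ s ∈ sidesOf pc Q, i s = i (nx (α s)) then 1 else 0)), Finset.filter_mem_eq_inter,
          Finset.univ_inter]
      rw [Finset.sum_eq_zero (s := Finset.univ.filter _), add_zero]
      · refine Finset.sum_congr rfl fun i hi => ?_
        rw [mem_colorings] at hi
        rw [if_pos hi.2, if_pos fun s hs => hi.1 s ((mem_sidesOf pc).1 hs)]
        simp
      · intro i hi
        have hi' := (Finset.mem_filter.1 hi).2
        rw [mem_colorings, not_and_or] at hi'
        rcases hi' with hi' | hi'
        · rw [if_neg (c := ∀ s ∈ sidesOf pc Q, i s = i (nx (α s))), mul_zero]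
          exact fun h => hi' fun s hs => h s ((mem_sidesOf pc).2 hs)
        · rw [if_neg hi', zero_mul]
    rw [pairingWeight, prod_pieceWeight]
    push_cast
    simp only [apply_ite Complex.ofReal, Complex.ofReal_natCast, Complex.ofReal_one]
    rw [hcol, Finset.mul_sum]
    refine Finset.sum_congr rfl fun i _ => ?_
    ring

end Traces

/-! ### Connected pairings and joint cumulants -/

section TypeCount

variable {ι β : Type*} [Fintype β]

/-- The numbers of elements of a finite set of each type, for a typing `c`. -/
noncomputable def typeCount (c : ι → β) (A : Finset ι) : β →₀ ℕ := ∑ i ∈ A, Finsupp.single (c i) 1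

theorem prod_pow_typeCount {M : Type*} [CommMonoid M] (c : ι → β) (A : Finset ι) (x : β → M) :
    ∏ b, x b ^ typeCount c A b = ∏ i ∈ A, x (c i) := by
  classical
  simp only [typeCount, Finsupp.finsetSum_apply, ← Finset.prod_pow_eq_pow_sum]
  rw [Finset.prod_comm]
  refine Finset.prod_congr rfl fun i _ => ?_
  rw [Finset.prod_eq_single (c i)]
  · simp
  · intro b _ hb
    rw [Finsupp.single_eq_of_ne hb, pow_zero]
  · simp

/-- The subsets of a set of labelled elements, grouped by their types. -/
theorem sum_powerset_typeCount [DecidableEq ι] [DecidableEq β] (c : ι → β) (A : Finset ι) (F : (β →₀ ℕ) → (β →₀ ℕ) → ℝ) :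
    ∑ A' ∈ A.powerset, F (typeCount c A') (typeCount c (A \ A')) =
      ∑ x ∈ Finset.HasAntidiagonal.antidiagonal (typeCount c A),
        ((∏ b, (x.1 b + x.2 b).choose (x.1 b) : ℕ) : ℝ) * F x.1 x.2 := by
  -- compare two expansions of a product of sums of two variables
  let P : MvPolynomial (β ⊕ β) ℝ := ∏ i ∈ A, (MvPolynomial.X (Sum.inl (c i)) +
    MvPolynomial.X (Sum.inr (c i)))
  let L : MvPolynomial (β ⊕ β) ℝ →ₗ[ℝ] ℝ := (MvPolynomial.basisMonomials (β ⊕ β) ℝ).constr ℝ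
    fun e => F (Finsupp.sumFinsuppEquivProdFinsupp e).1 (Finsupp.sumFinsuppEquivProdFinsupp e).2
  have hL : ∀ x y : β →₀ ℕ, L (MvPolynomial.monomial (Finsupp.sumElim x y) 1) = F x y := by
    intro x y
    have h : MvPolynomial.monomial (Finsupp.sumElim x y) (1 : ℝ) =
        MvPolynomial.basisMonomials (β ⊕ β) ℝ (Finsupp.sumElim x y) := by
      rw [MvPolynomial.coe_basisMonomials]
    rw [h, Module.Basis.constr_basis]
    congr 1
    · ext b; simp
    · ext b; simp
  have hmon : ∀ x y : β →₀ ℕ, (MvPolynomial.monomial (Finsupp.sumElim x y) 1 :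
      MvPolynomial (β ⊕ β) ℝ) = (∏ b, MvPolynomial.X (Sum.inl b) ^ x b) *
        ∏ b, MvPolynomial.X (Sum.inr b) ^ y b := by
    intro x y
    rw [MvPolynomial.monomial_eq, MvPolynomial.C_1, one_mul, Finsupp.prod_fintype _ _
      fun _ => pow_zero _, Fintype.prod_sum_type]
    simp
  have h1 : P = ∑ A' ∈ A.powerset,
      MvPolynomial.monomial (Finsupp.sumElim (typeCount c A') (typeCount c (A \ A'))) 1 := by
    change ∏ i ∈ A, (_ + _) = _
    rw [Finset.prod_add]
    refine Finset.sum_congr rfl fun A' _ => ?_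
    rw [hmon, prod_pow_typeCount c A' fun b => MvPolynomial.X (Sum.inl b),
      prod_pow_typeCount c (A \ A') fun b => MvPolynomial.X (Sum.inr b)]
  have h2 : P = ∑ x ∈ Finset.HasAntidiagonal.antidiagonal (typeCount c A),
      ((∏ b, (x.1 b + x.2 b).choose (x.1 b) : ℕ) : ℝ) •
        MvPolynomial.monomial (Finsupp.sumElim x.1 x.2) 1 := by
    have h3 : P = ∏ b, (MvPolynomial.X (Sum.inl b) +
        MvPolynomial.X (Sum.inr b) : MvPolynomial (β ⊕ β) ℝ) ^ typeCount c A b :=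
      (prod_pow_typeCount c A fun b => MvPolynomial.X (Sum.inl b) + MvPolynomial.X (Sum.inr b)).symm
    rw [h3]
    have hpow : ∀ b, (MvPolynomial.X (Sum.inl b) + MvPolynomial.X (Sum.inr b) :
        MvPolynomial (β ⊕ β) ℝ) ^ typeCount c A b = _ := fun b =>
      (Commute.all (MvPolynomial.X (Sum.inl b)) (MvPolynomial.X (Sum.inr b))).add_pow' _
    simp only [hpow, Finset.prod_univ_sum]
    refine Finset.sum_bij' (fun x _ => (Finsupp.equivFunOnFinite.symm fun b => (x b).1,
        Finsupp.equivFunOnFinite.symm fun b => (x b).2)) (fun x _ b => (x.1 b, x.2 b)) ?_ ?_ ?_ ?_ ?_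
    · intro x hx
      rw [Fintype.mem_piFinset] at hx
      rw [Finset.HasAntidiagonal.mem_antidiagonal]
      ext b
      simpa using hx b
    · intro x hx
      rw [Finset.HasAntidiagonal.mem_antidiagonal] at hx
      rw [Fintype.mem_piFinset]
      intro b
      simpa using DFunLike.congr_fun hx b
    · intro x _
      rfl
    · intro x _
      refine Prod.ext ?_ ?_ <;> ext b <;> simp
    · intro x hx
      rw [Fintype.mem_piFinset] at hx
      rw [hmon]
      simp only [nsmul_eq_mul, Finset.prod_mul_distrib, Finsupp.equivFunOnFinite_symm_apply_apply]
      have : ∀ b, (x b).1 + (x b).2 = typeCount c A b := fun b => by simpa using hx b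
      simp only [this]
      rw [Algebra.smul_def]
      simp
  have h4 := congrArg L (h1.symm.trans h2)
  simpa only [map_sum, map_smul, hL, smul_eq_mul] using h4

end TypeCount

section StuffedSides

variable {𝒞 : Finset ElemCell} {n m : ℕ} (ℓ : Fin n → ℕ) (cell : Fin m → 𝒞)

/-- The piece to which a side belongs. -/
def sidePiece : StuffedSide ℓ cell → Fin n ⊕ Fin m := Sum.map Sigma.fst Sigma.fst

/-- The following side on the same boundary polygon. -/
def sideNext : Equiv.Perm (StuffedSide ℓ cell) :=
  Equiv.sumCongr (Equiv.sigmaCongrRight fun j => finRotate (ℓ j))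
    (Equiv.sigmaCongrRight fun _ => Equiv.sigmaCongrRight fun _ => finRotate _)

/-- The boundary polygons of the pieces. -/
abbrev StuffedPolygon (_ℓ : Fin n → ℕ) (cell : Fin m → 𝒞) : Type :=
  Fin n ⊕ (Σ i : Fin m, Fin (cell i).1.perims.length)

/-- The perimeter of a boundary polygon. -/
def polyLen : StuffedPolygon ℓ cell → ℕ
  | Sum.inl j => ℓ j
  | Sum.inr b => (cell b.1).1.perims.get b.2

/-- The piece to which a boundary polygon belongs. -/
def polyPiece : StuffedPolygon ℓ cell → Fin n ⊕ Fin m := Sum.map id Sigma.fst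

/-- The sides as pairs of a boundary polygon and a position on it. -/
def sideEquiv : StuffedSide ℓ cell ≃ Σ p : StuffedPolygon ℓ cell, Fin (polyLen ℓ cell p) where
  toFun
    | Sum.inl ⟨j, s⟩ => ⟨Sum.inl j, s⟩
    | Sum.inr ⟨i, b, s⟩ => ⟨Sum.inr ⟨i, b⟩, s⟩
  invFun
    | ⟨Sum.inl j, s⟩ => Sum.inl ⟨j, s⟩
    | ⟨Sum.inr ⟨i, b⟩, s⟩ => Sum.inr ⟨i, b, s⟩
  left_inv := by rintro (⟨j, s⟩ | ⟨i, b, s⟩) <;> rfl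
  right_inv := by rintro ⟨j | ⟨i, b⟩, s⟩ <;> rfl

theorem sideEquiv_sideNext (s : StuffedSide ℓ cell) : sideEquiv ℓ cell (sideNext ℓ cell s) =
    ⟨(sideEquiv ℓ cell s).1, finRotate _ (sideEquiv ℓ cell s).2⟩ := by
  rcases s with ⟨j, s⟩ | ⟨i, b, s⟩ <;> rfl

theorem sidePiece_eq (s : StuffedSide ℓ cell) :
    sidePiece ℓ cell s = polyPiece ℓ cell (sideEquiv ℓ cell s).1 := by
  rcases s with ⟨j, s⟩ | ⟨i, b, s⟩ <;> rfl

theorem sidePiece_sideNext (s : StuffedSide ℓ cell) :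
    sidePiece ℓ cell (sideNext ℓ cell s) = sidePiece ℓ cell s := by
  rcases s with ⟨j, s⟩ | ⟨i, b, s⟩ <;> rfl

theorem prod_polyPiece_eq {M : Type*} [CommMonoid M] (f : ℕ → M) (B : Finset (Fin n))
    (A : Finset (Fin m)) :
    ∏ p ∈ Finset.univ.filter (fun p => polyPiece ℓ cell p ∈ B.disjSum A), f (polyLen ℓ cell p) =
      (∏ j ∈ B, f (ℓ j)) * ∏ i ∈ A, ((cell i).1.perims.map f).prod := by
  rw [← prod_filter_mem, Finset.prod_disjSum]
  congr 1
  · refine Finset.prod_congr rfl fun j _ => ?_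
    have : (Finset.univ.filter fun p => polyPiece ℓ cell p = Sum.inl j) = {Sum.inl j} := by
      ext (j' | b) <;> rw [Finset.mem_filter] <;> simp [polyPiece]
    rw [this, Finset.prod_singleton]
    rfl
  · refine Finset.prod_congr rfl fun i _ => ?_
    have : (Finset.univ.filter fun p => polyPiece ℓ cell p = Sum.inr i) =
        (Finset.univ : Finset (Fin (cell i).1.perims.length)).map
          ⟨fun b => Sum.inr ⟨i, b⟩, fun b b' h => by simpa using h⟩ := by
      ext (j' | ⟨i', b⟩)
      · rw [Finset.mem_filter]
        simp [polyPiece]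
      · rw [Finset.mem_filter, Finset.mem_map]
        simp only [polyPiece, Finset.mem_univ, true_and, Sum.map_inr, Sum.inr.injEq]
        constructor
        · rintro rfl
          exact ⟨b, rfl⟩
        · rintro ⟨b', h⟩
          exact (congrArg Sigma.fst (Sum.inr.inj h)).symm
    rw [this, Finset.prod_map]
    exact Fin.prod_univ_fun_getElem (cell i).1.perims f

variable {N : ℕ} {t : ℝ}

/-- The weights of the pieces. -/
noncomputable def stuffedPieceWeight (N : ℕ) (t : ℝ) : Fin n ⊕ Fin m → ℝ :=
  pieceWeight (polyLen ℓ cell) (polyPiece ℓ cell) (sidePiece ℓ cell) N t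

theorem pairingSum_eq_traceMoment [NeZero N] (hN : 1 ≤ N) (ht : 0 < t) (B : Finset (Fin n))
    (A : Finset (Fin m)) :
    pairingSum (sidePiece ℓ cell) (sideNext ℓ cell) N (stuffedPieceWeight ℓ cell N t)
      (B.disjSum A) = traceMoment 𝒞 n N t ℓ B (typeCount cell A) := by
  have h := (integral_prod_trPow (polyLen ℓ cell) (sideEquiv ℓ cell) (sideNext ℓ cell)
    (polyPiece ℓ cell) (sidePiece ℓ cell) hN ht (sideEquiv_sideNext ℓ cell) (sidePiece_eq ℓ cell)
    (B.disjSum A)).2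
  rw [stuffedPieceWeight, ← h, traceMoment]
  refine integral_congr_ae (Filter.Eventually.of_forall fun x => ?_)
  dsimp only
  rw [prod_polyPiece_eq, prod_pow_typeCount cell A fun C => C.1.traceProd x]
  rfl

theorem sum_powerset_disjSum {M : Type*} [AddCommMonoid M] (B : Finset (Fin n))
    (A : Finset (Fin m)) (p : Fin n) (f : Finset (Fin n ⊕ Fin m) → M) :
    ∑ R ∈ (B.disjSum A).powerset.filter (Sum.inl p ∈ ·), f R =
      ∑ x ∈ (B.powerset.filter (p ∈ ·)) ×ˢ A.powerset, f (x.1.disjSum x.2) := by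
  refine Finset.sum_bij' (fun R _ => (R.toLeft, R.toRight)) (fun x _ => x.1.disjSum x.2)
    ?_ ?_ ?_ ?_ ?_
  · intro R hR
    simp only [Finset.mem_filter, Finset.mem_powerset] at hR
    simp only [Finset.mem_product, Finset.mem_filter, Finset.mem_powerset, Finset.mem_toLeft]
    refine ⟨⟨fun j hj => ?_, hR.2⟩, fun i hi => ?_⟩
    · simpa using hR.1 (Finset.mem_toLeft.1 hj)
    · simpa using hR.1 (Finset.mem_toRight.1 hi)
  · intro x hx
    simp only [Finset.mem_product, Finset.mem_filter, Finset.mem_powerset] at hx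
    simp only [Finset.mem_filter, Finset.mem_powerset, Finset.inl_mem_disjSum]
    exact ⟨Finset.disjSum_mono hx.1.1 hx.2, hx.1.2⟩
  · intro R _
    simp [Finset.toLeft_disjSum_toRight]
  · intro x _
    simp
  · intro R _
    simp [Finset.toLeft_disjSum_toRight]

theorem disjSum_sdiff (B B' : Finset (Fin n)) (A A' : Finset (Fin m)) :
    B.disjSum A \ B'.disjSum A' = (B \ B').disjSum (A \ A') := by
  ext (j | i) <;> simp

/-- The sum over connected pairings is a joint cumulant: both are determined from the sum over all
pairings by the decomposition according to the component of a marked face. -/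
theorem connectedSum_eq_traceCumulant [NeZero N] (hN : 1 ≤ N) (ht : 0 < t) {p : Fin n} (B : Finset (Fin n))
    (A : Finset (Fin m)) (hp : p ∈ B) :
    connectedSum (sidePiece ℓ cell) (sideNext ℓ cell) N (stuffedPieceWeight ℓ cell N t) (Sum.inl p)
      (B.disjSum A) = traceCumulant 𝒞 n N t ℓ B (typeCount cell A) := by
  classical
  induction hs : B.card + A.card using Nat.strong_induction_on generalizing B A with
  | _ s ih =>
  set Z := pairingSum (sidePiece ℓ cell) (sideNext ℓ cell) N (stuffedPieceWeight ℓ cell N t) with hZ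
  have h1 := pairingSum_eq_sum_connectedSum (N := N) (ζ := stuffedPieceWeight ℓ cell N t)
    (sidePiece_sideNext ℓ cell) (p := Sum.inl p) (Q := B.disjSum A) (by simpa using hp)
  rw [sum_powerset_disjSum] at h1
  have h2 := traceMoment_eq_sum hN ht ℓ hp (typeCount cell A)
  have h3 : ∀ B' : Finset (Fin n), ∑ x ∈ Finset.HasAntidiagonal.antidiagonal (typeCount cell A),
      (cellChoose x : ℝ) * (traceCumulant 𝒞 n N t ℓ B' x.1 * traceMoment 𝒞 n N t ℓ (B \ B') x.2) =
      ∑ A' ∈ A.powerset, traceCumulant 𝒞 n N t ℓ B' (typeCount cell A') *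
        traceMoment 𝒞 n N t ℓ (B \ B') (typeCount cell (A \ A')) := fun B' =>
    (sum_powerset_typeCount cell A fun a b => traceCumulant 𝒞 n N t ℓ B' a *
      traceMoment 𝒞 n N t ℓ (B \ B') b).symm
  simp only [h3] at h2
  rw [← Finset.sum_product', ← pairingSum_eq_traceMoment ℓ cell hN ht, h1] at h2
  have hmem : (B, A) ∈ (B.powerset.filter (p ∈ ·)) ×ˢ A.powerset := by simp [hp]
  rw [← Finset.add_sum_erase _ _ hmem, ← Finset.add_sum_erase _ _ hmem] at h2
  have h4 : ∀ x ∈ ((B.powerset.filter (p ∈ ·)) ×ˢ A.powerset).erase (B, A),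
      connectedSum (sidePiece ℓ cell) (sideNext ℓ cell) N (stuffedPieceWeight ℓ cell N t)
        (Sum.inl p) (x.1.disjSum x.2) * Z (B.disjSum A \ x.1.disjSum x.2) =
      traceCumulant 𝒞 n N t ℓ x.1 (typeCount cell x.2) *
        traceMoment 𝒞 n N t ℓ (B \ x.1) (typeCount cell (A \ x.2)) := by
    rintro ⟨B', A'⟩ hx
    simp only [Finset.mem_erase, Finset.mem_product, Finset.mem_filter, Finset.mem_powerset] at hx
    obtain ⟨hne, ⟨hB, hpB⟩, hA⟩ := hx
    have hlt : B'.card + A'.card < s := by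
      have c1 := Finset.card_le_card hB
      have c2 := Finset.card_le_card hA
      rw [← hs]
      by_contra hcon
      have e1 := Finset.eq_of_subset_of_card_le hB (by omega)
      have e2 := Finset.eq_of_subset_of_card_le hA (by omega)
      exact hne (by rw [e1, e2])
    dsimp only
    rw [ih _ hlt B' A' hpB rfl, disjSum_sdiff, hZ, pairingSum_eq_traceMoment ℓ cell hN ht]
  rw [Finset.sum_congr rfl h4, add_left_inj] at h2
  dsimp only at h2
  rw [disjSum_sdiff, pairingSum_eq_traceMoment ℓ cell hN ht, ← pairingSum_eq_traceMoment ℓ cell hN ht,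
    Finset.sdiff_self, Finset.sdiff_self, Finset.empty_disjSum, Finset.map_empty, pairingSum_empty,
    mul_one, mul_one] at h2
  exact h2

end StuffedSides

/-! ### Counting relabellings -/

section Wreath

/-- Bijections of a disjoint union of copies of types `T c` which permute the copies by `τ` and
commute with given permutations of the `T c`. -/
theorem card_fiberwise_commuting {ι κ : Type*} [Fintype ι] (T : κ → Type*)
    (nx : ∀ c, Equiv.Perm (T c)) (c : ι → κ) (τ : Equiv.Perm ι) (hτ : ∀ i, c (τ i) = c i) :
    Nat.card {σ : Equiv.Perm (Σ i, T (c i)) // (∀ s, (σ s).1 = τ s.1) ∧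
        ∀ s, σ ⟨s.1, nx _ s.2⟩ = ⟨(σ s).1, nx _ (σ s).2⟩} =
      ∏ i, Nat.card {ρ : Equiv.Perm (T (c i)) // ∀ x, ρ (nx _ x) = nx _ (ρ x)} := by
  have h1 : ∀ i, Nat.card {ρ : Equiv.Perm (T (c i)) // ∀ x, ρ (nx _ x) = nx _ (ρ x)} =
      Nat.card {ρ : T (c i) ≃ T (c (τ i)) // ∀ x, ρ (nx _ x) = nx _ (ρ x)} := fun i => by
    rw [hτ i]
  simp only [h1]
  rw [← Nat.card_pi]
  symm
  let F : (∀ i, {ρ : T (c i) ≃ T (c (τ i)) // ∀ x, ρ (nx _ x) = nx _ (ρ x)}) →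
      {σ : Equiv.Perm (Σ i, T (c i)) // (∀ s, (σ s).1 = τ s.1) ∧
        ∀ s, σ ⟨s.1, nx _ s.2⟩ = ⟨(σ s).1, nx _ (σ s).2⟩} := fun ρ =>
    ⟨Equiv.sigmaCongr τ fun i => (ρ i).1, fun s => rfl, fun s => by
      exact congrArg (Sigma.mk (τ s.1)) ((ρ s.1).2 s.2)⟩
  refine Nat.card_congr (Equiv.ofBijective F ⟨fun ρ ρ' h => ?_, ?_⟩)
  · funext i
    refine Subtype.ext (Equiv.ext fun x => ?_)
    have := DFunLike.congr_fun (congrArg Subtype.val h) (⟨i, x⟩ : Σ i, T (c i))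
    exact eq_of_heq (Sigma.mk.inj this).2
  · rintro ⟨σ, h1, h2⟩
    have hex : ∀ i x, ∃ y, σ ⟨i, x⟩ = ⟨τ i, y⟩ := fun i x => by
      have h := h1 ⟨i, x⟩
      revert h
      generalize σ ⟨i, x⟩ = z
      rintro h
      obtain ⟨j, y⟩ := z
      subst h
      exact ⟨y, rfl⟩
    choose f hf using hex
    have hbij : ∀ i, Function.Bijective (f i) := by
      refine fun i => ⟨fun x y hxy => ?_, fun y => ?_⟩
      · have : σ ⟨i, x⟩ = σ ⟨i, y⟩ := by rw [hf, hf, hxy]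
        exact eq_of_heq (Sigma.mk.inj (σ.injective this)).2
      · obtain ⟨⟨j, x⟩, hx⟩ := σ.surjective ⟨τ i, y⟩
        have hj : τ j = τ i := by rw [← h1 ⟨j, x⟩, hx]
        obtain rfl := τ.injective hj
        exact ⟨x, eq_of_heq (Sigma.mk.inj ((hf j x).symm.trans hx)).2⟩
    refine ⟨fun i => ⟨Equiv.ofBijective (f i) (hbij i), fun x => ?_⟩, ?_⟩
    · have := h2 ⟨i, x⟩
      dsimp only at this
      rw [hf, hf] at this
      exact eq_of_heq (Sigma.mk.inj this).2
    · refine Subtype.ext (Equiv.ext ?_)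
      rintro ⟨i, x⟩
      exact (hf i x).symm

/-- The number of pairs of a type-preserving permutation of copies and a compatible bijection. -/
theorem card_wreath {ι κ : Type*} [Fintype ι] (T : κ → Type*) [∀ c, Finite (T c)]
    (nx : ∀ c, Equiv.Perm (T c)) (c : ι → κ) :
    Nat.card {g : Equiv.Perm (Σ i, T (c i)) × Equiv.Perm ι // (∀ i, c (g.2 i) = c i) ∧
        (∀ s, (g.1 s).1 = g.2 s.1) ∧
        ∀ s, g.1 ⟨s.1, nx _ s.2⟩ = ⟨(g.1 s).1, nx _ (g.1 s).2⟩} =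
      Nat.card {τ : Equiv.Perm ι // ∀ i, c (τ i) = c i} *
        ∏ i, Nat.card {ρ : Equiv.Perm (T (c i)) // ∀ x, ρ (nx _ x) = nx _ (ρ x)} := by
  have e : {g : Equiv.Perm (Σ i, T (c i)) × Equiv.Perm ι // (∀ i, c (g.2 i) = c i) ∧
        (∀ s, (g.1 s).1 = g.2 s.1) ∧
        ∀ s, g.1 ⟨s.1, nx _ s.2⟩ = ⟨(g.1 s).1, nx _ (g.1 s).2⟩} ≃
      Σ τ : {τ : Equiv.Perm ι // ∀ i, c (τ i) = c i},
        {σ : Equiv.Perm (Σ i, T (c i)) // (∀ s, (σ s).1 = τ.1 s.1) ∧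
          ∀ s, σ ⟨s.1, nx _ s.2⟩ = ⟨(σ s).1, nx _ (σ s).2⟩} :=
    { toFun := fun g => ⟨⟨g.1.2, g.2.1⟩, ⟨g.1.1, g.2.2⟩⟩
      invFun := fun x => ⟨(x.2.1, x.1.1), x.1.2, x.2.2⟩
      left_inv := fun _ => rfl
      right_inv := fun _ => rfl }
  have := Fintype.ofFinite {τ : Equiv.Perm ι // ∀ i, c (τ i) = c i}
  rw [Nat.card_congr e, Nat.card_sigma,
    Finset.sum_congr rfl fun τ _ => card_fiberwise_commuting T nx c τ.1 τ.2, Finset.sum_const,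
    Finset.card_univ, smul_eq_mul, Nat.card_eq_fintype_card]

/-- The permutations preserving a function. -/
theorem card_perm_preserving {ι κ : Type*} [Fintype ι] [DecidableEq ι] [DecidableEq κ] (c : ι → κ) :
    Nat.card {τ : Equiv.Perm ι // ∀ i, c (τ i) = c i} =
      ∏ x ∈ Finset.univ.image c, (Finset.univ.filter fun i => c i = x).card ! := by
  simp only [← Fintype.card_subtype]
  rw [← DomMulAct.stabilizer_card' c, ← Nat.card_eq_fintype_card]
  exact Nat.card_congr (Equiv.subtypeEquivRight fun τ => by simp [funext_iff])

theorem card_commuting_finRotate {l : ℕ} (hl : 1 ≤ l) :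
    Nat.card {ρ : Equiv.Perm (Fin l) // ∀ x, ρ (finRotate l x) = finRotate l (ρ x)} = l := by
  obtain ⟨k, rfl⟩ : ∃ k, l = k + 1 := ⟨l - 1, by omega⟩
  let F : {ρ : Equiv.Perm (Fin (k + 1)) //
      ∀ x, ρ (finRotate (k + 1) x) = finRotate (k + 1) (ρ x)} → Fin (k + 1) := fun ρ => ρ.1 0
  have hF : Function.Bijective F := by
    constructor
    · intro ρ ρ' h
      refine Subtype.ext (Equiv.ext fun x => ?_)
      induction x using Fin.induction with
      | zero => exact h
      | succ i ih =>
        have h1 := ρ.2 i.castSucc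
        have h2 := ρ'.2 i.castSucc
        rw [finRotate_apply, Fin.coeSucc_eq_succ] at h1 h2
        exact h1.trans ((congrArg _ ih).trans h2.symm)
    · intro x
      refine ⟨⟨Equiv.addRight x, fun y => ?_⟩, by simp [F]⟩
      simp only [finRotate_apply, Equiv.coe_addRight]
      exact add_right_comm y 1 x
  rw [Nat.card_congr (Equiv.ofBijective F hF), Nat.card_eq_fintype_card, Fintype.card_fin]

theorem eq_of_finRotate_invariant {β : Type*} {l : ℕ} (f : Fin l → β)
    (hf : ∀ x, f (finRotate l x) = f x) (x y : Fin l) : f x = f y := by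
  obtain ⟨k, rfl⟩ : ∃ k, l = k + 1 := ⟨l - 1, by have := x.2; omega⟩
  have h : ∀ x, f x = f 0 := fun x => by
    induction x using Fin.induction with
    | zero => rfl
    | succ i ih => rw [← ih, ← hf i.castSucc, finRotate_apply, Fin.coeSucc_eq_succ]
  rw [h x, h y]

/-- The number of symmetries of a disjoint union of oriented polygons. -/
theorem card_commuting_polygons {b : ℕ} (l : Fin b → ℕ) (hl : ∀ i, 1 ≤ l i) :
    Nat.card {ρ : Equiv.Perm (Σ i, Fin (l i)) //
        ∀ x, ρ ⟨x.1, finRotate _ x.2⟩ = ⟨(ρ x).1, finRotate _ (ρ x).2⟩} =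
      (∏ x ∈ Finset.univ.image l, (Finset.univ.filter fun i => l i = x).card !) * ∏ i, l i := by
  have h := card_wreath (fun l => Fin l) (fun l => finRotate l) l
  rw [card_perm_preserving, Finset.prod_congr rfl fun i _ => card_commuting_finRotate (hl i)] at h
  rw [← h]
  symm
  -- a permutation commuting with the rotations permutes the polygons
  have key : ∀ ρ : Equiv.Perm (Σ i, Fin (l i)),
      (∀ x, ρ ⟨x.1, finRotate _ x.2⟩ = ⟨(ρ x).1, finRotate _ (ρ x).2⟩) →
      ∀ i (x y : Fin (l i)), (ρ ⟨i, x⟩).1 = (ρ ⟨i, y⟩).1 := by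
    intro ρ hρ i x y
    refine eq_of_finRotate_invariant (fun x => (ρ ⟨i, x⟩).1) (fun x => ?_) x y
    have h := congrArg Sigma.fst (hρ ⟨i, x⟩)
    exact h
  let F : {g : Equiv.Perm (Σ i, Fin (l i)) × Equiv.Perm (Fin b) // (∀ i, l (g.2 i) = l i) ∧
        (∀ s, (g.1 s).1 = g.2 s.1) ∧
        ∀ s, g.1 ⟨s.1, finRotate _ s.2⟩ = ⟨(g.1 s).1, finRotate _ (g.1 s).2⟩} →
      {ρ : Equiv.Perm (Σ i, Fin (l i)) //
        ∀ x, ρ ⟨x.1, finRotate _ x.2⟩ = ⟨(ρ x).1, finRotate _ (ρ x).2⟩} :=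
    fun g => ⟨g.1.1, g.2.2.2⟩
  refine Nat.card_congr (Equiv.ofBijective F ⟨?_, ?_⟩)
  · rintro ⟨⟨ρ, τ⟩, h1, h2, h3⟩ ⟨⟨ρ', τ'⟩, h1', h2', h3'⟩ h
    obtain rfl : ρ = ρ' := congrArg Subtype.val h
    have : τ = τ' := Equiv.ext fun i =>
      (h2 ⟨i, ⟨0, hl i⟩⟩).symm.trans (h2' ⟨i, ⟨0, hl i⟩⟩)
    subst this
    rfl
  · rintro ⟨ρ, hρ⟩
    have hρ' : ∀ x, ρ.symm ⟨x.1, finRotate _ x.2⟩ = ⟨(ρ.symm x).1, finRotate _ (ρ.symm x).2⟩ := by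
      intro x
      rw [Equiv.symm_apply_eq, hρ, Equiv.apply_symm_apply]
    have k1 := key ρ hρ
    have k2 := key ρ.symm hρ'
    let τ : Equiv.Perm (Fin b) :=
      { toFun := fun i => (ρ ⟨i, ⟨0, hl i⟩⟩).1
        invFun := fun i => (ρ.symm ⟨i, ⟨0, hl i⟩⟩).1
        left_inv := fun i => by
          have := k2 _ ⟨0, hl _⟩ (ρ ⟨i, ⟨0, hl i⟩⟩).2
          dsimp only
          rw [this, Sigma.eta, Equiv.symm_apply_apply]
        right_inv := fun i => by
          have := k1 _ ⟨0, hl _⟩ (ρ.symm ⟨i, ⟨0, hl i⟩⟩).2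
          dsimp only
          rw [this, Sigma.eta, Equiv.apply_symm_apply] }
    have hτ : ∀ s, (ρ s).1 = τ s.1 := fun s => k1 _ _ _
    have hle : ∀ (ρ : Equiv.Perm (Σ i, Fin (l i))) (i j : Fin b), (∀ x, (ρ ⟨i, x⟩).1 = j) →
        l i ≤ l j := by
      intro ρ i j h
      have hinj : Function.Injective fun x : Fin (l i) => (h x ▸ (ρ ⟨i, x⟩).2 : Fin (l j)) := by
        intro x y hxy
        have h' : ∀ x, ρ ⟨i, x⟩ = ⟨j, (h x ▸ (ρ ⟨i, x⟩).2 : Fin (l j))⟩ := fun x => by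
          generalize_proofs hp
          revert hp
          generalize ρ ⟨i, x⟩ = z
          rintro rfl
          rfl
        have := (h' x).trans ((congrArg (Sigma.mk j) hxy).trans (h' y).symm)
        exact eq_of_heq (Sigma.mk.inj (ρ.injective this)).2
      simpa using Fintype.card_le_of_injective _ hinj
    refine ⟨⟨(ρ, τ), fun i => ?_, hτ, hρ⟩, rfl⟩
    refine le_antisymm (hle ρ.symm _ _ fun x => ?_) (hle ρ _ _ fun x => hτ ⟨i, x⟩)
    have : τ (ρ.symm ⟨τ i, x⟩).1 = τ i := by rw [← hτ, Equiv.apply_symm_apply]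
    exact τ.injective this

end Wreath

/-! ### Isomorphism classes of stuffed maps with given pieces -/

namespace ElemCell

/-- The number of symmetries of the boundary of a 2-cell. -/
def symmetries (C : ElemCell) : ℕ :=
  (∏ x ∈ C.perims.toFinset, (C.perims.count x)!) * C.perims.prod

theorem symmetries_pos (C : ElemCell) : 0 < C.symmetries :=
  Nat.mul_pos (Finset.prod_pos fun _ _ => Nat.factorial_pos _)
    (List.prod_pos fun l hl => C.perims_pos l hl)

theorem orderings_mul_symmetries (C : ElemCell) :
    C.orderings * C.symmetries = (C.bdry ! : ℚ) * (C.perims.prod : ℚ) := by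
  have h : (∏ x ∈ C.perims.toFinset, ((C.perims.count x)! : ℚ)) ≠ 0 :=
    Finset.prod_ne_zero_iff.2 fun _ _ => Nat.cast_ne_zero.2 (Nat.factorial_ne_zero _)
  rw [orderings, symmetries]
  push_cast
  field_simp

theorem card_symmetries (C : ElemCell) :
    Nat.card {ρ : Equiv.Perm (Σ b : Fin C.perims.length, Fin (C.perims.get b)) //
      ∀ x, ρ ⟨x.1, finRotate _ x.2⟩ = ⟨(ρ x).1, finRotate _ (ρ x).2⟩} = C.symmetries := by
  rw [card_commuting_polygons _ fun i => C.perims_pos _ (C.perims.get_mem i), symmetries]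
  congr 1
  · refine Finset.prod_congr ?_ fun x _ => ?_
    · ext x
      simp [List.mem_iff_get]
    · congr 1
      rw [Finset.card_filter]
      refine (Fin.sum_univ_fun_getElem C.perims fun y => if y = x then 1 else 0).trans ?_
      induction C.perims with
      | nil => rfl
      | cons a l ih => rw [List.map_cons, List.sum_cons, ih, List.count_cons, add_comm]; simp
  · rw [Fin.prod_univ_def]
    simp

end ElemCell

namespace StuffedMap

variable {𝒞 : Finset ElemCell} {n m : ℕ} {ℓ : Fin n → ℕ}

/-- The numbers of unmarked pieces of each type. -/
noncomputable def cellCount (M : StuffedMap 𝒞 ℓ) : 𝒞 →₀ ℕ := typeCount M.cell Finset.univ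

/-- The stuffed map obtained from given pieces by a fixed-point free involution of their sides. -/
def ofPairing (ℓ : Fin n → ℕ) (cell : Fin m → 𝒞)
    (α : {α // α ∈ pairings (Finset.univ : Finset (StuffedSide ℓ cell))}) : StuffedMap 𝒞 ℓ where
  numCells := m
  cell := cell
  glue := α.1
  glue_glue := (mem_pairings.1 α.2).1
  glue_ne s := ((mem_pairings.1 α.2).2 s).2 (Finset.mem_univ s)

/-- A relabelling of given pieces: a bijection of the sides and of the unmarked pieces which
preserves types and boundary polygons and fixes the sides of the marked faces. -/
abbrev Relabelling (ℓ : Fin n → ℕ) (cell : Fin m → 𝒞) : Type :=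
  {g : Equiv.Perm (StuffedSide ℓ cell) × Equiv.Perm (Fin m) // (∀ i, cell (g.2 i) = cell i) ∧
    (∀ s, sidePiece ℓ cell (g.1 s) = Sum.map id g.2 (sidePiece ℓ cell s)) ∧
    (∀ s, g.1 (sideNext ℓ cell s) = sideNext ℓ cell (g.1 s)) ∧ ∀ s, g.1 (Sum.inl s) = Sum.inl s}

/-- Isomorphisms between two gluings of the same pieces are relabellings intertwining them. -/
def isoEquiv (cell : Fin m → 𝒞)
    (α β : {α // α ∈ pairings (Finset.univ : Finset (StuffedSide ℓ cell))}) :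
    Iso (ofPairing ℓ cell α) (ofPairing ℓ cell β) ≃
      {g : Relabelling ℓ cell // ∀ s, g.1.1 (α.1 s) = β.1 (g.1.1 s)} where
  toFun e := ⟨⟨(e.side, e.onCells), e.cell_eq, e.piece_eq, e.next_eq, e.marked_eq⟩, e.glue_eq⟩
  invFun g := ⟨g.1.1.1, g.1.1.2, g.1.2.1, g.1.2.2.1, g.1.2.2.2.1, g.2, g.1.2.2.2.2⟩
  left_inv _ := rfl
  right_inv _ := rfl

instance (cell : Fin m → 𝒞) : Finite (Relabelling ℓ cell) := Subtype.finite

theorem card_iso_ne_zero (cell : Fin m → 𝒞)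
    (α : {α // α ∈ pairings (Finset.univ : Finset (StuffedSide ℓ cell))}) :
    Nat.card (Iso (ofPairing ℓ cell α) (ofPairing ℓ cell α)) ≠ 0 := by
  have : Finite (Iso (ofPairing ℓ cell α) (ofPairing ℓ cell α)) :=
    Finite.of_equiv _ (isoEquiv cell α α).symm
  have : Nonempty (Iso (ofPairing ℓ cell α) (ofPairing ℓ cell α)) := ⟨Iso.refl _⟩
  exact Nat.card_pos.ne'

theorem Iso.card_aut {M M' : StuffedMap 𝒞 ℓ} (e : Iso M M') :
    Nat.card (Iso M M) = Nat.card (Iso M' M') := by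
  refine Nat.card_congr ⟨fun f => (e.symm.trans f).trans e, fun f => (e.trans f).trans e.symm,
    fun f => ?_, fun f => ?_⟩
  · ext <;> simp [Iso.trans, Iso.symm]
  · ext <;> simp [Iso.trans, Iso.symm]

/-- Every relabelling carries a given gluing to exactly one gluing. -/
theorem sum_card_iso (cell : Fin m → 𝒞)
    (α : {α // α ∈ pairings (Finset.univ : Finset (StuffedSide ℓ cell))}) :
    ∑ β, Nat.card (Iso (ofPairing ℓ cell α) (ofPairing ℓ cell β)) =
      Nat.card (Relabelling ℓ cell) := by
  rw [Finset.sum_congr rfl fun β _ => Nat.card_congr (isoEquiv cell α β), ← Nat.card_sigma]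
  refine Nat.card_congr (Equiv.ofBijective (fun x => x.2.1) ⟨?_, fun g => ?_⟩)
  · rintro ⟨β, g, hg⟩ ⟨β', g', hg'⟩ h
    obtain rfl : g = g' := h
    have : β = β' := Subtype.ext (Equiv.ext fun s => by
      have h1 := hg (g.1.1.symm s)
      have h2 := hg' (g.1.1.symm s)
      rw [Equiv.apply_symm_apply] at h1 h2
      rw [← h1, h2])
    subst this
    rfl
  · refine ⟨⟨⟨(g.1.1.symm.trans α.1).trans g.1.1, mem_pairings.2 ⟨fun s => ?_, fun s => ?_⟩⟩, g,
      fun s => ?_⟩, rfl⟩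
    · simp [(mem_pairings.1 α.2).1]
    · simp only [Equiv.trans_apply, Finset.mem_univ, iff_true]
      rw [Ne, ← Equiv.eq_symm_apply]
      exact ((mem_pairings.1 α.2).2 _).2 (Finset.mem_univ _)
    · simp

theorem card_filter_eq_typeCount [DecidableEq 𝒞] (cell : Fin m → 𝒞) (C : 𝒞) :
    (Finset.univ.filter fun i => cell i = C).card = typeCount cell Finset.univ C := by
  rw [typeCount, Finsupp.finsetSum_apply, Finset.card_filter]
  refine Finset.sum_congr rfl fun i _ => ?_
  rw [Finsupp.single_apply]

/-- The number of relabellings. -/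
theorem card_relabelling (cell : Fin m → 𝒞) : Nat.card (Relabelling ℓ cell) =
    ∏ C, ((typeCount cell Finset.univ C)! * C.1.symmetries ^ typeCount cell Finset.univ C) := by
  classical
  have h := card_wreath
    (fun C : 𝒞 => Σ b : Fin C.1.perims.length, Fin (C.1.perims.get b))
    (fun C => Equiv.sigmaCongrRight fun _ => finRotate _) cell
  have h1 : ∀ i, Nat.card {ρ : Equiv.Perm (Σ b : Fin (cell i).1.perims.length,
      Fin ((cell i).1.perims.get b)) // ∀ x, ρ ((Equiv.sigmaCongrRight fun _ => finRotate _) x) =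
        (Equiv.sigmaCongrRight fun _ => finRotate _) (ρ x)} = (cell i).1.symmetries :=
    fun i => (cell i).1.card_symmetries
  rw [Finset.prod_congr rfl fun i _ => h1 i,
    ← prod_pow_typeCount cell Finset.univ fun C => C.1.symmetries, card_perm_preserving] at h
  have h2 : ∏ x ∈ Finset.univ.image cell, (Finset.univ.filter fun i => cell i = x).card ! =
      ∏ C, (typeCount cell Finset.univ C)! := by
    simp only [card_filter_eq_typeCount]
    refine Finset.prod_subset (Finset.subset_univ _) fun C _ hC => ?_
    rw [← card_filter_eq_typeCount, Finset.filter_false_of_mem, Finset.card_empty, Nat.factorial_zero]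
    intro i _ hi
    exact hC (Finset.mem_image.2 ⟨i, Finset.mem_univ _, hi⟩)
  rw [Finset.prod_mul_distrib, ← h2, ← h]
  symm
  let F : {g : Equiv.Perm (Σ i, Σ b : Fin (cell i).1.perims.length,
      Fin ((cell i).1.perims.get b)) × Equiv.Perm (Fin m) // (∀ i, cell (g.2 i) = cell i) ∧
        (∀ s, (g.1 s).1 = g.2 s.1) ∧
        ∀ s, g.1 ⟨s.1, (Equiv.sigmaCongrRight fun _ => finRotate _) s.2⟩ =
          ⟨(g.1 s).1, (Equiv.sigmaCongrRight fun _ => finRotate _) (g.1 s).2⟩} →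
      Relabelling ℓ cell := fun g =>
    ⟨(Equiv.sumCongr (Equiv.refl _) g.1.1, g.1.2), g.2.1, by
      rintro (s | s)
      · rfl
      · exact congrArg Sum.inr (g.2.2.1 s), by
      rintro (s | s)
      · rfl
      · exact congrArg Sum.inr (g.2.2.2 s), fun s => rfl⟩
  refine Nat.card_congr (Equiv.ofBijective F ⟨?_, ?_⟩)
  · rintro ⟨⟨ρ, τ⟩, hg⟩ ⟨⟨ρ', τ'⟩, hg'⟩ h
    have h1 := congrArg Subtype.val h
    obtain rfl : τ = τ' := congrArg Prod.snd h1
    have : ρ = ρ' := Equiv.ext fun s =>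
      Sum.inr_injective (DFunLike.congr_fun (congrArg Prod.fst h1) (Sum.inr s))
    subst this
    rfl
  · rintro ⟨⟨σ, τ⟩, h1, h2, h3, h4⟩
    obtain ⟨⟨a, ρ⟩, hρ⟩ := Equiv.Perm.mem_sumCongrHom_range_of_perm_mapsTo_inl (σ := σ) (by
      rintro _ ⟨s, rfl⟩
      exact ⟨s, (h4 s).symm⟩)
    have ha : a = Equiv.refl _ := Equiv.ext fun s => Sum.inl_injective (by
      have := h4 s
      dsimp only at this
      rw [← hρ] at this
      exact this)
    subst ha
    have hσ : σ = Equiv.sumCongr (Equiv.refl _) ρ := hρ.symm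
    subst hσ
    refine ⟨⟨(ρ, τ), h1, fun s => Sum.inr_injective (h2 (Sum.inr s)),
      fun s => Sum.inr_injective (h3 (Sum.inr s))⟩, rfl⟩

theorem Iso.cellCount_eq {M M' : StuffedMap 𝒞 ℓ} (e : Iso M M') : M.cellCount = M'.cellCount := by
  rw [cellCount, cellCount, typeCount, typeCount]
  exact Fintype.sum_equiv e.onCells _ _ fun i => by rw [e.cell_eq]

/-- Every stuffed map is isomorphic to a gluing of any given pieces with the right numbers of
types. -/
theorem exists_iso_ofPairing (cell : Fin m → 𝒞) (M : StuffedMap 𝒞 ℓ)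
    (hM : M.cellCount = typeCount cell Finset.univ) :
    ∃ α, Nonempty (Iso M (ofPairing ℓ cell α)) := by
  classical
  obtain ⟨k, cell', glue, h1, h2⟩ := M
  have he : ∃ e : Fin k ≃ Fin m, cell ∘ e = cell' := by
    have hc : ∀ C, Nonempty ({i // cell' i = C} ≃ {i // cell i = C}) := fun C => by
      refine Fintype.card_eq.1 ?_
      rw [Fintype.card_subtype, Fintype.card_subtype, card_filter_eq_typeCount,
        card_filter_eq_typeCount, ← hM]
      rfl
    have f := fun C => (hc C).some
    refine ⟨((Equiv.sigmaFiberEquiv cell').symm.trans (Equiv.sigmaCongrRight f)).trans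
      (Equiv.sigmaFiberEquiv cell), funext fun i => ?_⟩
    exact (f (cell' i) ⟨i, rfl⟩).2
  obtain ⟨e, rfl⟩ := he
  let E : StuffedSide ℓ (cell ∘ e) ≃ StuffedSide ℓ cell :=
    Equiv.sumCongr (Equiv.refl _) (Equiv.sigmaCongrLeft
      (β := fun i => Σ b : Fin (cell i).1.perims.length, Fin ((cell i).1.perims.get b)) e)
  refine ⟨⟨(E.symm.trans glue).trans E, mem_pairings.2 ⟨fun s => ?_, fun s => ?_⟩⟩,
    ⟨⟨E, e, fun i => rfl, ?_, ?_, fun s => ?_, fun s => rfl⟩⟩⟩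
  · simp [h1]
  · simp only [Equiv.trans_apply, Finset.mem_univ, iff_true]
    rw [Ne, ← Equiv.eq_symm_apply]
    exact h2 _
  · rintro (⟨j, s⟩ | ⟨i, b, s⟩) <;> rfl
  · rintro (⟨j, s⟩ | ⟨i, b, s⟩) <;> rfl
  · change E (glue s) = E (glue (E.symm (E s)))
    rw [Equiv.symm_apply_apply]

open Classical in
/-- The isomorphism classes of the gluings of given pieces. -/
noncomputable def gluingClasses (ℓ : Fin n → ℕ) (cell : Fin m → 𝒞) :
    Finset (Quotient (isoSetoid 𝒞 ℓ)) :=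
  Finset.univ.image fun α => Quotient.mk (isoSetoid 𝒞 ℓ) (ofPairing ℓ cell α)

theorem mem_gluingClasses (cell : Fin m → 𝒞) (q : Quotient (isoSetoid 𝒞 ℓ)) :
    q ∈ gluingClasses ℓ cell ↔ q.out.cellCount = typeCount cell Finset.univ := by
  classical
  rw [gluingClasses, Finset.mem_image]
  constructor
  · rintro ⟨α, -, rfl⟩
    obtain ⟨e⟩ := Quotient.mk_out (s := isoSetoid 𝒞 ℓ) (ofPairing ℓ cell α)
    exact e.cellCount_eq
  · intro h
    obtain ⟨α, ⟨e⟩⟩ := exists_iso_ofPairing cell q.out h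
    refine ⟨α, Finset.mem_univ _, ?_⟩
    rw [← Quotient.out_eq q]
    exact Quotient.sound ⟨e.symm⟩

/-- The sum over isomorphism classes weighted by the inverse orders of the automorphism groups is
the average over the labelled gluings. -/
theorem sum_gluingClasses (cell : Fin m → 𝒞) (f : StuffedMap 𝒞 ℓ → ℝ)
    (hf : ∀ M M', Iso M M' → f M = f M') :
    ∑ q ∈ gluingClasses ℓ cell, f q.out / Nat.card (Iso q.out q.out) =
      (∑ α, f (ofPairing ℓ cell α)) / Nat.card (Relabelling ℓ cell) := by
  classical
  have hG : (Nat.card (Relabelling ℓ cell) : ℝ) ≠ 0 := by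
    have : Nonempty (Relabelling ℓ cell) := ⟨⟨1, by simp⟩⟩
    exact Nat.cast_ne_zero.2 Nat.card_pos.ne'
  rw [eq_div_iff hG, Finset.sum_mul,
    ← Finset.sum_fiberwise_of_maps_to (t := gluingClasses ℓ cell)
      (g := fun α => Quotient.mk (isoSetoid 𝒞 ℓ) (ofPairing ℓ cell α))
      (fun α _ => by
        rw [gluingClasses]
        exact Finset.mem_image.2 ⟨α, Finset.mem_univ _, rfl⟩)]
  refine Finset.sum_congr rfl fun q hq => ?_
  obtain ⟨α, -, rfl⟩ := Finset.mem_image.1 (by rw [gluingClasses] at hq; exact hq)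
  set q : Quotient (isoSetoid 𝒞 ℓ) := Quotient.mk (isoSetoid 𝒞 ℓ) (ofPairing ℓ cell α) with hq
  obtain ⟨e⟩ : Nonempty (Iso q.out (ofPairing ℓ cell α)) := Quotient.mk_out (s := isoSetoid 𝒞 ℓ) _
  have h1 : ∀ β ∈ Finset.univ.filter (fun β => Quotient.mk (isoSetoid 𝒞 ℓ) (ofPairing ℓ cell β) = q),
      f (ofPairing ℓ cell β) = f q.out := by
    intro β hβ
    obtain ⟨e'⟩ := Quotient.exact (Finset.mem_filter.1 hβ).2
    exact (hf _ _ e').trans (hf _ _ e).symm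
  rw [Finset.sum_congr rfl h1, Finset.sum_const, nsmul_eq_mul]
  have h2 : Nat.card (Relabelling ℓ cell) = (Finset.univ.filter (fun β =>
      Quotient.mk (isoSetoid 𝒞 ℓ) (ofPairing ℓ cell β) = q)).card * Nat.card (Iso q.out q.out) := by
    rw [← sum_card_iso cell α, Finset.card_eq_sum_ones, Finset.sum_mul, Finset.sum_filter]
    refine Finset.sum_congr rfl fun β _ => ?_
    split_ifs with hβ
    · obtain ⟨e'⟩ := Quotient.exact hβ
      rw [one_mul, e.card_aut]
      exact Nat.card_congr ⟨fun x => x.trans e', fun x => x.trans e'.symm,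
        fun x => Iso.ext (Equiv.ext fun _ => e'.side.symm_apply_apply _)
          (Equiv.ext fun _ => e'.onCells.symm_apply_apply _),
        fun x => Iso.ext (Equiv.ext fun _ => e'.side.apply_symm_apply _)
          (Equiv.ext fun _ => e'.onCells.apply_symm_apply _)⟩
    · have : IsEmpty (Iso (ofPairing ℓ cell α) (ofPairing ℓ cell β)) :=
        ⟨fun x => hβ (Quotient.sound ⟨x.symm⟩)⟩
      rw [Nat.card_of_isEmpty]
  have h3 : (Nat.card (Iso q.out q.out) : ℝ) ≠ 0 := by
    rw [e.card_aut]
    exact Nat.cast_ne_zero.2 (card_iso_ne_zero cell α)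
  rw [h2]
  push_cast
  field_simp

end StuffedMap

/-! ### Coefficients of the connected correlators as sums over gluings -/

theorem exists_typeCount_eq {β : Type*} [Fintype β] (k : β →₀ ℕ) :
    ∃ (m : ℕ) (cell : Fin m → β), typeCount cell Finset.univ = k := by
  classical
  let e := Fintype.equivFin (Σ b : β, Fin (k b))
  refine ⟨_, fun i => (e.symm i).1, ?_⟩
  ext b
  rw [typeCount, Finsupp.finsetSum_apply, e.symm.sum_comp (fun x => Finsupp.single x.1 1 b),
    Fintype.sum_sigma]
  simp [Finsupp.single_apply]

theorem prod_zpow_eq_zpow_sum {ι : Type*} {s : Finset ι} {a : ℝ} (ha : a ≠ 0) (f : ι → ℤ) :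
    ∏ i ∈ s, a ^ f i = a ^ ∑ i ∈ s, f i := by
  classical
  induction s using Finset.induction_on with
  | empty => simp
  | insert i s hi ih => rw [Finset.prod_insert hi, Finset.sum_insert hi, ih, zpow_add₀ ha]

namespace StuffedMap

variable {𝒞 : Finset ElemCell} {n m : ℕ} {ℓ : Fin n → ℕ}

/-- Connectedness through sets of pieces that are closed under the gluing: the component of a piece is
the smallest such set that contains it. -/
theorem isConnected_iff (M : StuffedMap 𝒞 ℓ) (p : Fin n ⊕ Fin M.numCells) :
    M.IsConnected ↔ ∀ U : Finset (Fin n ⊕ Fin M.numCells), p ∈ U →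
      (∀ s, M.piece s ∈ U → M.piece (M.glue s) ∈ U) → U = Finset.univ := by
  classical
  constructor
  · intro h U hp hU
    refine Finset.eq_univ_of_forall fun q => ?_
    obtain ⟨w⟩ := h.preconnected p q
    induction w with
    | nil => exact hp
    | cons hadj _ ih =>
      refine ih ?_
      rw [SimpleGraph.fromRel_adj] at hadj
      obtain ⟨-, ⟨s, rfl, rfl⟩ | ⟨s, rfl, rfl⟩⟩ := hadj
      · exact hU s hp
      · have := hU _ hp
        rwa [M.glue_glue] at this
  · intro h
    set G := SimpleGraph.fromRel fun p q => ∃ s, M.piece s = p ∧ M.piece (M.glue s) = q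
    have hr : ∀ q, G.Reachable p q := by
      have := h (Finset.univ.filter fun q => G.Reachable p q) (by simp) (fun s hs => by
        simp only [Finset.mem_filter, Finset.mem_univ, true_and] at hs ⊢
        by_cases he : M.piece s = M.piece (M.glue s)
        · rwa [← he]
        · refine hs.trans (SimpleGraph.Adj.reachable ?_)
          rw [SimpleGraph.fromRel_adj]
          exact ⟨he, Or.inl ⟨s, rfl, rfl⟩⟩)
      intro q
      have hq := Finset.mem_univ q
      rw [← this] at hq
      exact (Finset.mem_filter.1 hq).2
    exact { preconnected := fun a b => (hr a).symm.trans (hr b), nonempty := ⟨p⟩ }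

theorem isConnected_ofPairing (cell : Fin m → 𝒞)
    (α : {α // α ∈ pairings (Finset.univ : Finset (StuffedSide ℓ cell))}) (p : Fin n) :
    (ofPairing ℓ cell α).IsConnected ↔
      ConnectedFrom (sidePiece ℓ cell) (Sum.inl p) Finset.univ α.1 := by
  rw [isConnected_iff _ (Sum.inl p)]
  exact ⟨fun h U _ hp hU => h U hp hU, fun h U hp hU => h U (Finset.subset_univ _) hp hU⟩

theorem two_mul_numEdges (M : StuffedMap 𝒞 ℓ) : 2 * M.numEdges = Fintype.card M.Side :=
  Equiv.Perm.two_mul_numCycles_of_involution M.glue_glue M.glue_ne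

/-- Only marked faces can have perimeter `0`. -/
theorem prod_polygons_eq {N : ℕ} (cell : Fin m → 𝒞) :
    ∏ p, (if polyLen ℓ cell p = 0 then (N : ℝ) else 1) = (N : ℝ) ^ Nat.card {j : Fin n // ℓ j = 0} := by
  rw [Fintype.prod_sum_type]
  have h1 : ∀ b : Σ i : Fin m, Fin (cell i).1.perims.length,
      (if polyLen ℓ cell (Sum.inr b) = 0 then (N : ℝ) else 1) = 1 := fun b => by
    have := (cell b.1).1.perims_pos _ ((cell b.1).1.perims.get_mem b.2)
    rw [if_neg]
    change (cell b.1).1.perims.get b.2 ≠ 0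
    omega
  rw [Finset.prod_congr rfl fun b _ => h1 b, Finset.prod_const_one, mul_one, Finset.prod_ite,
    Finset.prod_const, Finset.prod_const_one, mul_one, Nat.card_eq_fintype_card,
    Fintype.card_subtype]
  rfl

/-- The weight of a gluing of all pieces: the colourings are the functions on the set of cycles of
`next * glue`, and a marked face of perimeter `0` is a trace of `H ^ 0 = 1`, equal to `N`. -/
theorem pairingWeight_univ {N : ℕ} [NeZero N] {t : ℝ} (ht : 0 < t) (cell : Fin m → 𝒞)
    (α : {α // α ∈ pairings (Finset.univ : Finset (StuffedSide ℓ cell))}) :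
    pairingWeight (sidePiece ℓ cell) (sideNext ℓ cell) N (stuffedPieceWeight ℓ cell N t)
      Finset.univ α.1 =
      (t / N) ^ (ofPairing ℓ cell α).numEdges * (N : ℝ) ^ (ofPairing ℓ cell α).numVertices := by
  have h1 : (colorings (sidePiece ℓ cell) (sideNext ℓ cell) N Finset.univ α.1).card =
      N ^ (sideNext ℓ cell * α.1).numCycles := by
    have e : {i // i ∈ colorings (sidePiece ℓ cell) (sideNext ℓ cell) N Finset.univ α.1} ≃
        {f : StuffedSide ℓ cell → Fin N // ∀ x, f ((sideNext ℓ cell * α.1) x) = f x} :=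
      Equiv.subtypeEquivRight fun i => by
        rw [mem_colorings]
        exact ⟨fun h s => (h.1 s (Finset.mem_univ _)).symm,
          fun h => ⟨fun s _ => (h s).symm, fun s hs => absurd (Finset.mem_univ _) hs⟩⟩
    rw [← Fintype.card_coe, ← Nat.card_eq_fintype_card,
      Nat.card_congr (e.trans (Equiv.Perm.invariantEquiv _ _)), Nat.card_fun, Nat.card_fin]
    rfl
  have h2 : (sidesOf (sidePiece ℓ cell) Finset.univ).card = 2 * (ofPairing ℓ cell α).numEdges := by
    rw [two_mul_numEdges, sidesOf]
    simp only [Finset.mem_univ, Finset.filter_true]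
    rfl
  rw [pairingWeight, h1, stuffedPieceWeight, prod_pieceWeight, h2, pow_mul,
    Real.sq_sqrt (by positivity)]
  simp only [Finset.mem_univ, Finset.filter_true]
  rw [prod_polygons_eq, mul_assoc]
  congr 1
  have h3 : (ofPairing ℓ cell α).numVertices =
      Nat.card {j : Fin n // ℓ j = 0} + (sideNext ℓ cell * α.1).numCycles := add_comm _ _
  rw [h3, pow_add]
  push_cast
  rfl

/-- The numerical factors of the matrix model in terms of the weights `1 / orderings` of the unmarked
pieces and of the number of relabellings. -/
theorem cellNorm_eq {N : ℕ} {t : ℝ} (cell : Fin m → 𝒞) :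
    cellNorm 𝒞 N t (typeCount cell Finset.univ) =
      (∏ i, (((N : ℝ) / t) ^ (cell i).1.euler * (1 / (cell i).1.orderings : ℚ))) /
        Nat.card (Relabelling ℓ cell) := by
  rw [← prod_pow_typeCount cell Finset.univ
    fun C => ((N : ℝ) / t) ^ C.1.euler * ((1 / C.1.orderings : ℚ) : ℝ), card_relabelling, cellNorm]
  push_cast
  rw [← Finset.prod_div_distrib]
  refine Finset.prod_congr rfl fun C _ => ?_
  have h1 : (C.1.symmetries : ℝ) ≠ 0 := by exact_mod_cast C.1.symmetries_pos.ne'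
  have h2 : (C.1.orderings : ℝ) * C.1.symmetries = (C.1.bdry ! : ℝ) * (C.1.perims.prod : ℝ) := by
    have h := congrArg (fun x : ℚ => (x : ℝ)) C.1.orderings_mul_symmetries
    simpa only [Rat.cast_mul, Rat.cast_natCast] using h
  have h3 : C.1.vertexFactor N t =
      ((N : ℝ) / t) ^ C.1.euler / ((C.1.bdry ! : ℝ) * (C.1.perims.prod : ℝ)) := by
    rw [ElemCell.vertexFactor]
    have : (C.1.perims.map fun l : ℕ => (l : ℝ)⁻¹).prod = ((C.1.perims.prod : ℕ) : ℝ)⁻¹ := by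
      induction C.1.perims with
      | nil => simp
      | cons a l ih => simp [ih, mul_comm]
    rw [this, div_mul_eq_div_div, ← div_eq_mul_inv]
  have h4 : (C.1.bdry ! : ℝ) * (C.1.perims.prod : ℝ) ≠ 0 := by
    refine mul_ne_zero (by exact_mod_cast C.1.bdry.factorial_ne_zero) ?_
    exact_mod_cast (List.prod_pos fun l hl => C.1.perims_pos l hl).ne'
  have h5 : (C.1.orderings : ℝ) ≠ 0 := fun h => h4 (by rw [← h2, h, zero_mul])
  rw [h3, ← h2]
  field_simp
  rw [← mul_pow]
  field_simp

/-- The coefficients of the connected correlators: a sum over the gluings of labelled pieces for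
which the surface is connected. -/
theorem coeff_connectedCorr {N : ℕ} {t : ℝ} (hN : 1 ≤ N) (ht : 0 < t) (hn : 1 ≤ n)
    (cell : Fin m → 𝒞) :
    MvPowerSeries.coeff (Finsupp.sumElim (faceExp ℓ Finset.univ) (typeCount cell Finset.univ))
      (connectedCorr 𝒞 n N t) =
      (∏ i, ((1 / (cell i).1.orderings : ℚ) : ℝ)) / Nat.card (Relabelling ℓ cell) *
        ∑ α, open Classical in (if (ofPairing ℓ cell α).IsConnected then
          ((N : ℝ) / t) ^ ((ofPairing ℓ cell α).euler - n) * t ^ (ofPairing ℓ cell α).numVertices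
        else 0) := by
  classical
  have : NeZero N := ⟨by omega⟩
  have hNt : (N : ℝ) / t ≠ 0 := by positivity
  have h1 := connectedSum_eq_traceCumulant ℓ cell hN ht (p := ⟨0, hn⟩) Finset.univ Finset.univ
    (Finset.mem_univ _)
  rw [Finset.univ_disjSum_univ, traceCumulant, eq_div_iff (cellNorm_ne_zero 𝒞 hN ht _)] at h1
  have hs : sidesOf (sidePiece ℓ cell) Finset.univ = Finset.univ := by ext; simp [mem_sidesOf]
  rw [connectedCorr_eq_jointCumulant, ← h1, connectedSum, hs, Finset.sum_filter,
    ← Finset.sum_coe_sort, cellNorm_eq (ℓ := ℓ), Finset.prod_mul_distrib, mul_div_assoc, mul_comm,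
    mul_right_comm, mul_comm, Finset.mul_sum]
  congr 1
  refine Finset.sum_congr rfl fun α _ => ?_
  rw [mul_ite, mul_zero]
  refine if_congr (isConnected_ofPairing cell α _).symm ?_ rfl
  rw [pairingWeight_univ ht]
  have he : (ofPairing ℓ cell α).euler - n = (∑ i, (cell i).1.euler) +
      ((ofPairing ℓ cell α).numVertices - (ofPairing ℓ cell α).numEdges : ℤ) := by
    rw [euler]
    change _ - _ + _ + ∑ i, (cell i).1.euler - _ = _
    ring
  have hV : ((N : ℝ) / t) ^ (ofPairing ℓ cell α).numVertices * t ^ (ofPairing ℓ cell α).numVertices =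
      (N : ℝ) ^ (ofPairing ℓ cell α).numVertices := by
    rw [← mul_pow, div_mul_cancel₀ _ ht.ne']
  rw [he, zpow_add₀ hNt, zpow_sub₀ hNt, ← prod_zpow_eq_zpow_sum hNt, mul_assoc, zpow_natCast,
    zpow_natCast, ← hV, ← inv_div (N : ℝ) t, inv_pow]
  generalize (N : ℝ) / t = a
  ring

end StuffedMap

/-! ### The genus of a connected stuffed map -/

namespace ElemCell

theorem bdry_pos (C : ElemCell) : 0 < C.bdry := List.length_pos_iff.2 C.perims_ne_nil

end ElemCell

section Polygons

variable {𝒞 : Finset ElemCell} {n m : ℕ} {ℓ : Fin n → ℕ} {cell : Fin m → 𝒞}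

theorem polyLen_inr_pos (b : Σ i : Fin m, Fin (cell i).1.perims.length) :
    0 < polyLen ℓ cell (Sum.inr b) :=
  (cell b.1).1.perims_pos _ ((cell b.1).1.perims.get_mem b.2)

/-- A function of the sides which is invariant under rotations depends only on the polygon. -/
theorem eq_of_sideNext_invariant {β : Type*} {f : StuffedSide ℓ cell → β}
    (hf : ∀ s, f (sideNext ℓ cell s) = f s) {s s' : StuffedSide ℓ cell}
    (h : (sideEquiv ℓ cell s).1 = (sideEquiv ℓ cell s').1) : f s = f s' := by
  have h1 : ∀ p (x y : Fin (polyLen ℓ cell p)),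
      f ((sideEquiv ℓ cell).symm ⟨p, x⟩) = f ((sideEquiv ℓ cell).symm ⟨p, y⟩) := fun p x y => by
    refine eq_of_finRotate_invariant (fun x => f ((sideEquiv ℓ cell).symm ⟨p, x⟩)) (fun x => ?_) x y
    rw [← hf ((sideEquiv ℓ cell).symm ⟨p, x⟩)]
    congr 1
    rw [Equiv.symm_apply_eq, sideEquiv_sideNext, Equiv.apply_symm_apply]
  have hs : s = (sideEquiv ℓ cell).symm (sideEquiv ℓ cell s) := by simp
  have hs' : s' = (sideEquiv ℓ cell).symm (sideEquiv ℓ cell s') := by simp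
  revert h hs hs'
  generalize sideEquiv ℓ cell s = a
  generalize sideEquiv ℓ cell s' = b
  obtain ⟨p, x⟩ := a
  obtain ⟨q, y⟩ := b
  rintro h hs hs'
  obtain rfl : p = q := h
  rw [hs, hs']
  exact h1 p x y

/-- The cycles of the rotation of the sides are the polygons with at least one side. -/
theorem numCycles_sideNext : (sideNext ℓ cell).numCycles =
    Nat.card {p : StuffedPolygon ℓ cell // 0 < polyLen ℓ cell p} := by
  have e : {f : StuffedSide ℓ cell → Fin 2 // ∀ s, f (sideNext ℓ cell s) = f s} ≃
      ({p : StuffedPolygon ℓ cell // 0 < polyLen ℓ cell p} → Fin 2) :=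
    { toFun := fun f p => f.1 ((sideEquiv ℓ cell).symm ⟨p.1, ⟨0, p.2⟩⟩)
      invFun := fun g => ⟨fun s => g ⟨(sideEquiv ℓ cell s).1, (sideEquiv ℓ cell s).2.pos⟩,
        fun s => congrArg g (Subtype.ext (by
          have h := congrArg Sigma.fst (sideEquiv_sideNext ℓ cell s)
          exact h))⟩
      left_inv := fun f => Subtype.ext (funext fun s =>
        eq_of_sideNext_invariant f.2 (by rw [Equiv.apply_symm_apply]))
      right_inv := fun g => funext fun p => by
        dsimp only
        congr 1
        exact Subtype.ext (by rw [Equiv.apply_symm_apply]) }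
  have h := Nat.card_congr (((sideNext ℓ cell).invariantEquiv (Fin 2)).symm.trans e)
  rw [Nat.card_fun, Nat.card_fun, Nat.card_fin] at h
  exact Nat.pow_right_injective le_rfl h

theorem numCycles_sideNext_add : (sideNext ℓ cell).numCycles + Nat.card {j : Fin n // ℓ j = 0} =
    n + ∑ i, (cell i).1.bdry := by
  have e : {p : StuffedPolygon ℓ cell // ¬ 0 < polyLen ℓ cell p} ≃ {j : Fin n // ℓ j = 0} :=
    { toFun := fun p => match p with
        | ⟨Sum.inl j, h⟩ => ⟨j, Nat.eq_zero_of_not_pos h⟩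
        | ⟨Sum.inr b, h⟩ => absurd (polyLen_inr_pos b) h
      invFun := fun j => ⟨Sum.inl j.1, fun h => h.ne' j.2⟩
      left_inv := by
        rintro ⟨j | b, h⟩
        · rfl
        · exact absurd (polyLen_inr_pos b) h
      right_inv := fun j => rfl }
  rw [numCycles_sideNext, ← Nat.card_congr e, ← Nat.card_sum,
    Nat.card_congr (Equiv.sumCompl fun p : StuffedPolygon ℓ cell => 0 < polyLen ℓ cell p),
    Nat.card_sum, Nat.card_sigma, Nat.card_fin]
  simp [ElemCell.bdry]

end Polygons

namespace StuffedMap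

variable {𝒞 : Finset ElemCell} {n : ℕ} {ℓ : Fin n → ℕ}

/-- The functions of the sides which are constant on polygons and compatible with the gluing, with
arbitrary values at the marked faces of perimeter `0`, as functions of the polygons. -/
noncomputable def polygonValue (M : StuffedMap 𝒞 ℓ) (p : StuffedPolygon ℓ M.cell) :
    ((M.next.invariants ⊓ M.glue.invariants : Submodule ℚ (M.Side → ℚ)) ×
      ({j : Fin n // ℓ j = 0} → ℚ)) →ₗ[ℚ] ℚ :=
  if h : 0 < polyLen ℓ M.cell p then
    LinearMap.proj ((sideEquiv ℓ M.cell).symm ⟨p, ⟨0, h⟩⟩) ∘ₗ Submodule.subtype _ ∘ₗ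
      LinearMap.fst ℚ _ _
  else match p, h with
    | Sum.inl j, h => LinearMap.proj (⟨j, Nat.eq_zero_of_not_pos h⟩ : {j : Fin n // ℓ j = 0}) ∘ₗ
        LinearMap.snd ℚ _ _
    | Sum.inr b, h => absurd (polyLen_inr_pos b) h

theorem polygonValue_side (M : StuffedMap 𝒞 ℓ)
    (x : (M.next.invariants ⊓ M.glue.invariants : Submodule ℚ (M.Side → ℚ)) ×
      ({j : Fin n // ℓ j = 0} → ℚ)) (s : M.Side) :
    M.polygonValue (sideEquiv ℓ M.cell s).1 x = x.1.1 s := by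
  rw [polygonValue, dif_pos (sideEquiv ℓ M.cell s).2.pos]
  refine eq_of_sideNext_invariant (f := x.1.1)
    (Equiv.Perm.mem_invariants.1 (Submodule.mem_inf.1 x.1.2).1) ?_
  rw [Equiv.apply_symm_apply]

/-- For a connected map, a function that is constant on polygons and compatible with the gluing is
determined by its value on one marked face and its differences within each unmarked piece. -/
theorem finrank_add_card_le (M : StuffedMap 𝒞 ℓ) (hM : M.IsConnected) (p : Fin n) :
    Module.finrank ℚ (M.next.invariants ⊓ M.glue.invariants : Submodule ℚ (M.Side → ℚ)) +
      Nat.card {j : Fin n // ℓ j = 0} ≤ 1 + ∑ i, ((M.cell i).1.bdry - 1) := by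
  classical
  let V := (M.next.invariants ⊓ M.glue.invariants : Submodule ℚ (M.Side → ℚ)) ×
      ({j : Fin n // ℓ j = 0} → ℚ)
  let Θ : V →ₗ[ℚ] ℚ × ((Σ i : Fin M.numCells, Fin ((M.cell i).1.bdry - 1)) → ℚ) :=
    LinearMap.prod (M.polygonValue (Sum.inl p)) (LinearMap.pi fun b =>
      M.polygonValue (Sum.inr ⟨b.1, ⟨b.2 + 1, Nat.add_lt_of_lt_sub b.2.2⟩⟩) -
        M.polygonValue (Sum.inr ⟨b.1, ⟨0, (M.cell b.1).1.bdry_pos⟩⟩))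
  have hΘ : Function.Injective Θ := by
    rw [← LinearMap.ker_eq_bot, LinearMap.ker_eq_bot']
    intro x hx
    have h1 : M.polygonValue (Sum.inl p) x = 0 := congrArg Prod.fst hx
    have h2 : ∀ i (b : Fin (M.cell i).1.perims.length), M.polygonValue (Sum.inr ⟨i, b⟩) x =
        M.polygonValue (Sum.inr ⟨i, ⟨0, (M.cell i).1.bdry_pos⟩⟩) x := by
      intro i b
      obtain ⟨b, hb⟩ := b
      cases b with
      | zero => rfl
      | succ b => exact sub_eq_zero.1 (congrFun (congrArg Prod.snd hx)
          ⟨i, ⟨b, Nat.lt_sub_of_add_lt hb⟩⟩)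
    have h3 : ∀ q q' : StuffedPolygon ℓ M.cell, polyPiece ℓ M.cell q = polyPiece ℓ M.cell q' →
        M.polygonValue q x = M.polygonValue q' x := by
      rintro (j | ⟨i, b⟩) (j' | ⟨i', b'⟩) h
      · obtain rfl : j = j' := Sum.inl_injective h
        rfl
      · exact absurd h Sum.inl_ne_inr
      · exact absurd h Sum.inr_ne_inl
      · obtain rfl : i = i' := Sum.inr_injective h
        rw [h2 i b, h2 i b']
    have h4 := (M.isConnected_iff (Sum.inl p)).1 hM
      (Finset.univ.filter fun r => ∀ q, polyPiece ℓ M.cell q = r → M.polygonValue q x = 0)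
      (by
        simp only [Finset.mem_filter, Finset.mem_univ, true_and]
        intro q hq
        rw [h3 q (Sum.inl p) hq, h1])
      (by
        intro s hs
        simp only [Finset.mem_filter, Finset.mem_univ, true_and] at hs ⊢
        have h5 := hs _ (sidePiece_eq ℓ M.cell s).symm
        rw [polygonValue_side,
          ← Equiv.Perm.mem_invariants.1 (Submodule.mem_inf.1 x.1.2).2 s, ← polygonValue_side] at h5
        intro q hq
        rw [h3 q _ (hq.trans (sidePiece_eq ℓ M.cell (M.glue s))), h5])
    have h5 : ∀ q, M.polygonValue q x = 0 := fun q => by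
      have h6 := Finset.mem_univ (polyPiece ℓ M.cell q)
      rw [← h4] at h6
      exact (Finset.mem_filter.1 h6).2 q rfl
    refine Prod.ext (Subtype.ext (funext fun s => ?_)) (funext fun j => ?_)
    · rw [← polygonValue_side, h5]
      rfl
    · have h6 := h5 (Sum.inl j.1)
      rw [polygonValue, dif_neg (by change ¬ 0 < ℓ j.1; omega)] at h6
      exact h6
  have h := LinearMap.finrank_le_finrank_of_injective hΘ
  rw [Module.finrank_prod, Module.finrank_prod, Module.finrank_self,
    Module.finrank_fintype_fun_eq_card, Module.finrank_fintype_fun_eq_card, Fintype.card_sigma] at h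
  simpa [Nat.card_eq_fintype_card] using h

/-- A connected stuffed map with a marked face has a genus. -/
theorem exists_hasGenus (M : StuffedMap 𝒞 ℓ) (hn : 1 ≤ n) (hM : M.IsConnected) :
    ∃ g, M.HasGenus g := by
  have h1 := Equiv.Perm.numCycles_add_le M.next M.glue
  have h2 := Equiv.Perm.even_numCycles_add M.next M.glue
  have h3 := M.finrank_add_card_le hM ⟨0, hn⟩
  have h4 := M.two_mul_numEdges
  have h5 : M.next.numCycles + Nat.card {j : Fin n // ℓ j = 0} = n + ∑ i, (M.cell i).1.bdry :=
    numCycles_sideNext_add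
  have h6 : M.glue.numCycles = M.numEdges := rfl
  have h7 : M.numVertices = (M.next * M.glue).numCycles + Nat.card {j : Fin n // ℓ j = 0} := rfl
  have h8 : ∑ i, (M.cell i).1.euler = 2 * (M.numCells : ℤ) - 2 * ((∑ i, (M.cell i).1.genus : ℕ) : ℤ)
      - ((∑ i, (M.cell i).1.bdry : ℕ) : ℤ) := by
    push_cast
    simp only [ElemCell.euler, Finset.sum_sub_distrib, ← Finset.mul_sum]
    simp
    ring
  have h9 : ∑ i, ((M.cell i).1.bdry - 1) + M.numCells = ∑ i, (M.cell i).1.bdry := by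
    have : ∀ i, ((M.cell i).1.bdry - 1) + 1 = (M.cell i).1.bdry := fun i =>
      Nat.sub_add_cancel (M.cell i).1.bdry_pos
    rw [← Finset.sum_congr rfl fun i _ => this i, Finset.sum_add_distrib]
    simp
  have h10 : M.euler = M.numVertices - M.numEdges + n + ∑ i, (M.cell i).1.euler := rfl
  -- `h2` gives the parity; `h1` and `h3` give `χ ≤ 2`, as genera of unmarked pieces only lower `χ`
  rw [h6, ← h4] at h1 h2
  obtain ⟨c, hc⟩ := h2
  refine ⟨((2 - M.euler) / 2).toNat, hM, ?_⟩
  have : 0 ≤ (2 - M.euler) / 2 := by omega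
  rw [Int.toNat_of_nonneg this]
  omega

end StuffedMap

/-! ### Invariance under isomorphisms -/

theorem Equiv.Perm.numCycles_eq_of_equiv {α β : Type*} [Finite α] [Finite β] {σ : Equiv.Perm α}
    {τ : Equiv.Perm β} (e : α ≃ β) (h : ∀ x, e (σ x) = τ (e x)) : σ.numCycles = τ.numCycles := by
  have e' : {f : β → Fin 2 // ∀ x, f (τ x) = f x} ≃ {f : α → Fin 2 // ∀ x, f (σ x) = f x} :=
    (Equiv.arrowCongr e.symm (Equiv.refl _)).subtypeEquiv fun f => by
      rw [← e.forall_congr_right]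
      simp [h]
  have h := Nat.card_congr ((τ.invariantEquiv (Fin 2)).symm.trans (e'.trans (σ.invariantEquiv _)))
  rw [Nat.card_fun, Nat.card_fun, Nat.card_fin] at h
  exact (Nat.pow_right_injective le_rfl h).symm

namespace StuffedMap

variable {𝒞 : Finset ElemCell} {n m : ℕ} {ℓ : Fin n → ℕ}

theorem Iso.numVertices_eq {M M' : StuffedMap 𝒞 ℓ} (e : Iso M M') :
    M.numVertices = M'.numVertices :=
  congrArg (· + _) (Equiv.Perm.numCycles_eq_of_equiv (σ := M.next * M.glue)
    (τ := M'.next * M'.glue) e.side fun x => by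
      rw [Equiv.Perm.mul_apply, Equiv.Perm.mul_apply, e.next_eq, e.glue_eq])

theorem Iso.euler_eq {M M' : StuffedMap 𝒞 ℓ} (e : Iso M M') : M.euler = M'.euler := by
  have h1 : M.numEdges = M'.numEdges := Equiv.Perm.numCycles_eq_of_equiv e.side e.glue_eq
  have h2 : ∑ i, (M.cell i).1.euler = ∑ i, (M'.cell i).1.euler :=
    Fintype.sum_equiv e.onCells _ _ fun i => by rw [e.cell_eq]
  rw [euler, euler, e.numVertices_eq, h1, h2]

theorem Iso.isConnected {M M' : StuffedMap 𝒞 ℓ} (e : Iso M M') (h : M.IsConnected) :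
    M'.IsConnected := by
  let w : Fin n ⊕ Fin M.numCells ≃ Fin n ⊕ Fin M'.numCells := Equiv.sumCongr (Equiv.refl _) e.onCells
  have hp : ∀ s, M'.piece (e.side s) = w (M.piece s) := e.piece_eq
  have hr : ∀ p q, (∃ s, M'.piece s = w p ∧ M'.piece (M'.glue s) = w q) ↔
      ∃ s, M.piece s = p ∧ M.piece (M.glue s) = q := by
    intro p q
    rw [← e.side.exists_congr_right]
    simp only [← e.glue_eq, hp, w.injective.eq_iff]
  let u : (SimpleGraph.fromRel fun p q => ∃ s, M.piece s = p ∧ M.piece (M.glue s) = q) ≃g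
      (SimpleGraph.fromRel fun p q => ∃ s, M'.piece s = p ∧ M'.piece (M'.glue s) = q) :=
    { toEquiv := w
      map_rel_iff' := by
        intro p q
        rw [SimpleGraph.fromRel_adj, SimpleGraph.fromRel_adj, hr, hr, w.injective.ne_iff] }
  exact u.connected_iff.1 h

theorem Iso.hasGenus {M M' : StuffedMap 𝒞 ℓ} (e : Iso M M') {g : ℕ} (h : M.HasGenus g) :
    M'.HasGenus g := ⟨e.isConnected h.1, e.euler_eq ▸ h.2⟩

end StuffedMap

theorem mem_stuffedClasses {𝒞 : Finset ElemCell} {g n : ℕ} {q : StuffedClass 𝒞 n} :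
    q ∈ stuffedClasses 𝒞 g n ↔ (Quotient.out q.2).HasGenus g := by
  constructor
  · rintro ⟨M, hM, hg⟩
    rw [← hM]
    obtain ⟨e⟩ := Quotient.mk_out (s := StuffedMap.isoSetoid 𝒞 q.1) M
    exact e.symm.hasGenus hg
  · intro h
    exact ⟨_, Quotient.out_eq q.2, h⟩

/-! ### Coefficients of the generating series of stuffed maps -/

namespace StuffedMap

variable {𝒞 : Finset ElemCell} {n m : ℕ} {ℓ : Fin n → ℕ}

open Classical in
/-- The weight of a stuffed map is a single monomial. -/
theorem coef_weight (M : StuffedMap 𝒞 ℓ) (x : Fin n →₀ ℕ) (v : ℕ) (k : 𝒞 →₀ ℕ) :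
    M.weight.coef x v k =
      if x = faceExp ℓ Finset.univ ∧ v = M.numVertices ∧ k = M.cellCount then
        (∏ i, (1 / (M.cell i).1.orderings)) / Nat.card (Iso M M) else 0 := by
  have h1 : MvPolynomial.C (1 / (Nat.card (Iso M M) : ℚ)) *
      ∏ i, (MvPolynomial.C (1 / (M.cell i).1.orderings) * MvPolynomial.X (M.cell i)) =
      MvPolynomial.monomial M.cellCount
        ((∏ i, (1 / (M.cell i).1.orderings)) / Nat.card (Iso M M)) := by
    rw [cellCount, typeCount, MvPolynomial.monomial_sum_index, Finset.prod_mul_distrib,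
      ← map_prod, ← mul_assoc, ← map_mul, one_div_mul_eq_div]
    rfl
  have h2 : (Finsupp.equivFunOnFinite.symm fun j => ℓ j + 1) = faceExp ℓ Finset.univ := by
    ext j
    simp [faceExp_apply]
  rw [GenSeries.coef, weight, h1, h2, MvPowerSeries.coeff_monomial]
  by_cases hx : x = faceExp ℓ Finset.univ
  · rw [if_pos hx, PowerSeries.coeff_monomial]
    by_cases hv : v = M.numVertices
    · rw [if_pos hv, MvPolynomial.coeff_monomial]
      simp [hx, hv, eq_comm]
    · simp [hv]
  · simp [hx]


/-- The isomorphism classes with given numbers of unmarked pieces are the classes of the gluings of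
fixed pieces. -/
theorem finite_cellCount_mem {K : Set (𝒞 →₀ ℕ)} (hK : K.Finite) :
    {c : Quotient (isoSetoid 𝒞 ℓ) | c.out.cellCount ∈ K}.Finite := by
  have : {c : Quotient (isoSetoid 𝒞 ℓ) | c.out.cellCount ∈ K} =
      ⋃ k ∈ K, {c : Quotient (isoSetoid 𝒞 ℓ) | c.out.cellCount = k} := by
    ext c
    simp
  rw [this]
  refine hK.biUnion fun k _ => ?_
  obtain ⟨m, cell, rfl⟩ := exists_typeCount_eq k
  exact (gluingClasses ℓ cell).finite_toSet.subset fun c hc => (mem_gluingClasses cell c).2 hc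

theorem card_side (M : StuffedMap 𝒞 ℓ) :
    Fintype.card M.Side = ∑ j, ℓ j + ∑ i, (M.cell i).1.perims.sum := by
  rw [Fintype.card_sum, Fintype.card_sigma, Fintype.card_sigma]
  congr 1
  · simp
  · refine Finset.sum_congr rfl fun i _ => ?_
    rw [Fintype.card_sigma]
    simp only [Fintype.card_fin]
    simp

theorem sum_cellCount (M : StuffedMap 𝒞 ℓ) : ∑ C, M.cellCount C = M.numCells := by
  simp only [cellCount, typeCount, Finsupp.finsetSum_apply]
  rw [Finset.sum_comm]
  classical
  simp [Finsupp.single_apply]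

end StuffedMap

namespace StuffedMap

variable {P : GeometryModel} {n : ℕ} {ℓ : Fin n → ℕ}

/-- For every 2-cell of the model, the number of boundary sides, each counted as half an edge, exceeds
the Euler characteristic. -/
theorem _root_.GeometryModel.one_le_of_mem_cells {C : ElemCell} (hC : C ∈ P.cells) :
    1 ≤ (C.perims.sum : ℤ) - 2 * C.euler := by
  have hC' : C ∈ P.unstableCells ∪ P.stableCells := by
    simpa [GeometryModel.cells] using hC
  have hb := C.bdry_pos
  rcases hC' with (⟨hg, l, hl, -, hp⟩ | ⟨hg, a, b, -, -, h2, -, hp⟩) | ⟨s, hs, -, hg, -⟩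
  · simp [ElemCell.euler, ElemCell.bdry, hg, hp]
    omega
  · simp [ElemCell.euler, ElemCell.bdry, hg, hp]
    omega
  · rw [ElemCell.euler, hg]
    omega

/-- The numbers of vertices and the genus bound the number of unmarked pieces. -/
theorem numCells_le (M : StuffedMap P.cells ℓ) {g : ℕ} (h : M.HasGenus g) :
    M.numCells ≤ 2 * M.numVertices + 2 * n + 4 * g := by
  have h1 := M.two_mul_numEdges
  rw [card_side] at h1
  have h2 := h.2
  rw [euler] at h2
  have h3 : (M.numCells : ℤ) ≤
      ((∑ i, (M.cell i).1.perims.sum : ℕ) : ℤ) - 2 * ∑ i, (M.cell i).1.euler := by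
    push_cast
    rw [Finset.mul_sum, ← Finset.sum_sub_distrib]
    have := Finset.sum_le_sum fun i (_ : i ∈ Finset.univ) =>
      GeometryModel.one_le_of_mem_cells (M.cell i).2
    simpa using this
  omega

end StuffedMap

section Coefficients

variable {𝒞 : Finset ElemCell} {n m : ℕ} {ℓ : Fin n → ℕ}

/-- Each coefficient in `t` and the `x_j⁻¹` receives finitely many contributions. -/
theorem finite_contributions (P : GeometryModel) (g n : ℕ) (x : Fin n →₀ ℕ) (v : ℕ) :
    {q ∈ stuffedClasses P.cells g n |
        PowerSeries.coeff v (MvPowerSeries.coeff x q.weight) ≠ 0}.Finite := by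
  classical
  have hK : {k : P.cells →₀ ℕ | ∀ C, k C ≤ 2 * v + 2 * n + 4 * g}.Finite := by
    refine Set.Finite.of_injOn (f := fun k : P.cells →₀ ℕ => (k : P.cells → ℕ))
      (t := Set.Iic fun _ => 2 * v + 2 * n + 4 * g) (fun k hk => hk)
      DFunLike.coe_injective.injOn (Set.finite_Iic _)
  -- the perimeter of the `j`-th marked face is the exponent of `x_j⁻¹` minus one
  refine ((StuffedMap.finite_cellCount_mem (ℓ := fun j => x j - 1) hK).image
    fun c => (⟨_, c⟩ : StuffedClass P.cells n)).subset ?_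
  rintro ⟨ℓ, c⟩ ⟨h1, h2⟩
  have h3 : ∃ k, (c.out).weight.coef x v k ≠ 0 := by
    by_contra hcon
    push Not at hcon
    exact h2 (MvPolynomial.ext _ _ hcon)
  obtain ⟨k, hk⟩ := h3
  rw [StuffedMap.coef_weight] at hk
  obtain ⟨⟨hx, hv, -⟩, -⟩ := ite_ne_right_iff.1 hk
  have hℓ : (fun j => x j - 1) = ℓ := by
    funext j
    rw [hx, faceExp_apply]
    simp
  subst hℓ
  refine ⟨c, fun C => ?_, rfl⟩
  have h4 := (Quotient.out c).numCells_le (mem_stuffedClasses.1 h1)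
  rw [← hv, ← StuffedMap.sum_cellCount] at h4
  exact (Finset.single_le_sum (fun _ _ => Nat.zero_le _) (Finset.mem_univ C)).trans h4

theorem coef_stuffedSeries {g : ℕ} {x : Fin n →₀ ℕ} {v : ℕ}
    (hfin : {q ∈ stuffedClasses 𝒞 g n |
        PowerSeries.coeff v (MvPowerSeries.coeff x q.weight) ≠ 0}.Finite) (k : 𝒞 →₀ ℕ) :
    (stuffedSeries 𝒞 g n).coef x v k = ∑ᶠ q ∈ stuffedClasses 𝒞 g n, q.weight.coef x v k := by
  have h : PowerSeries.coeff v (MvPowerSeries.coeff x (stuffedSeries 𝒞 g n)) =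
      ∑ᶠ q ∈ stuffedClasses 𝒞 g n, PowerSeries.coeff v (MvPowerSeries.coeff x q.weight) :=
    PowerSeries.coeff_mk v fun v => ∑ᶠ q ∈ stuffedClasses 𝒞 g n,
      PowerSeries.coeff v (MvPowerSeries.coeff x q.weight)
  rw [GenSeries.coef, h]
  exact (MvPolynomial.lcoeff ℚ k).toAddMonoidHom.map_finsum_mem' hfin

theorem coef_stuffedSeries_eq_zero {g : ℕ} {x : Fin n →₀ ℕ} {v : ℕ}
    (hfin : {q ∈ stuffedClasses 𝒞 g n |
        PowerSeries.coeff v (MvPowerSeries.coeff x q.weight) ≠ 0}.Finite) (k : 𝒞 →₀ ℕ)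
    {j : Fin n} (hj : x j = 0) : (stuffedSeries 𝒞 g n).coef x v k = 0 := by
  classical
  rw [coef_stuffedSeries hfin]
  refine finsum_mem_eq_zero_of_forall_eq_zero fun q _ => ?_
  rw [StuffedClass.weight, StuffedMap.coef_weight, if_neg]
  rintro ⟨rfl, -⟩
  simp [faceExp_apply] at hj

open Classical in
/-- The coefficients of the generating series: the sum over the gluings of labelled pieces, divided
by the number of relabellings. -/
theorem coef_stuffedSeries_eq_sum {g v : ℕ} (cell : Fin m → 𝒞)
    (hfin : {q ∈ stuffedClasses 𝒞 g n | PowerSeries.coeff v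
      (MvPowerSeries.coeff (faceExp ℓ Finset.univ) q.weight) ≠ 0}.Finite) :
    ((stuffedSeries 𝒞 g n).coef (faceExp ℓ Finset.univ) v (typeCount cell Finset.univ) : ℝ) =
      (∏ i, ((1 / (cell i).1.orderings : ℚ) : ℝ)) / Nat.card (StuffedMap.Relabelling ℓ cell) *
        ∑ α, if (StuffedMap.ofPairing ℓ cell α).HasGenus g ∧
          (StuffedMap.ofPairing ℓ cell α).numVertices = v then (1 : ℝ) else 0 := by
  let e : Quotient (StuffedMap.isoSetoid 𝒞 ℓ) ↪ StuffedClass 𝒞 n :=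
    ⟨fun c => (⟨ℓ, c⟩ : StuffedClass 𝒞 n), fun c c' h => eq_of_heq (Sigma.mk.inj h).2⟩
  let T : Finset (StuffedClass 𝒞 n) :=
    ((StuffedMap.gluingClasses ℓ cell).filter fun c => c.out.HasGenus g).map e
  rw [coef_stuffedSeries hfin, finsum_mem_eq_sum_of_inter_support_eq (t := T), Finset.sum_map,
    Finset.sum_filter]
  · rw [div_mul_eq_mul_div, mul_div_assoc, ← StuffedMap.sum_gluingClasses cell
      (fun M => if M.HasGenus g ∧ M.numVertices = v then (1 : ℝ) else 0)]
    · push_cast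
      rw [Finset.mul_sum]
      refine Finset.sum_congr rfl fun c hc => ?_
      have hk := (StuffedMap.mem_gluingClasses cell c).1 hc
      have hprod : ∏ i, (1 / (c.out.cell i).1.orderings) = ∏ i, (1 / (cell i).1.orderings) := by
        rw [← prod_pow_typeCount cell Finset.univ fun C => 1 / C.1.orderings, ← hk]
        exact (prod_pow_typeCount c.out.cell Finset.univ fun C => 1 / C.1.orderings).symm
      have hw : (e c).weight = c.out.weight := rfl
      rw [hw, StuffedMap.coef_weight, hprod]
      by_cases hg : c.out.HasGenus g
      · by_cases hv : c.out.numVertices = v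
        · simp [hg, hv, hk]
          ring
        · simp [hg, hv, Ne.symm hv]
      · simp [hg]
    · intro M M' e
      rw [e.numVertices_eq]
      exact if_congr (and_congr_left fun _ => ⟨e.hasGenus, e.symm.hasGenus⟩) rfl rfl
  · ext q
    simp only [Set.mem_inter_iff, Function.mem_support, and_congr_left_iff]
    intro hne
    obtain ⟨ℓ', c⟩ := q
    change (Quotient.out c).weight.coef _ _ _ ≠ 0 at hne
    rw [StuffedMap.coef_weight] at hne
    obtain ⟨⟨hx, -, hk⟩, -⟩ := ite_ne_right_iff.1 hne
    have hℓ : ℓ' = ℓ := by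
      funext j
      have := DFunLike.congr_fun hx j
      simpa [faceExp_apply] using this.symm
    subst hℓ
    have hc := (StuffedMap.mem_gluingClasses cell c).2 hk.symm
    refine (mem_stuffedClasses (q := e c)).trans (Iff.trans ?_ (Finset.mem_coe.trans Finset.mem_map).symm)
    constructor
    · exact fun h => ⟨c, Finset.mem_filter.2 ⟨hc, h⟩, rfl⟩
    · rintro ⟨c', h, he⟩
      obtain rfl : c' = c := eq_of_heq (Sigma.mk.inj he).2
      exact (Finset.mem_filter.1 h).2

end Coefficients

/-! ### The topological expansion -/

theorem integrable_prod_map_trPow {N : ℕ} {t : ℝ} (hN : 1 ≤ N) (ht : 0 < t) (L : List ℕ) :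
    Integrable (fun h : HermCoord N => (L.map (trPow h)).prod) (gaussianHerm N t) := by
  have : NeZero N := ⟨by omega⟩
  have h := (integral_prod_trPow (ι := Σ p : Fin L.length, Fin (L.get p)) (fun p => L.get p)
    (Equiv.refl _) (Equiv.sigmaCongrRight fun _ => finRotate _) id Sigma.fst hN ht (fun _ => rfl)
    (fun _ => rfl) Finset.univ).1
  refine h.congr (Filter.Eventually.of_forall fun x => ?_)
  dsimp only
  simp only [Finset.mem_univ, Finset.filter_true]
  exact Fin.prod_univ_fun_getElem L (trPow x)

/-- The sum over the genus, for a single stuffed map. -/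
theorem finsum_hasGenus {𝒞 : Finset ElemCell} {n : ℕ} {ℓ : Fin n → ℕ} (M : StuffedMap 𝒞 ℓ)
    (hn : 1 ≤ n) (a b : ℝ) [Decidable M.IsConnected] [∀ g, Decidable (M.HasGenus g)] :
    (Function.support fun g : ℕ => a ^ (2 - 2 * (g : ℤ) - n) * if M.HasGenus g then b else 0).Finite ∧
      ∑ᶠ g : ℕ, a ^ (2 - 2 * (g : ℤ) - n) * (if M.HasGenus g then b else 0) =
        if M.IsConnected then a ^ (M.euler - n) * b else 0 := by
  by_cases hM : M.IsConnected
  · obtain ⟨g, hg⟩ := M.exists_hasGenus hn hM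
    have huniq : ∀ g', g' ≠ g → (a ^ (2 - 2 * (g' : ℤ) - n) * if M.HasGenus g' then b else 0) = 0 := by
      intro g' hne
      rw [if_neg, mul_zero]
      intro hg'
      have h1 := hg.2
      have h2 := hg'.2
      omega
    refine ⟨(Set.finite_singleton g).subset fun g' h => not_not.1 fun hne => h (huniq g' hne), ?_⟩
    rw [finsum_eq_single _ g huniq, if_pos hg, if_pos hM, hg.2]
  · have hz : ∀ g : ℕ, (a ^ (2 - 2 * (g : ℤ) - n) * if M.HasGenus g then b else 0) = 0 := fun g => by
      rw [if_neg fun h => hM h.1, mul_zero]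
    rw [if_neg hM]
    simp only [hz, finsum_zero, and_true]
    exact Set.finite_empty.subset fun g h => h rfl

section Expansion

variable {𝒞 : Finset ElemCell} {n m : ℕ} {ℓ : Fin n → ℕ}

/-- A monomial that is divisible by every `x_j⁻¹` is the monomial of some perimeters. -/
theorem eq_faceExp {x : Fin n →₀ ℕ} (hx : ∀ j, x j ≠ 0) :
    x = faceExp (fun j => x j - 1) Finset.univ := by
  ext j
  have := hx j
  simp only [faceExp_apply, Finset.mem_univ, if_true]
  omega

theorem finite_coef_stuffedSeries {g : ℕ}
    (hfin : ∀ x v, {q ∈ stuffedClasses 𝒞 g n | PowerSeries.coeff v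
      (MvPowerSeries.coeff x q.weight) ≠ 0}.Finite) (x : Fin n →₀ ℕ) (k : 𝒞 →₀ ℕ) :
    {v : ℕ | (stuffedSeries 𝒞 g n).coef x v k ≠ 0}.Finite := by
  classical
  by_cases hx : ∀ j, x j ≠ 0
  · obtain ⟨m, cell, rfl⟩ := exists_typeCount_eq k
    rw [eq_faceExp hx]
    refine (Set.finite_range fun α =>
      (StuffedMap.ofPairing (fun j => x j - 1) cell α).numVertices).subset fun v hv => ?_
    by_contra hcon
    have h := coef_stuffedSeries_eq_sum (g := g) (v := v) (ℓ := fun j => x j - 1) cell (hfin _ _)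
    rw [Finset.sum_eq_zero, mul_zero] at h
    · exact hv (by exact_mod_cast h)
    · intro α _
      exact if_neg fun h => hcon ⟨α, h.2⟩
  · push Not at hx
    obtain ⟨j, hj⟩ := hx
    simp [coef_stuffedSeries_eq_zero (hfin _ _) k hj]

open Classical in
/-- At a number `t`, the sum over the powers of `t` becomes a sum over the gluings of genus `g`. -/
theorem coeff_atT_stuffedSeries {g : ℕ} (cell : Fin m → 𝒞) (t : ℝ)
    (hfin : ∀ x v, {q ∈ stuffedClasses 𝒞 g n | PowerSeries.coeff v
      (MvPowerSeries.coeff x q.weight) ≠ 0}.Finite) :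
    MvPowerSeries.coeff (Finsupp.sumElim (faceExp ℓ Finset.univ) (typeCount cell Finset.univ))
      ((stuffedSeries 𝒞 g n).atT t) =
      (∏ i, ((1 / (cell i).1.orderings : ℚ) : ℝ)) / Nat.card (StuffedMap.Relabelling ℓ cell) *
        ∑ α, if (StuffedMap.ofPairing ℓ cell α).HasGenus g then
          t ^ (StuffedMap.ofPairing ℓ cell α).numVertices else 0 := by
  set c := (∏ i, ((1 / (cell i).1.orderings : ℚ) : ℝ)) /
    Nat.card (StuffedMap.Relabelling ℓ cell) with hc
  have h1 : MvPowerSeries.coeff (Finsupp.sumElim (faceExp ℓ Finset.univ)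
      (typeCount cell Finset.univ)) ((stuffedSeries 𝒞 g n).atT t) =
      ∑ᶠ v : ℕ, ((stuffedSeries 𝒞 g n).coef (faceExp ℓ Finset.univ) v
        (typeCount cell Finset.univ) : ℝ) * t ^ v := by
    change ∑ᶠ v : ℕ, _ = _
    refine finsum_congr fun v => ?_
    congr 3
    · ext j; simp
    · ext C; simp
  have h2 : ∀ v : ℕ, ((stuffedSeries 𝒞 g n).coef (faceExp ℓ Finset.univ) v
      (typeCount cell Finset.univ) : ℝ) * t ^ v =
      ∑ α, if v = (StuffedMap.ofPairing ℓ cell α).numVertices then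
        c * (if (StuffedMap.ofPairing ℓ cell α).HasGenus g then
          t ^ (StuffedMap.ofPairing ℓ cell α).numVertices else 0) else 0 := by
    intro v
    rw [coef_stuffedSeries_eq_sum cell (hfin _ _), ← hc, mul_assoc, Finset.sum_mul, Finset.mul_sum]
    refine Finset.sum_congr rfl fun α _ => ?_
    by_cases hv : v = (StuffedMap.ofPairing ℓ cell α).numVertices
    · by_cases hg : (StuffedMap.ofPairing ℓ cell α).HasGenus g
      · rw [if_pos ⟨hg, hv.symm⟩, if_pos hv, if_pos hg, hv, one_mul]
      · rw [if_neg fun h => hg h.1, if_pos hv, if_neg hg, zero_mul]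
    · rw [if_neg fun h => hv h.2.symm, if_neg hv, zero_mul, mul_zero]
  rw [h1, finsum_congr h2, finsum_sum_comm, Finset.mul_sum]
  · refine Finset.sum_congr rfl fun α _ => ?_
    rw [finsum_eq_single _ (StuffedMap.ofPairing ℓ cell α).numVertices fun v hv => if_neg hv,
      if_pos rfl]
  · intro α _
    refine (Set.finite_singleton (StuffedMap.ofPairing ℓ cell α).numVertices).subset fun v hv => ?_
    by_contra hne
    exact hv (if_neg hne)

theorem isFormalSum_connectedCorr {N : ℕ} {t : ℝ} (hN : 1 ≤ N) (ht : 0 < t) (hn : 1 ≤ n)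
    (hfin : ∀ g x v, {q ∈ stuffedClasses 𝒞 g n | PowerSeries.coeff v
      (MvPowerSeries.coeff x q.weight) ≠ 0}.Finite) :
    IsFormalSum
      (fun g => (((N : ℝ) / t) ^ (2 - 2 * (g : ℤ) - (n : ℤ))) • (stuffedSeries 𝒞 g n).atT t)
      (connectedCorr 𝒞 n N t) := by
  classical
  intro e
  rw [← sumElim_fst_snd e]
  set x := (Finsupp.sumFinsuppEquivProdFinsupp e).1 with hxe
  set k := (Finsupp.sumFinsuppEquivProdFinsupp e).2 with hke
  by_cases hx : ∀ j, x j ≠ 0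
  · obtain ⟨m, cell, hcell⟩ := exists_typeCount_eq k
    obtain ⟨ℓ, hℓ⟩ : ∃ ℓ, x = faceExp ℓ Finset.univ := ⟨_, eq_faceExp hx⟩
    rw [hℓ, ← hcell, StuffedMap.coeff_connectedCorr hN ht hn]
    set c := (∏ i, ((1 / (cell i).1.orderings : ℚ) : ℝ)) /
      Nat.card (StuffedMap.Relabelling ℓ cell) with hc
    have h1 : ∀ g : ℕ, MvPowerSeries.coeff
        (Finsupp.sumElim (faceExp ℓ Finset.univ) (typeCount cell Finset.univ))
        ((((N : ℝ) / t) ^ (2 - 2 * (g : ℤ) - (n : ℤ))) • (stuffedSeries 𝒞 g n).atT t) =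
        ∑ α, ((N : ℝ) / t) ^ (2 - 2 * (g : ℤ) - (n : ℤ)) *
          (if (StuffedMap.ofPairing ℓ cell α).HasGenus g then
            c * t ^ (StuffedMap.ofPairing ℓ cell α).numVertices else 0) := by
      intro g
      rw [map_smul, smul_eq_mul, coeff_atT_stuffedSeries cell t (hfin g), ← hc, Finset.mul_sum,
        Finset.mul_sum]
      simp only [mul_ite, mul_zero]
    have h2 := fun α => finsum_hasGenus (StuffedMap.ofPairing ℓ cell α) hn ((N : ℝ) / t)
      (c * t ^ (StuffedMap.ofPairing ℓ cell α).numVertices)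
    simp only [h1]
    constructor
    · refine (Set.finite_iUnion fun α => (h2 α).1).subset fun g hg => ?_
      obtain ⟨α, -, hα⟩ := Finset.exists_ne_zero_of_sum_ne_zero hg
      exact Set.mem_iUnion.2 ⟨α, hα⟩
    · rw [finsum_sum_comm _ _ fun α _ => (h2 α).1, Finset.mul_sum]
      refine Finset.sum_congr rfl fun α _ => ?_
      rw [(h2 α).2, mul_ite, mul_zero]
      refine if_congr Iff.rfl ?_ rfl
      ring
  · -- a monomial that misses some `x_j⁻¹` occurs on neither side
    push Not at hx
    obtain ⟨j, hj⟩ := hx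
    have h1 : MvPowerSeries.coeff (Finsupp.sumElim x k) (connectedCorr 𝒞 n N t) = 0 := by
      by_contra hne
      rw [connectedCorr_eq_jointCumulant] at hne
      exact (supportedOn_jointCumulant 𝒞 n N t Finset.univ _ hne j).1 (Finset.mem_univ j)
        (by simpa using hj)
    have h2 : ∀ g : ℕ, MvPowerSeries.coeff (Finsupp.sumElim x k)
        ((((N : ℝ) / t) ^ (2 - 2 * (g : ℤ) - (n : ℤ))) • (stuffedSeries 𝒞 g n).atT t) = 0 := by
      intro g
      have h3 : MvPowerSeries.coeff (Finsupp.sumElim x k) ((stuffedSeries 𝒞 g n).atT t) = 0 := by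
        change ∑ᶠ v : ℕ, _ = _
        refine finsum_eq_zero_of_forall_eq_zero fun v => ?_
        rw [coef_stuffedSeries_eq_zero (hfin g _ _) _ (j := j) (by simpa using hj)]
        simp
      rw [map_smul, h3, smul_zero]
    simp [h1, h2]

end Expansion

theorem mainTheorem3 (P : GeometryModel) (n : ℕ) (hn : 1 ≤ n) :
    -- `W_{g,n}` is a well-defined element of `ℚ[𝐭][[t]][[x⁻¹]]`: each coefficient in `t` and `x⁻¹`
    -- of the sum over `𝕄_{g,n}(𝒞)` receives finitely many contributions
    (∀ (g : ℕ) (m : Fin n →₀ ℕ) (v : ℕ),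
      {q ∈ stuffedClasses P.cells g n |
        PowerSeries.coeff v (MvPowerSeries.coeff m q.weight) ≠ 0}.Finite) ∧
    -- `W_{g,n}` can be evaluated at a number `t` as a formal series in `𝐭` and `x⁻¹`
    (∀ (g : ℕ) (m : Fin n →₀ ℕ) (k : P.cells →₀ ℕ),
      {v : ℕ | (stuffedSeries P.cells g n).coef m v k ≠ 0}.Finite) ∧
    ∀ (N : ℕ) (t : ℝ), 1 ≤ N → 0 < t →
      -- the formal matrix integrals make sense
      IsProbabilityMeasure (gaussianHerm N t) ∧
      (∀ L : List ℕ, Integrable (fun h : HermCoord N => (L.map (trPow h)).prod)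
        (gaussianHerm N t)) ∧
      -- `W_n = ∑_g (N/t)^{2-2g-n} W_{g,n}`
      IsFormalSum
        (fun g => (((N : ℝ) / t) ^ (2 - 2 * (g : ℤ) - (n : ℤ))) • (stuffedSeries P.cells g n).atT t)
        (connectedCorr P.cells n N t) :=
  ⟨fun g m v => finite_contributions P g n m v,
    fun g => finite_coef_stuffedSeries fun x v => finite_contributions P g n x v,
    fun _ _ hN ht => ⟨isProbabilityMeasure_gaussianHerm hN ht, integrable_prod_map_trPow hN ht,
      isFormalSum_connectedCorr hN ht hn fun g x v => finite_contributions P g n x v⟩⟩
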